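/- Conventions. Let $G$ be a finitely generated group, $S$ a finite generating set, and $d_S(g,h)$ the word metric, i.e. the length of a shortest word in $S\cup S^{-1}$ representing $g^{-1}h$. Let $\omega$ be an ultrafilter on $\mathbb N$, $d=(d_n)$ a scaling sequence of real numbers with $\lim^\omega d_n=\infty$, and $e=(e_n)$ a sequence of elements of $G$. The asymptotic cone $\operatorname{Con}^\omega(G,e,d)$ is the metric space of all sequences $(x_n)$ in $G$ for which $d_S(x_n,e_n)/d_n$ is $\omega$-bounded, with distance $\lim^\omega d_S(x_n,y_n)/d_n$, sequences at distance $0$ being identified. A finitely generated group is a prairie group if all of its asymptotic cones (for all $S,\omega,e,d$) are simply connected. A homomorphism $f\colon H\to G$ of finitely generated groups is a quasi-isometric embedding if for all finite generating sets $T$ of $H$ and $S$ of $G$ there are $L\ge 1$, $C\ge 0$ with $\frac1L d_T(x,y)-C\le d_S(f(x),f(y))\le L\,d_T(x,y)+C$ for all $x,y\in H$. Theorem. Let $G$ be one of the following finitely generated groups. (a) An HNN extension $G=\langle A,t\mid tht^{-1}=\varphi(h),\ h\in H\rangle$ of a group $A$, where $\varphi\colon H\to K$ is an isomorphism between proper subgroups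 $H,K$ of $A$ which are prairie groups and whose inclusions into $G$ are quasi-isometric embeddings. (b) An amalgamated product $G=A_1*_H A_2$ of groups $A_1,A_2$ along injective homomorphisms $H\to A_1$ and $H\to A_2$ whose images are proper subgroups, where $H$ is a prairie group and the canonical map $H\to G$ is a quasi-isometric embedding. Then every asymptotic cone of $G$ (for every finite generating set of $G$ and all $\omega,e,d$) is either simply connected or has uncountable fundamental group. -/

import Mathlib

open Filter Topology

universe u v w

/-! ### Word metrics -/

/-- The length of a shortest word in the letters `S ∪ S⁻¹` that represents `g`. (If `S` generates
the group then such a word exists for every `g`; only that case is used.) -/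
noncomputable def wordLength {G : Type*} [Group G] (S : Set G) (g : G) : ℕ :=
  sInf {n : ℕ | ∃ l : List G, l.length = n ∧ (∀ x ∈ l, x ∈ S ∨ x⁻¹ ∈ S) ∧ l.prod = g}

section WordLength

variable {G : Type*} [Group G] {S : Set G}

theorem wordLength_le_of_word (l : List G) (hl : ∀ x ∈ l, x ∈ S ∨ x⁻¹ ∈ S) :
    wordLength S l.prod ≤ l.length :=
  Nat.sInf_le ⟨l, rfl, hl, rfl⟩

theorem exists_word (hS : Subgroup.closure S = ⊤) (g : G) :
    ∃ l : List G, l.length = wordLength S g ∧ (∀ x ∈ l, x ∈ S ∨ x⁻¹ ∈ S) ∧ l.prod = g := by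
  have hg : g ∈ (Subgroup.closure S).toSubmonoid := by rw [hS]; trivial
  rw [Subgroup.closure_toSubmonoid] at hg
  obtain ⟨l, hl, hp⟩ := Submonoid.exists_list_of_mem_closure hg
  exact Nat.sInf_mem (s := {n : ℕ | ∃ l : List G, l.length = n ∧
    (∀ x ∈ l, x ∈ S ∨ x⁻¹ ∈ S) ∧ l.prod = g}) ⟨l.length, l, rfl, fun x hx => by simpa using hl x hx, hp⟩

theorem wordLength_one : wordLength S (1 : G) = 0 :=
  Nat.le_zero.mp (wordLength_le_of_word (S := S) [] (by simp))

theorem wordLength_inv_le (hS : Subgroup.closure S = ⊤) (g : G) :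
    wordLength S g⁻¹ ≤ wordLength S g := by
  obtain ⟨l, h1, h2, h3⟩ := exists_word hS g
  have h := wordLength_le_of_word (S := S) (l.map (·⁻¹)).reverse (by
    intro x hx
    simp only [List.mem_reverse, List.mem_map] at hx
    obtain ⟨y, hy, rfl⟩ := hx
    simpa using (h2 y hy).symm)
  rw [← List.prod_inv_reverse, h3] at h
  simpa [h1] using h

theorem wordLength_inv (hS : Subgroup.closure S = ⊤) (g : G) :
    wordLength S g⁻¹ = wordLength S g :=
  le_antisymm (wordLength_inv_le hS g) (by simpa using wordLength_inv_le hS g⁻¹)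

theorem wordLength_mul_le (hS : Subgroup.closure S = ⊤) (g h : G) :
    wordLength S (g * h) ≤ wordLength S g + wordLength S h := by
  obtain ⟨l, h1, h2, h3⟩ := exists_word hS g
  obtain ⟨m, k1, k2, k3⟩ := exists_word hS h
  have key := wordLength_le_of_word (S := S) (l ++ m) (by
    intro x hx
    rcases List.mem_append.mp hx with hx | hx
    · exact h2 x hx
    · exact k2 x hx)
  simpa [h1, h3, k1, k3] using key

theorem eq_one_of_wordLength_eq_zero (hS : Subgroup.closure S = ⊤) {g : G}
    (hg : wordLength S g = 0) : g = 1 := by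
  obtain ⟨l, h1, -, h3⟩ := exists_word hS g
  rw [hg, List.length_eq_zero_iff] at h1
  simpa [h1] using h3.symm

end WordLength

/-- The group `G` regarded as a metric space, with the word metric of the generating set `S`.
This is the vertex set of the Cayley graph of `G` with respect to `S` with the path metric. -/
def WordMetric {G : Type*} [Group G] (S : Set G) (_hS : Subgroup.closure S = ⊤) : Type _ := G

/-- `dist g h` is the word length of `g⁻¹ h`. -/
noncomputable instance WordMetric.instMetricSpace {G : Type*} [Group G] (S : Set G)
    (hS : Subgroup.closure S = ⊤) : MetricSpace (WordMetric S hS) where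
  dist := fun g h : G => (wordLength S (g⁻¹ * h) : ℝ)
  dist_self := fun g : G => by
    simp [wordLength_one]
  dist_comm := fun g h : G => by
    rw [← wordLength_inv hS (g⁻¹ * h)]
    simp
  dist_triangle := fun g h k : G => by
    have key := wordLength_mul_le hS (g⁻¹ * h) (h⁻¹ * k)
    rw [show g⁻¹ * h * (h⁻¹ * k) = g⁻¹ * k by group] at key
    exact_mod_cast key
  eq_of_dist_eq_zero := fun {g h : G} hgh => by
    change (wordLength S (g⁻¹ * h) : ℝ) = 0 at hgh
    have key := eq_one_of_wordLength_eq_zero hS (by exact_mod_cast hgh)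
    exact (inv_mul_eq_one (G := G)).mp key

/-! ### Asymptotic cones -/

/-- The sequences `x` in `X` at finite distance from the observation sequence `e`: the numbers
`dist (x n) (e n) / d n` are bounded `ω`-almost surely. Here `d` is a scaling sequence, i.e. it
diverges to `+∞` along the ultrafilter `ω` (which forces `ω` to be non-principal, and `d n > 0`
for `ω`-almost every `n`). -/
def ConeSequence (X : Type*) [PseudoMetricSpace X] (ω : Ultrafilter ℕ) (e : ℕ → X) (d : ℕ → ℝ)
    (_hd : Tendsto d ω atTop) : Type _ :=
  {x : ℕ → X // ∃ M : ℝ, ∀ᶠ n in (ω : Filter ℕ), dist (x n) (e n) / d n ≤ M}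

namespace ConeSequence

variable {X : Type*} [PseudoMetricSpace X] {ω : Ultrafilter ℕ} {e : ℕ → X} {d : ℕ → ℝ}
  {hd : Tendsto d ω atTop}

/-- The distance of two sequences: the `ω`-limit of the rescaled distances. -/
noncomputable instance : Dist (ConeSequence X ω e d hd) :=
  ⟨fun x y => limUnder (ω : Filter ℕ) fun n => dist (x.1 n) (y.1 n) / d n⟩

/-- The limit that defines the distance exists. -/
theorem tendsto_dist (x y : ConeSequence X ω e d hd) :
    Tendsto (fun n => dist (x.1 n) (y.1 n) / d n) ω (𝓝 (dist x y)) := by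
  obtain ⟨M, hM⟩ := x.2
  obtain ⟨N, hN⟩ := y.2
  have hmem : ∀ᶠ n in (ω : Filter ℕ),
      dist (x.1 n) (y.1 n) / d n ∈ Set.Icc (0 : ℝ) (M + N) := by
    filter_upwards [hM, hN, hd.eventually_gt_atTop 0] with n h1 h2 h3
    refine ⟨by positivity, ?_⟩
    calc dist (x.1 n) (y.1 n) / d n
        ≤ (dist (x.1 n) (e n) + dist (y.1 n) (e n)) / d n := by
          gcongr
          exact dist_triangle_right _ _ _
      _ ≤ M + N := by rw [add_div]; exact add_le_add h1 h2
  obtain ⟨a, -, ha⟩ := (isCompact_Icc (a := (0 : ℝ)) (b := M + N)).ultrafilter_le_nhds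
    (ω.map fun n => dist (x.1 n) (y.1 n) / d n) (le_principal_iff.mpr hmem)
  have ha' : Tendsto (fun n => dist (x.1 n) (y.1 n) / d n) ω (𝓝 a) := ha
  exact tendsto_nhds_limUnder ⟨a, ha'⟩

noncomputable instance : PseudoMetricSpace (ConeSequence X ω e d hd) where
  dist_self x := tendsto_nhds_unique (tendsto_dist x x) (by simp)
  dist_comm x y := tendsto_nhds_unique (tendsto_dist x y) (by
    simpa only [dist_comm] using tendsto_dist y x)
  dist_triangle x y z := by
    refine le_of_tendsto_of_tendsto (tendsto_dist x z)
      ((tendsto_dist x y).add (tendsto_dist y z)) ?_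
    filter_upwards [hd.eventually_gt_atTop 0] with n h
    rw [← add_div]
    gcongr
    exact dist_triangle _ _ _

end ConeSequence

/-- The asymptotic cone of the metric space `X` with respect to the ultrafilter `ω`, the
observation sequence `e` and the scaling sequence `d`, as a metric space: sequences at finite
distance from `e`, where sequences at distance `0` are identified. -/
abbrev AsymptoticCone (X : Type*) [PseudoMetricSpace X] (ω : Ultrafilter ℕ) (e : ℕ → X)
    (d : ℕ → ℝ) (hd : Tendsto d ω atTop) : Type _ :=
  SeparationQuotient (ConeSequence X ω e d hd)

/-! ### Prairie groups, quasi-isometric embeddings -/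

/-- A prairie group: a finitely generated group all of whose asymptotic cones are simply
connected. -/
def IsPrairieGroup (H : Type*) [Group H] : Prop :=
  Group.FG H ∧
    ∀ (S : Set H) (_ : S.Finite) (hS : Subgroup.closure S = ⊤)
      (ω : Ultrafilter ℕ) (e : ℕ → WordMetric S hS) (d : ℕ → ℝ) (hd : Tendsto d ω atTop),
      SimplyConnectedSpace (AsymptoticCone (WordMetric S hS) ω e d hd)

/-- Quasi-isometric embeddings of metric spaces. -/
def IsQuasiIsometricEmbedding {X Y : Type*} [PseudoMetricSpace X] [PseudoMetricSpace Y]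
    (f : X → Y) : Prop :=
  ∃ L C : ℝ, 1 ≤ L ∧ 0 ≤ C ∧
    ∀ x y : X, dist x y / L - C ≤ dist (f x) (f y) ∧ dist (f x) (f y) ≤ L * dist x y + C

/-- A homomorphism of finitely generated groups that is a quasi-isometric embedding for the word
metrics of finite generating sets. -/
def IsQuasiIsometricallyEmbedded {H G : Type*} [Group H] [Group G] (f : H →* G) : Prop :=
  Group.FG H ∧ Group.FG G ∧
    ∀ (T : Set H) (_ : T.Finite) (hT : Subgroup.closure T = ⊤)
      (S : Set G) (_ : S.Finite) (hS : Subgroup.closure S = ⊤),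
      IsQuasiIsometricEmbedding (X := WordMetric T hT) (Y := WordMetric S hS) f

/-- Every asymptotic cone of the group `G` (for every finite generating set, ultrafilter,
observation sequence and scaling sequence) is simply connected or has an uncountable fundamental
group (at every base point). -/
def SatisfiesConeDichotomy (G : Type*) [Group G] : Prop :=
  ∀ (S : Set G) (_ : S.Finite) (hS : Subgroup.closure S = ⊤)
    (ω : Ultrafilter ℕ) (e : ℕ → WordMetric S hS) (d : ℕ → ℝ) (hd : Tendsto d ω atTop),
    SimplyConnectedSpace (AsymptoticCone (WordMetric S hS) ω e d hd) ∨
      ∀ p : AsymptoticCone (WordMetric S hS) ω e d hd,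
        Uncountable (FundamentalGroup (AsymptoticCone (WordMetric S hS) ω e d hd) p)

/-!
Loops in asymptotic cones are compared by means of maps on the unit square that are continuous up
to an error (`EpsContOn`), so that one argument serves for cones and for almost continuous fillings.

**Divisions and extensions.** A division of quadrilaterals (`LoopDivision`) fills every large
quadrilateral with geodesic sides by an `n × n` grid of quadrilaterals that are smaller by a fixed
factor. A division of a space passes to its asymptotic cones (`LoopDivision.coneComb`). In a
complete space, iterating a division over finer and finer grids extends every map from a closed
subset of the square to the whole square, with uniform control of its discontinuity
(`exists_extension`, recorded as `UniformExtension`). Conversely, if all cones of a space admit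
almost continuous fillings of loops, then the space has a division: counterexamples on finer and
finer grids would rescale to a loop in some cone without a filling (`exists_loopDivision`). Hence
cones of prairie groups have the extension property (`IsPrairieGroup.exists_uniformExtension`).

**Separation.** Let a simply connected closed subspace with the extension property separate a space
into two sides. If a loop on one side is freely homotopic to a loop on the other side, it is
null-homotopic, because the part of the homotopy beyond the subspace can be pushed into it
(`Path.Homotopic.refl_of_separated`).

**Branches.** Suppose that `G` splits over a quasi-isometrically embedded prairie group, and let
`P` be the set of elements whose normal form begins in a prescribed way. The frontier of `P` is
close to the edge group, so in a cone of `G` the limits of translates of the edge group are closed,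
simply connected and separating. If both sides of `P` contain enough deep elements (`IsBranch`), an
essential loop in a cone has a translate for each real number in `(0, 1)`, and any two of these
translates are separated by such a limit. No two are freely homotopic, so the fundamental group is
uncountable (`IsBranch.simplyConnectedSpace_or_uncountable`, `satisfiesConeDichotomy_of_branch`).
For HNN extensions a branch exists as soon as one associated subgroup is proper, and for amalgamated
products as soon as the index of the edge group in one of the factors is at least three.

**Index two.** If the edge group has index two in both factors of an amalgamated product, the
product acts on `ℤ` with the two factors acting by reflections, and the cosets of the edge group
are the level sets of the orbit map. The cones of the product are then foliated by cones of the edge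
group. Loops are filled almost continuously by first extending the level to the square and then
extending level by level (`IsFoliated.almostFillable`). This gives a division of the product, and
its cones are simply connected (`satisfiesConeDichotomy_of_levels`).
-/

/-! ### Continuity up to an error -/

/-- `g` is continuous on `S` up to the error `ε`: near each point of `S`, the values of `g` on `S`
stay within `ε`. -/
def EpsContOn {α Z : Type*} [TopologicalSpace α] [PseudoMetricSpace Z] (ε : ℝ) (g : α → Z)
    (S : Set α) : Prop :=
  ∀ p ∈ S, ∀ᶠ q in 𝓝[S] p, dist (g q) (g p) ≤ ε

theorem EpsContOn.mono {α Z : Type*} [TopologicalSpace α] [PseudoMetricSpace Z] {ε : ℝ}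
    {g : α → Z} {S T : Set α} (h : EpsContOn ε g T) (hST : S ⊆ T) : EpsContOn ε g S :=
  fun p hp => nhdsWithin_mono p hST (h p (hST hp))

theorem ContinuousOn.epsContOn {α Z : Type*} [TopologicalSpace α] [PseudoMetricSpace Z] {ε : ℝ}
    {g : α → Z} {S : Set α} (h : ContinuousOn g S) (hε : 0 < ε) : EpsContOn ε g S :=
  fun p hp => ((Metric.tendsto_nhds.1 (h p hp)) ε hε).mono fun _ hq => hq.le

theorem continuousOn_of_epsContOn {α Z : Type*} [TopologicalSpace α] [PseudoMetricSpace Z]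
    {g : α → Z} {S : Set α} (h : ∀ ε > 0, EpsContOn ε g S) : ContinuousOn g S := by
  intro p hp
  refine Metric.tendsto_nhds.2 fun ε hε => ?_
  filter_upwards [h (ε / 2) (half_pos hε) p hp] with q hq
  linarith

/-! ### Combings and divisions of quadrilaterals -/

/-- A combing with additive error `κ`: a choice, for any two points, of a path between them that
is parametrized proportionally to its length, up to `κ`. -/
structure IsCombing {Z : Type*} [PseudoMetricSpace Z] (κ : ℝ) (c : Z → Z → ℝ → Z) : Prop where
  zero : ∀ p q, c p q 0 = p
  one : ∀ p q, c p q 1 = q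
  dist_le : ∀ p q, ∀ s ∈ Set.Icc (0 : ℝ) 1, ∀ t ∈ Set.Icc (0 : ℝ) 1,
    dist (c p q s) (c p q t) ≤ |s - t| * dist p q + κ

/-- The map `g`, on the vertices of an `n × n` grid, fills the quadrilateral with the corners
`a, b` (bottom) and `p, q` (top) and with sides given by the combing `c`; neighbouring vertices
have images at distance at most `δ`. -/
structure IsGridFilling {Z : Type*} [PseudoMetricSpace Z] (c : Z → Z → ℝ → Z) (n : ℕ) (δ : ℝ)
    (a b p q : Z) (g : ℕ → ℕ → Z) : Prop where
  bottom : ∀ i ≤ n, g i 0 = c a b (i / n)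
  top : ∀ i ≤ n, g i n = c p q (i / n)
  left : ∀ j ≤ n, g 0 j = c a p (j / n)
  right : ∀ j ≤ n, g n j = c b q (j / n)
  horiz : ∀ i < n, ∀ j ≤ n, dist (g i j) (g (i + 1) j) ≤ δ
  vert : ∀ i ≤ n, ∀ j < n, dist (g i j) (g i (j + 1)) ≤ δ

/-- Quadrilaterals of size `r ≥ R` are divided by `n × n` grids into quadrilaterals whose size is
smaller by the factor `lam`. -/
def LoopDivision {Z : Type*} [PseudoMetricSpace Z] (c : Z → Z → ℝ → Z) (n : ℕ) (lam R : ℝ) :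
    Prop :=
  ∀ r, R ≤ r → ∀ a b p q, dist a b ≤ r → dist p q ≤ r → dist a p ≤ r → dist b q ≤ r →
    ∃ g, IsGridFilling c n (lam * r) a b p q g

theorem IsGridFilling.dist_corner_le {Z : Type*} [PseudoMetricSpace Z] {c : Z → Z → ℝ → Z}
    {n : ℕ} {δ : ℝ} {a b p q : Z} {g : ℕ → ℕ → Z} (h : IsGridFilling c n δ a b p q g)
    {i j : ℕ} (hi : i ≤ n) (hj : j ≤ n) : dist (g i j) (g 0 0) ≤ (i + j) * δ := by
  have h1 : ∀ i ≤ n, dist (g i 0) (g 0 0) ≤ i * δ := by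
    intro i
    induction i with
    | zero => simp
    | succ i ih =>
      intro hi
      have := h.horiz i hi 0 (Nat.zero_le _)
      rw [dist_comm] at this
      push_cast
      linarith [ih (by omega), dist_triangle (g (i + 1) 0) (g i 0) (g 0 0)]
  have h2 : ∀ j ≤ n, dist (g i j) (g 0 0) ≤ (i + j) * δ := by
    intro j
    induction j with
    | zero => intro _; simpa using h1 i hi
    | succ j ih =>
      intro hj
      have := h.vert i hi j hj
      rw [dist_comm] at this
      push_cast
      linarith [ih (by omega), dist_triangle (g i (j + 1)) (g i j) (g 0 0)]
  exact h2 j hj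

/-! ### Extension of maps from closed subsets of the square -/

/-- The closed unit square, in `ℝ × ℝ` with the supremum metric. -/
def unitSq : Set (ℝ × ℝ) := Set.Icc (0 : ℝ) 1 ×ˢ Set.Icc (0 : ℝ) 1

namespace GridExtension

/-- The vertex `(i, j)` of the grid of mesh `n⁻ᵏ`. -/
noncomputable def pos (n k i j : ℕ) : ℝ × ℝ := ((i : ℝ) / n ^ k, (j : ℝ) / n ^ k)

/-- A vertex is near `A` if its distance from `A` is less than three times the mesh. -/
def Near (A : Set (ℝ × ℝ)) (n k i j : ℕ) : Prop := ∃ a ∈ A, dist a (pos n k i j) < 3 / (n : ℝ) ^ k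

/-- The approximations, on finer and finer grids, of the extension of `f : A → Z`: at vertices
near `A` the value of a nearby point of `A` is taken, at the other vertices the value that the
division `D` of the parent cell gives. -/
noncomputable def approx {Z : Type*} (D : Z → Z → Z → Z → ℕ → ℕ → Z) (A : Set (ℝ × ℝ))
    (f : ℝ × ℝ → Z) (n : ℕ) : ℕ → ℕ → ℕ → Z
  | 0, i, j => open Classical in if h : Near A n 0 i j then f h.choose else f 0
  | k + 1, i, j => open Classical in if h : Near A n (k + 1) i j then f h.choose else
      D (approx D A f n k (i / n) (j / n)) (approx D A f n k (i / n + 1) (j / n))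
        (approx D A f n k (i / n) (j / n + 1)) (approx D A f n k (i / n + 1) (j / n + 1))
        (i % n) (j % n)

/-- The four sides of the cell with lower left corner `(i, j)` have length at most `r`. -/
structure CellLE {Z : Type*} [PseudoMetricSpace Z] (F : ℕ → ℕ → Z) (i j : ℕ) (r : ℝ) : Prop where
  bottom : dist (F i j) (F (i + 1) j) ≤ r
  top : dist (F i (j + 1)) (F (i + 1) (j + 1)) ≤ r
  left : dist (F i j) (F i (j + 1)) ≤ r
  right : dist (F (i + 1) j) (F (i + 1) (j + 1)) ≤ r

/-- The cell of the grid of mesh `n⁻ᵏ` that contains the number `x`. -/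
noncomputable def idx (n k : ℕ) (x : ℝ) : ℕ := ⌊x * n ^ k⌋₊

variable {Z : Type*} [MetricSpace Z] {c : Z → Z → ℝ → Z} {D : Z → Z → Z → Z → ℕ → ℕ → Z}
  {A : Set (ℝ × ℝ)} {f : ℝ × ℝ → Z} {n : ℕ}

theorem idx_succ (hn : 0 < n) (k : ℕ) (x : ℝ) : idx n (k + 1) x / n = idx n k x := by
  unfold idx
  rw [← Nat.floor_div_natCast]
  congr 1
  have : (n : ℝ) ≠ 0 := by positivity
  rw [pow_succ]; field_simp

theorem idx_decomp (hn : 0 < n) (k : ℕ) (x : ℝ) :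
    ∃ i' < n, idx n (k + 1) x = idx n k x * n + i' :=
  ⟨idx n (k + 1) x % n, Nat.mod_lt _ hn, by rw [← idx_succ hn k x, Nat.div_add_mod']⟩

theorem dist_pos_idx_le (hn : 0 < n) (k : ℕ) {p : ℝ × ℝ} (hp : p ∈ unitSq) :
    dist (pos n k (idx n k p.1) (idx n k p.2)) p ≤ 1 / (n : ℝ) ^ k := by
  have hN : (0 : ℝ) < (n : ℝ) ^ k := by positivity
  have key : ∀ x : ℝ, 0 ≤ x → |(idx n k x : ℝ) / n ^ k - x| ≤ 1 / (n : ℝ) ^ k := by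
    intro x hx
    have h1 := Nat.floor_le (mul_nonneg hx hN.le)
    have h2 := Nat.lt_floor_add_one (x * (n : ℝ) ^ k)
    have : (idx n k x : ℝ) / n ^ k - x = ((idx n k x : ℝ) - x * n ^ k) / n ^ k := by field_simp
    rw [this, abs_div, abs_of_pos hN]
    gcongr
    rw [abs_le]; unfold idx; constructor <;> linarith
  exact max_le (key _ hp.1.1) (key _ hp.2.1)

theorem dist_pos_child_le (hn : 0 < n) (k i j : ℕ) {i' j' : ℕ} (hi : i' ≤ n) (hj : j' ≤ n) :
    dist (pos n (k + 1) (i * n + i') (j * n + j')) (pos n k i j) ≤ 1 / (n : ℝ) ^ k := by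
  have hN : (0 : ℝ) < (n : ℝ) ^ k := by positivity
  have hn' : (0 : ℝ) < n := by positivity
  have key : ∀ i i' : ℕ, i' ≤ n →
      |((i * n + i' : ℕ) : ℝ) / n ^ (k + 1) - i / n ^ k| ≤ 1 / (n : ℝ) ^ k := by
    intro i i' hi
    have : ((i * n + i' : ℕ) : ℝ) / n ^ (k + 1) - i / n ^ k = (i' / n) / (n : ℝ) ^ k := by
      push_cast; rw [pow_succ]; field_simp; ring
    rw [this, abs_of_nonneg (by positivity)]
    gcongr
    rw [div_le_one hn']
    exact_mod_cast hi
  exact max_le (key _ _ hi) (key _ _ hj)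

theorem dist_pos_corner_le (hn : 0 < n) (k i j : ℕ) {i' j' : ℕ} (hi : i' ≤ 1) (hj : j' ≤ 1) :
    dist (pos n k (i + i') (j + j')) (pos n k i j) ≤ 1 / (n : ℝ) ^ k := by
  have hN : (0 : ℝ) < (n : ℝ) ^ k := by positivity
  have key : ∀ i i' : ℕ, i' ≤ 1 →
      |((i + i' : ℕ) : ℝ) / n ^ k - i / n ^ k| ≤ 1 / (n : ℝ) ^ k := by
    intro i i' hi
    have : ((i + i' : ℕ) : ℝ) / n ^ k - i / n ^ k = i' / (n : ℝ) ^ k := by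
      push_cast; ring
    rw [this, abs_of_nonneg (by positivity)]
    gcongr
    exact_mod_cast hi
  exact max_le (key _ _ hi) (key _ _ hj)

omit [MetricSpace Z] in
theorem approx_of_near {k i j : ℕ} (h : Near A n k i j) :
    ∃ a ∈ A, dist a (pos n k i j) < 3 / (n : ℝ) ^ k ∧ approx D A f n k i j = f a := by
  refine ⟨h.choose, h.choose_spec.1, h.choose_spec.2, ?_⟩
  cases k <;> rw [approx, dif_pos h]

/-- The operator `D` assigns to the corners of every quadrilateral a filling by an `n × n` grid in
which the size is at least halved. -/
def IsDivision (c : Z → Z → ℝ → Z) (D : Z → Z → Z → Z → ℕ → ℕ → Z) (n : ℕ) : Prop :=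
  ∀ a b p q r, dist a b ≤ r → dist p q ≤ r → dist a p ≤ r → dist b q ≤ r →
    IsGridFilling c n (r / 2) a b p q (D a b p q)

theorem exists_isDivision (hD : LoopDivision c n (1 / 2) 0) :
    ∃ D : Z → Z → Z → Z → ℕ → ℕ → Z, IsDivision c D n := by
  have : ∀ a b p q : Z, ∃ g, IsGridFilling c n
      (1 / 2 * max (max (dist a b) (dist p q)) (max (dist a p) (dist b q))) a b p q g := by
    intro a b p q
    refine hD _ (le_max_of_le_left (le_max_of_le_left dist_nonneg)) a b p q ?_ ?_ ?_ ?_ <;> simp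
  choose D hD using this
  refine ⟨D, fun a b p q r h1 h2 h3 h4 => ?_⟩
  have hle : 1 / 2 * max (max (dist a b) (dist p q)) (max (dist a p) (dist b q)) ≤ r / 2 := by
    have : max (max (dist a b) (dist p q)) (max (dist a p) (dist b q)) ≤ r := by
      simp [h1, h2, h3, h4]
    linarith
  have h := hD a b p q
  exact ⟨h.bottom, h.top, h.left, h.right, fun i hi j hj => (h.horiz i hi j hj).trans hle,
    fun i hi j hj => (h.vert i hi j hj).trans hle⟩

theorem IsDivision.isGridFilling (hD : IsDivision c D n) (a b p q : Z) :
    ∃ δ, IsGridFilling c n δ a b p q (D a b p q) :=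
  ⟨_, hD a b p q (max (max (dist a b) (dist p q)) (max (dist a p) (dist b q)))
    (by simp) (by simp) (by simp) (by simp)⟩

/-- The values at the vertices of a cell come from the division of that cell, also on the sides
that the cell shares with its neighbours. -/
theorem approx_child (hn : 0 < n) (hc : IsCombing 0 c) (hD : IsDivision c D n) {k i j i' j' : ℕ}
    (hi : i' ≤ n) (hj : j' ≤ n) (h : ¬ Near A n (k + 1) (i * n + i') (j * n + j')) :
    approx D A f n (k + 1) (i * n + i') (j * n + j') =
      D (approx D A f n k i j) (approx D A f n k (i + 1) j)
        (approx D A f n k i (j + 1)) (approx D A f n k (i + 1) (j + 1)) i' j' := by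
  have hn' : (n : ℝ) ≠ 0 := by positivity
  rw [approx, dif_neg h]
  have hlt : ∀ i i' : ℕ, i' < n → (i * n + i') / n = i ∧ (i * n + i') % n = i' := by
    intro i i' h
    rw [add_comm, Nat.add_mul_div_right _ _ hn, Nat.add_mul_mod_self_right, Nat.div_eq_of_lt h,
      Nat.mod_eq_of_lt h]
    simp
  have heq : ∀ i : ℕ, (i * n + n) / n = i + 1 ∧ (i * n + n) % n = 0 := by
    intro i
    rw [← Nat.succ_mul, Nat.mul_div_cancel _ hn, Nat.mul_mod_left]
    simp
  set F := approx D A f n k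
  obtain ⟨δ₀, h0⟩ := hD.isGridFilling (F i j) (F (i + 1) j) (F i (j + 1)) (F (i + 1) (j + 1))
  rcases hi.lt_or_eq with hi' | rfl <;> rcases hj.lt_or_eq with hj' | hj'
  · rw [(hlt i i' hi').1, (hlt i i' hi').2, (hlt j j' hj').1, (hlt j j' hj').2]
  · subst hj'
    rw [(hlt i i' hi').1, (hlt i i' hi').2, (heq j).1, (heq j).2, h0.top _ hi]
    obtain ⟨δ, h1⟩ := hD.isGridFilling (F i (j + 1)) (F (i + 1) (j + 1)) (F i (j + 1 + 1))
      (F (i + 1) (j + 1 + 1))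
    rw [h1.bottom _ hi]
  · rw [(hlt j j' hj').1, (hlt j j' hj').2, (heq i).1, (heq i).2, h0.right _ hj]
    obtain ⟨δ, h1⟩ := hD.isGridFilling (F (i + 1) j) (F (i + 1 + 1) j) (F (i + 1) (j + 1))
      (F (i + 1 + 1) (j + 1))
    rw [h1.left _ hj]
  · subst hj'
    rw [(heq i).1, (heq i).2, (heq j).1, (heq j).2, h0.top _ le_rfl, div_self hn', hc.one]
    obtain ⟨δ, h1⟩ := hD.isGridFilling (F (i + 1) (j + 1)) (F (i + 1 + 1) (j + 1))
      (F (i + 1) (j + 1 + 1)) (F (i + 1 + 1) (j + 1 + 1))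
    rw [h1.bottom _ (Nat.zero_le _)]
    simp [hc.zero]

theorem CellLE.dist_child_le (hn : 0 < n) (hc : IsCombing 0 c) (hD : IsDivision c D n)
    {k i j i' j' : ℕ} {r : ℝ} (h : CellLE (approx D A f n k) i j r)
    (hi : i' ≤ n) (hj : j' ≤ n) (hnear : ¬ Near A n (k + 1) (i * n + i') (j * n + j')) :
    dist (approx D A f n (k + 1) (i * n + i') (j * n + j')) (approx D A f n k i j) ≤ n * r := by
  rw [approx_child hn hc hD hi hj hnear]
  have hf := hD _ _ _ _ r h.bottom h.top h.left h.right
  have h1 := hf.dist_corner_le hi hj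
  rw [hf.bottom 0 (Nat.zero_le _)] at h1
  simp only [Nat.cast_zero, zero_div, hc.zero] at h1
  have hr : 0 ≤ r := dist_nonneg.trans h.bottom
  have hi' : (i' : ℝ) ≤ n := by exact_mod_cast hi
  have hj' : (j' : ℝ) ≤ n := by exact_mod_cast hj
  nlinarith

theorem not_near_child (hn : 2 ≤ n) {k i j i' j' : ℕ} (h : ¬ Near A n k i j) (hi : i' ≤ n)
    (hj : j' ≤ n) : ¬ Near A n (k + 1) (i * n + i') (j * n + j') := by
  rintro ⟨a, ha, hd⟩
  refine h ⟨a, ha, ?_⟩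
  have h1 := dist_pos_child_le (by omega : 0 < n) k i j hi hj
  have hN : (0 : ℝ) < (n : ℝ) ^ k := by positivity
  have hn' : (2 : ℝ) ≤ n := by exact_mod_cast hn
  have h2 : 3 / (n : ℝ) ^ (k + 1) ≤ 2 / (n : ℝ) ^ k := by
    rw [pow_succ, div_le_div_iff₀ (by positivity) hN]
    nlinarith
  calc _ ≤ _ := dist_triangle _ (pos n (k + 1) (i * n + i') (j * n + j')) _
    _ < 2 / (n : ℝ) ^ k + 1 / (n : ℝ) ^ k := by linarith
    _ = _ := by ring

theorem CellLE.child (hn : 2 ≤ n) (hc : IsCombing 0 c) (hD : IsDivision c D n)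
    {k i j i' j' : ℕ} {r : ℝ} (h : CellLE (approx D A f n k) i j r)
    (hnear : ¬ Near A n k i j) (hi : i' < n) (hj : j' < n) :
    CellLE (approx D A f n (k + 1)) (i * n + i') (j * n + j') (r / 2) := by
  have hf := hD _ _ _ _ r h.bottom h.top h.left h.right
  have key : ∀ i' ≤ n, ∀ j' ≤ n, _ := fun i' hi j' hj =>
    approx_child (f := f) (by omega) hc hD hi hj (not_near_child hn hnear hi hj)
  constructor <;> simp only [add_assoc]
  · rw [key i' hi.le j' hj.le, key (i' + 1) hi j' hj.le]
    exact hf.horiz _ hi _ hj.le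
  · rw [key i' hi.le _ hj, key (i' + 1) hi _ hj]
    exact hf.horiz _ hi _ hj
  · rw [key i' hi.le j' hj.le, key i' hi.le _ hj]
    exact hf.vert _ hi.le _ hj
  · rw [key _ hi j' hj.le, key _ hi _ hj]
    exact hf.vert _ hi _ hj

/-- The behaviour of the approximations over a point `p`, beginning with a cell away from `A`. -/
theorem cellLE_of_far (hn : 2 ≤ n) (hc : IsCombing 0 c) (hD : IsDivision c D n) {k : ℕ}
    {p : ℝ × ℝ} {r : ℝ} (h : CellLE (approx D A f n k) (idx n k p.1) (idx n k p.2) r)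
    (hnear : ¬ Near A n k (idx n k p.1) (idx n k p.2)) (m : ℕ) :
    CellLE (approx D A f n (k + m)) (idx n (k + m) p.1) (idx n (k + m) p.2) (r / 2 ^ m) ∧
      ¬ Near A n (k + m) (idx n (k + m) p.1) (idx n (k + m) p.2) := by
  induction m with
  | zero => simpa using ⟨h, hnear⟩
  | succ m ih =>
    obtain ⟨i', hi, hi'⟩ := idx_decomp (by omega : 0 < n) (k + m) p.1
    obtain ⟨j', hj, hj'⟩ := idx_decomp (by omega : 0 < n) (k + m) p.2
    rw [← add_assoc, hi', hj', pow_succ, ← div_div]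
    exact ⟨ih.1.child hn hc hD ih.2 hi hj, not_near_child hn ih.2 hi.le hj.le⟩

/-- The limit of the approximations. -/
noncomputable def lim [Nonempty Z] (D : Z → Z → Z → Z → ℕ → ℕ → Z) (A : Set (ℝ × ℝ))
    (f : ℝ × ℝ → Z) (n : ℕ) (p : ℝ × ℝ) : Z :=
  limUnder atTop fun k => approx D A f n k (idx n k p.1) (idx n k p.2)

theorem dist_lim_le [Nonempty Z] [CompleteSpace Z] (hn : 2 ≤ n) (hc : IsCombing 0 c)
    (hD : IsDivision c D n) {k : ℕ} {p : ℝ × ℝ} {r : ℝ}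
    (h : CellLE (approx D A f n k) (idx n k p.1) (idx n k p.2) r)
    (hnear : ¬ Near A n k (idx n k p.1) (idx n k p.2)) :
    dist (approx D A f n k (idx n k p.1) (idx n k p.2)) (lim D A f n p) ≤ 2 * n * r := by
  set u : ℕ → Z := fun m => approx D A f n (k + m) (idx n (k + m) p.1) (idx n (k + m) p.2)
  have hu : ∀ m, dist (u m) (u (m + 1)) ≤ (2 * n * r) / 2 / 2 ^ m := by
    intro m
    obtain ⟨h1, h2⟩ := cellLE_of_far hn hc hD h hnear m
    obtain ⟨i', hi, hi'⟩ := idx_decomp (by omega : 0 < n) (k + m) p.1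
    obtain ⟨j', hj, hj'⟩ := idx_decomp (by omega : 0 < n) (k + m) p.2
    have := h1.dist_child_le (by omega) hc hD hi.le hj.le (not_near_child hn h2 hi.le hj.le)
    rw [dist_comm]
    simp only [u, ← add_assoc]
    rw [hi', hj']
    refine this.trans (le_of_eq ?_)
    ring
  obtain ⟨z, hz⟩ := cauchySeq_tendsto_of_complete (cauchySeq_of_le_geometric_two hu)
  have hlim : Tendsto (fun k => approx D A f n k (idx n k p.1) (idx n k p.2)) atTop (𝓝 z) := by
    rw [← tendsto_add_atTop_iff_nat k]
    simpa only [u, add_comm] using hz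
  rw [lim, hlim.limUnder_eq]
  exact dist_le_of_le_geometric_two_of_tendsto₀ hu hz

/-- Control of the approximations near `A`, by the oscillation of `f`. -/
theorem dist_approx_le (hn : 4 ≤ n) (hc : IsCombing 0 c) (hD : IsDivision c D n) {k i j : ℕ}
    {ρ : ℝ} {z : Z} {a₁ : ℝ × ℝ} (ha₁ : a₁ ∈ A) (hk : k = 0 → Near A n k i j)
    (h₁ : dist a₁ (pos n k i j) < 4 / (n : ℝ) ^ k)
    (hρ : ∀ a ∈ A, dist a (pos n k i j) < 4 * n / (n : ℝ) ^ k → dist (f a) z ≤ ρ) :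
    dist (approx D A f n k i j) z ≤ (2 * n + 1) * ρ := by
  have hN : (0 : ℝ) < (n : ℝ) ^ k := by positivity
  have hn' : (4 : ℝ) ≤ n := by exact_mod_cast hn
  have hρ0 : 0 ≤ ρ := dist_nonneg.trans (hρ a₁ ha₁ (h₁.trans_le (by gcongr; linarith)))
  by_cases hnear : Near A n k i j
  · obtain ⟨a, ha, had, hF⟩ := approx_of_near (D := D) (f := f) hnear
    rw [hF]
    have := hρ a ha (had.trans_le (by gcongr; linarith))
    nlinarith
  · obtain ⟨k, rfl⟩ : ∃ m, k = m + 1 := Nat.exists_eq_succ_of_ne_zero fun h => hnear (hk h)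
    have hM : (0 : ℝ) < (n : ℝ) ^ k := by positivity
    have hscale : 4 * n / (n : ℝ) ^ (k + 1) = 4 / (n : ℝ) ^ k := by
      rw [pow_succ]; field_simp
    have hscale' : 4 / (n : ℝ) ^ (k + 1) ≤ 1 / (n : ℝ) ^ k := by
      rw [pow_succ, div_le_div_iff₀ (by positivity) hM]; nlinarith
    obtain ⟨i₀, i', hi, rfl⟩ : ∃ i₀ i', i' < n ∧ i = i₀ * n + i' :=
      ⟨i / n, i % n, Nat.mod_lt _ (by omega), (Nat.div_add_mod' _ _).symm⟩
    obtain ⟨j₀, j', hj, rfl⟩ : ∃ i₀ i', i' < n ∧ j = i₀ * n + i' :=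
      ⟨j / n, j % n, Nat.mod_lt _ (by omega), (Nat.div_add_mod' _ _).symm⟩
    have hchild : ∀ i'' ≤ 1, ∀ j'' ≤ 1, dist (pos n (k + 1) (i₀ * n + i') (j₀ * n + j'))
        (pos n k (i₀ + i'') (j₀ + j'')) ≤ 1 / (n : ℝ) ^ k := by
      have key : ∀ i₀ i' i'' : ℕ, i' < n → i'' ≤ 1 →
          |((i₀ * n + i' : ℕ) : ℝ) / n ^ (k + 1) - (i₀ + i'' : ℕ) / n ^ k| ≤ 1 / (n : ℝ) ^ k := by
        intro i₀ i' i'' h1 h2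
        have : ((i₀ * n + i' : ℕ) : ℝ) / n ^ (k + 1) - (i₀ + i'' : ℕ) / n ^ k =
            (i' / n - i'') / (n : ℝ) ^ k := by
          push_cast; rw [pow_succ]; field_simp; ring
        rw [this, abs_div, abs_of_pos hM]
        gcongr
        have h3 : (i' : ℝ) / n ≤ 1 := by
          rw [div_le_one (by linarith)]; exact_mod_cast h1.le
        have h4 : (0 : ℝ) ≤ (i' : ℝ) / n := by positivity
        have h5 : (i'' : ℝ) ≤ 1 := by exact_mod_cast h2
        have h6 : (0 : ℝ) ≤ i'' := by positivity
        rw [abs_le]; constructor <;> linarith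
      intro i'' h1 j'' h2
      exact max_le (key _ _ _ hi h1) (key _ _ _ hj h2)
    have hcorner : ∀ i'' ≤ 1, ∀ j'' ≤ 1, dist (approx D A f n k (i₀ + i'') (j₀ + j'')) z ≤ ρ := by
      intro i'' h1 j'' h2
      have hd := hchild i'' h1 j'' h2
      have hw : Near A n k (i₀ + i'') (j₀ + j'') := by
        refine ⟨a₁, ha₁, ?_⟩
        calc _ ≤ _ := dist_triangle _ (pos n (k + 1) (i₀ * n + i') (j₀ * n + j')) _
          _ < 1 / (n : ℝ) ^ k + 1 / (n : ℝ) ^ k := by linarith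
          _ = 2 / (n : ℝ) ^ k := by ring
          _ ≤ _ := by gcongr; norm_num
      obtain ⟨a, ha, had, hF⟩ := approx_of_near (D := D) (f := f) hw
      rw [hF]
      refine hρ a ha ?_
      rw [hscale]
      rw [dist_comm] at hd
      calc _ ≤ _ := dist_triangle _ (pos n k (i₀ + i'') (j₀ + j'')) _
          _ < 3 / (n : ℝ) ^ k + 1 / (n : ℝ) ^ k := by linarith
          _ = 4 / (n : ℝ) ^ k := by ring
    have h00 := hcorner 0 (by simp) 0 (by simp)
    have h10 := hcorner 1 le_rfl 0 (by simp)
    have h01 := hcorner 0 (by simp) 1 le_rfl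
    have h11 := hcorner 1 le_rfl 1 le_rfl
    simp only [add_zero] at h00 h10 h01
    have hcell : CellLE (approx D A f n k) i₀ j₀ (2 * ρ) := by
      constructor
      · linarith [dist_triangle_right (approx D A f n k i₀ j₀) (approx D A f n k (i₀ + 1) j₀) z]
      · linarith [dist_triangle_right (approx D A f n k i₀ (j₀ + 1))
          (approx D A f n k (i₀ + 1) (j₀ + 1)) z]
      · linarith [dist_triangle_right (approx D A f n k i₀ j₀) (approx D A f n k i₀ (j₀ + 1)) z]
      · linarith [dist_triangle_right (approx D A f n k (i₀ + 1) j₀)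
          (approx D A f n k (i₀ + 1) (j₀ + 1)) z]
    have := hcell.dist_child_le (by omega) hc hD hi.le hj.le hnear
    linarith [dist_triangle (approx D A f n (k + 1) (i₀ * n + i') (j₀ * n + j'))
      (approx D A f n k i₀ j₀) z]

theorem idx_zero_le_one {x : ℝ} (hx : x ∈ Set.Icc (0 : ℝ) 1) : idx n 0 x ≤ 1 := by
  unfold idx
  rw [pow_zero, mul_one]
  calc ⌊x⌋₊ ≤ ⌊(1 : ℝ)⌋₊ := Nat.floor_mono hx.2
    _ = 1 := Nat.floor_one

/-- All vertices of the coarsest grid are near a nonempty subset of the square. -/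
theorem near_zero (hA : A ⊆ unitSq) (hne : A.Nonempty) {i j : ℕ} (hi : i ≤ 2) (hj : j ≤ 2) :
    Near A n 0 i j := by
  obtain ⟨a, ha⟩ := hne
  refine ⟨a, ha, ?_⟩
  have h := hA ha
  have key : ∀ (x : ℝ) (i : ℕ), x ∈ Set.Icc (0 : ℝ) 1 → i ≤ 2 → |x - i / (n : ℝ) ^ 0| ≤ 2 := by
    intro x i hx hi
    have h1 : (i : ℝ) ≤ 2 := by exact_mod_cast hi
    have h2 : (0 : ℝ) ≤ i := by positivity
    rw [pow_zero, div_one, abs_le]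
    constructor <;> linarith [hx.1, hx.2]
  have : dist a (pos n 0 i j) ≤ 2 := max_le (key _ _ h.1 hi) (key _ _ h.2 hj)
  simpa using this.trans_lt (by norm_num : (2 : ℝ) < 3)

theorem dist_corner_point_le (hn : 0 < n) (k : ℕ) {p : ℝ × ℝ} (hp : p ∈ unitSq) {i' j' : ℕ}
    (hi : i' ≤ 1) (hj : j' ≤ 1) :
    dist (pos n k (idx n k p.1 + i') (idx n k p.2 + j')) p ≤ 1 / (n : ℝ) ^ k := by
  have hN : (0 : ℝ) < (n : ℝ) ^ k := by positivity
  have key : ∀ (x : ℝ) (i' : ℕ), 0 ≤ x → i' ≤ 1 →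
      |((idx n k x + i' : ℕ) : ℝ) / n ^ k - x| ≤ 1 / (n : ℝ) ^ k := by
    intro x i' hx hi
    have h1 := Nat.floor_le (mul_nonneg hx hN.le)
    have h2 := Nat.lt_floor_add_one (x * (n : ℝ) ^ k)
    have : ((idx n k x + i' : ℕ) : ℝ) / n ^ k - x =
        ((idx n k x : ℝ) - x * n ^ k + i') / n ^ k := by push_cast; field_simp; ring
    rw [this, abs_div, abs_of_pos hN]
    gcongr
    have h3 : (i' : ℝ) ≤ 1 := by exact_mod_cast hi
    have h4 : (0 : ℝ) ≤ i' := by positivity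
    rw [abs_le]; unfold idx; constructor <;> linarith
  exact max_le (key _ _ hp.1.1 hi) (key _ _ hp.2.1 hj)

theorem cellLE_of_corners {F : ℕ → ℕ → Z} {i j : ℕ} {z : Z} {r : ℝ}
    (h : ∀ i' ≤ 1, ∀ j' ≤ 1, dist (F (i + i') (j + j')) z ≤ r) : CellLE F i j (2 * r) := by
  have h00 := h 0 (by simp) 0 (by simp)
  have h10 := h 1 le_rfl 0 (by simp)
  have h01 := h 0 (by simp) 1 le_rfl
  have h11 := h 1 le_rfl 1 le_rfl
  simp only [add_zero] at h00 h10 h01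
  constructor
  · linarith [dist_triangle_right (F i j) (F (i + 1) j) z]
  · linarith [dist_triangle_right (F i (j + 1)) (F (i + 1) (j + 1)) z]
  · linarith [dist_triangle_right (F i j) (F i (j + 1)) z]
  · linarith [dist_triangle_right (F (i + 1) j) (F (i + 1) (j + 1)) z]

theorem CellLE.dist_corners_le {F : ℕ → ℕ → Z} {i j : ℕ} {r : ℝ} (h : CellLE F i j r)
    {u w u' w' : ℕ} (hu : u ≤ 1) (hw : w ≤ 1) (hu' : u' ≤ 1) (hw' : w' ≤ 1) :
    dist (F (i + u) (j + w)) (F (i + u') (j + w')) ≤ 2 * r := by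
  have hr : 0 ≤ r := dist_nonneg.trans h.bottom
  have h1 : dist (F (i + u) (j + w)) (F (i + u') (j + w)) ≤ r := by
    interval_cases u <;> interval_cases u' <;> interval_cases w <;>
      simp only [add_zero, dist_self, hr, h.bottom, h.top, dist_comm (F (i + 1) _)]
  have h2 : dist (F (i + u') (j + w)) (F (i + u') (j + w')) ≤ r := by
    interval_cases w <;> interval_cases w' <;> interval_cases u' <;>
      simp only [add_zero, dist_self, hr, h.left, h.right, dist_comm (F _ (j + 1))]
  linarith [dist_triangle (F (i + u) (j + w)) (F (i + u') (j + w)) (F (i + u') (j + w'))]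

theorem exists_scale (hn : 2 ≤ n) {η : ℝ} (hη : 0 < η) : ∃ k : ℕ, 1 / (n : ℝ) ^ k < η := by
  have hn' : (2 : ℝ) ≤ n := by exact_mod_cast hn
  obtain ⟨k, hk⟩ := exists_pow_lt_of_lt_one hη (show (1 / (n : ℝ)) < 1 by
    rw [div_lt_one] <;> linarith)
  exact ⟨k, by simpa using hk⟩

/-- Vertices away from `A` in terms of the distance from `A`. -/
theorem not_near_of_le {k i j : ℕ} {p : ℝ × ℝ} {η : ℝ} (hη : ∀ a ∈ A, η ≤ dist a p)
    (hp : dist (pos n k i j) p ≤ 2 * (1 / (n : ℝ) ^ k)) (hk : 5 * (1 / (n : ℝ) ^ k) ≤ η) :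
    ¬ Near A n k i j := by
  rintro ⟨a, ha, hd⟩
  have h1 := hη a ha
  have h2 := dist_triangle a (pos n k i j) p
  have h3 : 3 / (n : ℝ) ^ k = 3 * (1 / (n : ℝ) ^ k) := by ring
  linarith

/-- Control of the extension near `A`, by the oscillation of `f`. -/
theorem dist_lim_le_of_osc [Nonempty Z] [CompleteSpace Z] (hn : 4 ≤ n) (hc : IsCombing 0 c)
    (hD : IsDivision c D n) (hA : A ⊆ unitSq) {p a : ℝ × ℝ} (hp : p ∈ unitSq) {η : ℝ}
    (hη0 : 0 < η) (hη : ∀ a ∈ A, η ≤ dist a p)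
    (ha : a ∈ A) {ρ : ℝ}
    (hρ : ∀ a' ∈ A, dist a' a ≤ (4 * n ^ 2 + n + 1) * dist p a → dist (f a') (f a) ≤ ρ) :
    dist (lim D A f n p) (f a) ≤ (4 * n + 1) * (2 * n + 1) ^ 2 * ρ := by
  have hn' : (4 : ℝ) ≤ n := by exact_mod_cast hn
  have hρ0 : 0 ≤ ρ := by
    have := hρ a ha (by rw [dist_self]; positivity)
    rwa [dist_self] at this
  -- the first grid in which the cell of `p` is not near `A`
  have hex : ∃ k, ¬ Near A n k (idx n k p.1) (idx n k p.2) := by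
    obtain ⟨k, hk⟩ := exists_scale (by omega : 2 ≤ n) (show (0 : ℝ) < η / 5 by positivity)
    refine ⟨k, not_near_of_le hη ((dist_pos_idx_le (by omega) k hp).trans ?_) (by linarith)⟩
    have : 0 ≤ 1 / (n : ℝ) ^ k := by positivity
    linarith
  classical
  obtain ⟨k', hk', hmin⟩ : ∃ k, ¬ Near A n k (idx n k p.1) (idx n k p.2) ∧
      ∀ m < k, Near A n m (idx n m p.1) (idx n m p.2) :=
    ⟨Nat.find hex, Nat.find_spec hex, fun m hm => not_not.1 (Nat.find_min hex hm)⟩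
  have hx1 : idx n 0 p.1 ≤ 1 := idx_zero_le_one hp.1
  have hy1 : idx n 0 p.2 ≤ 1 := idx_zero_le_one hp.2
  obtain ⟨k, rfl⟩ : ∃ m, k' = m + 1 := Nat.exists_eq_succ_of_ne_zero (by
    rintro rfl
    exact hk' (near_zero hA ⟨a, ha⟩ (by omega) (by omega)))
  obtain ⟨a₁, ha₁, had₁⟩ := hmin k (Nat.lt_succ_self k)
  have hN : (0 : ℝ) < (n : ℝ) ^ k := by positivity
  set h := 1 / (n : ℝ) ^ k with hh
  have h0 : 0 < h := by positivity
  -- the mesh is comparable to the distance of `p` from `A`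
  have hmesh : h ≤ n * dist p a := by
    have h1 : 3 / (n : ℝ) ^ (k + 1) ≤ dist a (pos n (k + 1) (idx n (k + 1) p.1)
        (idx n (k + 1) p.2)) := not_lt.1 fun hlt => hk' ⟨a, ha, hlt⟩
    have h2 := dist_pos_idx_le (by omega : 0 < n) (k + 1) hp
    have h3 := dist_triangle_right a (pos n (k + 1) (idx n (k + 1) p.1) (idx n (k + 1) p.2)) p
    rw [dist_comm] at h3
    have h4 : 3 / (n : ℝ) ^ (k + 1) = 3 * (h / n) := by rw [hh, pow_succ]; field_simp
    have h5 : 1 / (n : ℝ) ^ (k + 1) = h / n := by rw [hh, pow_succ]; field_simp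
    rw [h4] at h1; rw [h5] at h2
    have h7 : dist (pos n (k + 1) (idx n (k + 1) p.1) (idx n (k + 1) p.2)) a ≤
      dist (pos n (k + 1) (idx n (k + 1) p.1) (idx n (k + 1) p.2)) p + dist p a :=
        dist_triangle _ _ _
    have h6 : h / n ≤ dist p a := by
      rw [dist_comm] at h1
      have : 0 < h / n := by positivity
      linarith
    rw [div_le_iff₀ (by linarith)] at h6
    linarith
  have hosc : ∀ b, dist b p ≤ h → ∀ a' ∈ A, dist a' b < 4 * n / (n : ℝ) ^ k →
      dist (f a') (f a) ≤ ρ := by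
    intro b hb a' ha' hd
    refine hρ a' ha' ?_
    have h1 : 4 * n / (n : ℝ) ^ k = 4 * n * h := by rw [hh]; ring
    rw [h1] at hd
    have h2 := dist_triangle4 a' b p a
    nlinarith [mul_le_mul_of_nonneg_left hmesh (by linarith : (0 : ℝ) ≤ 4 * n + 1)]
  set C₁ : ℝ := (2 * n + 1) * ρ with hC₁
  have hC₁0 : 0 ≤ C₁ := by positivity
  have hρC : ρ ≤ C₁ := by rw [hC₁]; nlinarith
  have hcorner : ∀ i' ≤ 1, ∀ j' ≤ 1,
      dist (approx D A f n k (idx n k p.1 + i') (idx n k p.2 + j')) (f a) ≤ C₁ := by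
    intro i' hi j' hj
    have hd := dist_corner_point_le (by omega : 0 < n) k hp hi hj
    refine dist_approx_le hn hc hD ha₁ ?_ ?_ (hosc _ hd)
    · rintro rfl
      exact near_zero hA ⟨a, ha⟩ (by omega) (by omega)
    · have h1 := dist_pos_corner_le (by omega : 0 < n) k (idx n k p.1) (idx n k p.2) hi hj
      rw [dist_comm] at h1
      calc _ ≤ _ := dist_triangle _ (pos n k (idx n k p.1) (idx n k p.2)) _
        _ < 3 / (n : ℝ) ^ k + 1 / (n : ℝ) ^ k := by linarith
        _ = _ := by ring
  have hcell := cellLE_of_corners hcorner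
  have hcorner' : ∀ i' ≤ 1, ∀ j' ≤ 1, dist (approx D A f n (k + 1) (idx n (k + 1) p.1 + i')
      (idx n (k + 1) p.2 + j')) (f a) ≤ (2 * n + 1) * C₁ := by
    intro i' hi j' hj
    by_cases hnear : Near A n (k + 1) (idx n (k + 1) p.1 + i') (idx n (k + 1) p.2 + j')
    · obtain ⟨a', ha', hd', hF⟩ := approx_of_near (D := D) (f := f) hnear
      rw [hF]
      have hd := dist_corner_point_le (by omega : 0 < n) (k + 1) hp hi hj
      have hlt : 1 / (n : ℝ) ^ (k + 1) ≤ h := by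
        rw [hh]
        exact one_div_le_one_div_of_le hN (pow_le_pow_right₀ (by linarith) (Nat.le_succ k))
      refine (hosc _ (hd.trans hlt) a' ha' (hd'.trans_le ?_)).trans (by nlinarith)
      rw [show 3 / (n : ℝ) ^ (k + 1) = 3 * (1 / (n : ℝ) ^ (k + 1)) by ring,
        show 4 * n / (n : ℝ) ^ k = 4 * n * h by rw [hh]; ring]
      nlinarith
    · obtain ⟨u, hu, hu'⟩ := idx_decomp (by omega : 0 < n) k p.1
      obtain ⟨w, hw, hw'⟩ := idx_decomp (by omega : 0 < n) k p.2
      rw [hu', hw', add_assoc, add_assoc] at hnear ⊢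
      have h1 := hcell.dist_child_le (by omega) hc hD (by omega : u + i' ≤ n)
        (by omega : w + j' ≤ n) hnear
      have h2 := hcorner 0 (by simp) 0 (by simp)
      simp only [add_zero] at h2
      linarith [dist_triangle (approx D A f n (k + 1) (idx n k p.1 * n + (u + i'))
        (idx n k p.2 * n + (w + j'))) (approx D A f n k (idx n k p.1) (idx n k p.2)) (f a)]
  have h1 := dist_lim_le (by omega) hc hD (cellLE_of_corners hcorner') hk'
  have h2 := hcorner' 0 (by simp) 0 (by simp)
  simp only [add_zero] at h2
  have h3 := dist_triangle_left (lim D A f n p) (f a)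
    (approx D A f n (k + 1) (idx n (k + 1) p.1) (idx n (k + 1) p.2))
  calc _ ≤ _ := h3
    _ ≤ 2 * n * (2 * ((2 * n + 1) * C₁)) + (2 * n + 1) * C₁ := add_le_add h1 h2
    _ = _ := by rw [hC₁]; ring

/-- The limit of the approximations is continuous away from `A`. -/
theorem continuousWithinAt_lim [Nonempty Z] [CompleteSpace Z] (hn : 2 ≤ n) (hc : IsCombing 0 c)
    (hD : IsDivision c D n) {p : ℝ × ℝ} (hp : p ∈ unitSq) {η : ℝ}
    (hη0 : 0 < η) (hη : ∀ a ∈ A, η ≤ dist a p) {ε : ℝ} (hε : 0 < ε) :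
    ∃ δ > 0, ∀ q ∈ unitSq, dist q p < δ → dist (lim D A f n q) (lim D A f n p) ≤ ε := by
  obtain ⟨k, hk⟩ := exists_scale hn (show (0 : ℝ) < η / 5 by positivity)
  have hn0 : 0 < n := by omega
  have hn' : (2 : ℝ) ≤ n := by exact_mod_cast hn
  have hN : (0 : ℝ) < (n : ℝ) ^ k := by positivity
  -- a common bound for the cells of this grid
  obtain ⟨r, hr⟩ : ∃ r, ∀ x ∈ Set.Iic (n ^ k) ×ˢ Set.Iic (n ^ k),
      CellLE (approx D A f n k) x.1 x.2 r := by
    set F := approx D A f n k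
    obtain ⟨r, hr⟩ := (((Set.finite_Iic (n ^ k)).prod (Set.finite_Iic (n ^ k))).image
      fun x : ℕ × ℕ => dist (F x.1 x.2) (F (x.1 + 1) x.2) +
        dist (F x.1 (x.2 + 1)) (F (x.1 + 1) (x.2 + 1)) + dist (F x.1 x.2) (F x.1 (x.2 + 1)) +
          dist (F (x.1 + 1) x.2) (F (x.1 + 1) (x.2 + 1))).bddAbove
    refine ⟨r, fun x hx => ?_⟩
    have h := hr (Set.mem_image_of_mem _ hx)
    have h1 : 0 ≤ dist (F x.1 x.2) (F (x.1 + 1) x.2) := dist_nonneg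
    have h2 : 0 ≤ dist (F x.1 (x.2 + 1)) (F (x.1 + 1) (x.2 + 1)) := dist_nonneg
    have h3 : 0 ≤ dist (F x.1 x.2) (F x.1 (x.2 + 1)) := dist_nonneg
    have h4 : 0 ≤ dist (F (x.1 + 1) x.2) (F (x.1 + 1) (x.2 + 1)) := dist_nonneg
    constructor <;> linarith
  have hidx : ∀ x ∈ Set.Icc (0 : ℝ) 1, idx n k x ≤ n ^ k := by
    intro x hx
    refine Nat.floor_le_of_le ?_
    push_cast
    exact mul_le_of_le_one_left hN.le hx.2
  have hnear : ∀ q ∈ unitSq, dist q p < 1 / (n : ℝ) ^ k →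
      ¬ Near A n k (idx n k q.1) (idx n k q.2) := by
    intro q hq hqp
    refine not_near_of_le hη ?_ (by linarith)
    linarith [dist_triangle (pos n k (idx n k q.1) (idx n k q.2)) q p,
      dist_pos_idx_le hn0 k hq]
  have hcell : ∀ q ∈ unitSq, dist q p < 1 / (n : ℝ) ^ k → ∀ m,
      CellLE (approx D A f n (k + m)) (idx n (k + m) q.1) (idx n (k + m) q.2) (r / 2 ^ m) ∧
      dist (approx D A f n (k + m) (idx n (k + m) q.1) (idx n (k + m) q.2)) (lim D A f n q) ≤
        2 * n * (r / 2 ^ m) := by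
    intro q hq hqp m
    obtain ⟨h1, h2⟩ := cellLE_of_far hn hc hD
      (hr (idx n k q.1, idx n k q.2) ⟨hidx _ hq.1, hidx _ hq.2⟩) (hnear q hq hqp) m
    exact ⟨h1, dist_lim_le hn hc hD h1 h2⟩
  obtain ⟨m, hm⟩ : ∃ m : ℕ, (4 * n + 2) * (r / 2 ^ m) ≤ ε := by
    have : Tendsto (fun m : ℕ => (4 * n + 2) * (r / 2 ^ m)) atTop (𝓝 ((4 * n + 2) * 0)) :=
      (tendsto_const_nhds.div_atTop (tendsto_pow_atTop_atTop_of_one_lt one_lt_two)).const_mul _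
    rw [mul_zero] at this
    exact ((this.eventually (gt_mem_nhds hε)).mono fun _ h => le_of_lt h).exists
  have hNm : (0 : ℝ) < (n : ℝ) ^ (k + m) := by positivity
  refine ⟨1 / (n : ℝ) ^ (k + m), by positivity, fun q hq hqp => ?_⟩
  have hle : 1 / (n : ℝ) ^ (k + m) ≤ 1 / (n : ℝ) ^ k :=
    one_div_le_one_div_of_le hN (pow_le_pow_right₀ (by linarith) (Nat.le_add_right k m))
  -- the cells of `p` and `q` are both adjacent to the cell of the point `z`
  set z : ℝ × ℝ := (min p.1 q.1, min p.2 q.2) with hz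
  have hzsq : z ∈ unitSq :=
    ⟨⟨le_min hp.1.1 hq.1.1, min_le_of_left_le hp.1.2⟩,
      ⟨le_min hp.2.1 hq.2.1, min_le_of_left_le hp.2.2⟩⟩
  have habs : ∀ x y : ℝ, |min x y - x| ≤ |y - x| := by
    intro x y
    rcases le_total x y with h | h
    · simp [h]
    · simp [h]
  have hzp : dist z p ≤ dist q p := max_le_max (habs _ _) (habs _ _)
  have hmin : ∀ x y, idx n (k + m) (min x y) = min (idx n (k + m) x) (idx n (k + m) y) := by
    intro x y
    unfold idx
    rw [min_mul_of_nonneg _ _ hNm.le]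
    exact (Nat.floor_mono (R := ℝ)).map_min
  have hclose : ∀ x y : ℝ, 0 ≤ x → |y - x| < 1 / (n : ℝ) ^ (k + m) →
      idx n (k + m) y ≤ idx n (k + m) x + 1 := by
    intro x y hx h
    have h1 : y < x + 1 / (n : ℝ) ^ (k + m) := by linarith [(abs_lt.1 h).2]
    have h2 : y * (n : ℝ) ^ (k + m) ≤ x * (n : ℝ) ^ (k + m) + 1 := by
      have := mul_le_mul_of_nonneg_right h1.le hNm.le
      rwa [add_mul, one_div_mul_cancel hNm.ne'] at this
    unfold idx
    calc _ ≤ _ := Nat.floor_mono h2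
      _ = _ := Nat.floor_add_one (by positivity)
  have hd1 : |q.1 - p.1| < 1 / (n : ℝ) ^ (k + m) := (le_max_left _ _).trans_lt hqp
  have hd2 : |q.2 - p.2| < 1 / (n : ℝ) ^ (k + m) := (le_max_right _ _).trans_lt hqp
  have hc1 := hclose p.1 q.1 hp.1.1 hd1
  have hc2 := hclose p.2 q.2 hp.2.1 hd2
  have hc3 := hclose q.1 p.1 hq.1.1 (by rwa [abs_sub_comm])
  have hc4 := hclose q.2 p.2 hq.2.1 (by rwa [abs_sub_comm])
  obtain ⟨hzc, -⟩ := hcell z hzsq (hzp.trans_lt (hqp.trans_le hle)) m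
  obtain ⟨-, hpl⟩ := hcell p hp (by rw [dist_self]; positivity) m
  obtain ⟨-, hql⟩ := hcell q hq (hqp.trans_le hle) m
  have hz1 : idx n (k + m) z.1 = min (idx n (k + m) p.1) (idx n (k + m) q.1) := hmin _ _
  have hz2 : idx n (k + m) z.2 = min (idx n (k + m) p.2) (idx n (k + m) q.2) := hmin _ _
  rw [hz1, hz2] at hzc
  set F := approx D A f n (k + m)
  have hedge : dist (F (idx n (k + m) p.1) (idx n (k + m) p.2))
      (F (idx n (k + m) q.1) (idx n (k + m) q.2)) ≤ 2 * (r / 2 ^ m) := by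
    have h1 : ∀ i i' : ℕ, i' ≤ i + 1 → i ≤ i' + 1 →
        ∃ u ≤ 1, ∃ u' ≤ 1, i = min i i' + u ∧ i' = min i i' + u' := fun i i' h h' =>
      ⟨i - min i i', by omega, i' - min i i', by omega, by omega, by omega⟩
    obtain ⟨u, hu, u', hu', e1, e2⟩ := h1 _ _ hc1 hc3
    obtain ⟨w, hw, w', hw', e3, e4⟩ := h1 _ _ hc2 hc4
    have := hzc.dist_corners_le hu hw hu' hw'
    rwa [← e1, ← e2, ← e3, ← e4] at this
  have := dist_triangle4 (lim D A f n q) (F (idx n (k + m) q.1) (idx n (k + m) q.2))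
    (F (idx n (k + m) p.1) (idx n (k + m) p.2)) (lim D A f n p)
  rw [dist_comm (lim D A f n q) (F _ _), dist_comm (F (idx n (k + m) q.1) _) (F _ _)] at this
  linarith

end GridExtension

open GridExtension in
/-- **Extension theorem.** In a complete space in which quadrilaterals of every size can be divided
uniformly into smaller ones, any map on a closed subset of the square extends to the square in such
a way that continuity, also up to an error, is preserved. -/
theorem exists_extension {Z : Type*} [MetricSpace Z] [CompleteSpace Z] [Nonempty Z]
    {c : Z → Z → ℝ → Z} {n : ℕ} (hn : 4 ≤ n) (hc : IsCombing 0 c)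
    (hdiv : LoopDivision c n (1 / 2) 0) :
    ∃ C : ℝ, 1 ≤ C ∧ ∀ A ⊆ unitSq, IsClosed A → ∀ f : ℝ × ℝ → Z, ∃ E : ℝ × ℝ → Z,
      Set.EqOn E f A ∧ ∀ ε > 0, EpsContOn ε f A → EpsContOn (C * ε) E unitSq := by
  obtain ⟨D, hD⟩ := exists_isDivision hdiv
  have hn' : (4 : ℝ) ≤ n := by exact_mod_cast hn
  set C : ℝ := (4 * n + 1) * (2 * n + 1) ^ 2 with hC
  have hC1 : 1 ≤ C := by
    have h1 : (1 : ℝ) ≤ (2 * n + 1) ^ 2 := one_le_pow₀ (by linarith)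
    nlinarith
  refine ⟨C, hC1, fun A hA hAc f => ?_⟩
  classical
  rcases A.eq_empty_or_nonempty with rfl | hne
  · obtain ⟨z⟩ := ‹Nonempty Z›
    exact ⟨fun _ => z, by simp, fun ε hε _ p _ => Eventually.of_forall fun q => by
      rw [dist_self]; positivity⟩
  refine ⟨fun p => if p ∈ A then f p else lim D A f n p, fun p hp => if_pos hp, ?_⟩
  intro ε hε hf p hp
  by_cases hpA : p ∈ A
  · obtain ⟨δ, hδ, hball⟩ := Metric.mem_nhdsWithin_iff.1 (hf p hpA)
    have hM : (0 : ℝ) < 4 * n ^ 2 + n + 1 := by positivity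
    have hδ' : 0 < δ / (2 * (4 * n ^ 2 + n + 1)) := by positivity
    filter_upwards [self_mem_nhdsWithin, nhdsWithin_le_nhds (Metric.ball_mem_nhds p hδ'),
      nhdsWithin_le_nhds (Metric.ball_mem_nhds p hδ)] with q hq hqp hqp'
    rw [if_pos hpA]
    by_cases hqA : q ∈ A
    · rw [if_pos hqA]
      have : dist (f q) (f p) ≤ ε := hball ⟨hqp', hqA⟩
      nlinarith
    · rw [if_neg hqA]
      obtain ⟨η, hη0, hη⟩ : ∃ η > 0, ∀ a ∈ A, η ≤ dist a q := by
        obtain ⟨η, hη0, h⟩ := Metric.isOpen_iff.1 hAc.isOpen_compl q hqA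
        exact ⟨η, hη0, fun a ha => not_lt.1 fun hlt => h hlt ha⟩
      refine dist_lim_le_of_osc hn hc hD hA hq hη0 hη hpA fun a' ha' hd => ?_
      refine hball ⟨?_, ha'⟩
      rw [Metric.mem_ball] at hqp ⊢
      rw [lt_div_iff₀ (by positivity)] at hqp
      have h0 : 0 ≤ dist q p := dist_nonneg
      nlinarith
  · obtain ⟨η, hη0, hη⟩ : ∃ η > 0, ∀ a ∈ A, η ≤ dist a p := by
      obtain ⟨η, hη0, h⟩ := Metric.isOpen_iff.1 hAc.isOpen_compl p hpA
      exact ⟨η, hη0, fun a ha => not_lt.1 fun hlt => h hlt ha⟩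
    obtain ⟨δ, hδ, hlim⟩ := continuousWithinAt_lim (f := f) (by omega : 2 ≤ n) hc hD hp hη0 hη
      (show 0 < C * ε by positivity)
    filter_upwards [self_mem_nhdsWithin, nhdsWithin_le_nhds (Metric.ball_mem_nhds p hδ),
      nhdsWithin_le_nhds (hAc.isOpen_compl.mem_nhds hpA)] with q hq hqp hqA
    rw [if_neg hpA, if_neg hqA]
    exact hlim q hq hqp

/-- The conclusion of the extension theorem `exists_extension`, as a property of a space. -/
def UniformExtension (Z : Type*) [PseudoMetricSpace Z] (C : ℝ) : Prop :=
  1 ≤ C ∧ ∀ A ⊆ unitSq, IsClosed A → ∀ f : ℝ × ℝ → Z, ∃ E : ℝ × ℝ → Z,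
    Set.EqOn E f A ∧ ∀ ε > 0, EpsContOn ε f A → EpsContOn (C * ε) E unitSq

theorem UniformExtension.exists_continuousOn {Z : Type*} [PseudoMetricSpace Z] {C : ℝ}
    (hZ : UniformExtension Z C) {A : Set (ℝ × ℝ)} (hA : A ⊆ unitSq) (hAc : IsClosed A)
    {f : ℝ × ℝ → Z} (hf : ContinuousOn f A) :
    ∃ E : ℝ × ℝ → Z, ContinuousOn E unitSq ∧ Set.EqOn E f A := by
  obtain ⟨E, hEf, hE⟩ := hZ.2 A hA hAc f
  have hC : 0 < C := by linarith [hZ.1]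
  refine ⟨E, continuousOn_of_epsContOn fun ε hε => ?_, hEf⟩
  have := hE (ε / C) (by positivity) (hf.epsContOn (by positivity))
  rwa [mul_div_cancel₀ _ hC.ne'] at this

theorem UniformExtension.exists_continuousOn_Icc {Z : Type*} [PseudoMetricSpace Z] {C : ℝ}
    (hZ : UniformExtension Z C) {B : Set ℝ} (hB : B ⊆ Set.Icc 0 1) (hBc : IsClosed B)
    {f : ℝ → Z} (hf : ContinuousOn f B) :
    ∃ e : ℝ → Z, ContinuousOn e (Set.Icc 0 1) ∧ Set.EqOn e f B := by
  have h0 : (0 : ℝ) ∈ Set.Icc (0 : ℝ) 1 := by simp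
  obtain ⟨E, hE, hEf⟩ := hZ.exists_continuousOn (A := B ×ˢ {0}) (f := fun p => f p.1)
    (Set.prod_mono hB (by simp)) (hBc.prod isClosed_singleton)
    (hf.comp continuousOn_fst fun p hp => hp.1)
  refine ⟨fun s => E (s, 0), hE.comp (by fun_prop) fun s hs => ⟨hs, h0⟩, fun s hs => ?_⟩
  exact hEf (x := (s, 0)) ⟨hs, rfl⟩

/-! ### The boundary of the square -/

/-- The boundary of the closed unit square. -/
def sqBoundary : Set (ℝ × ℝ) := {p ∈ unitSq | p.2 = 0 ∨ p.2 = 1 ∨ p.1 = 0 ∨ p.1 = 1}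

theorem isClosed_unitSq : IsClosed unitSq := isClosed_Icc.prod isClosed_Icc

theorem isCompact_unitSq : IsCompact unitSq := isCompact_Icc.prod isCompact_Icc

theorem sqBoundary_subset : sqBoundary ⊆ unitSq := fun _ hp => hp.1

theorem isClosed_sqBoundary : IsClosed sqBoundary := by
  refine IsClosed.inter (s₂ := {p : ℝ × ℝ | p.2 = 0 ∨ p.2 = 1 ∨ p.1 = 0 ∨ p.1 = 1})
    isClosed_unitSq ?_
  exact (isClosed_eq continuous_snd continuous_const).union
    ((isClosed_eq continuous_snd continuous_const).union
      ((isClosed_eq continuous_fst continuous_const).union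
        (isClosed_eq continuous_fst continuous_const)))

/-- The map on the boundary of the square that is given by `b` on the bottom side, `t` on the top
side, `l` on the left and `r` on the right. -/
noncomputable def sides {Z : Type*} (b t l r : ℝ → Z) (p : ℝ × ℝ) : Z :=
  open Classical in
  if p.2 = 0 then b p.1 else if p.2 = 1 then t p.1 else if p.1 = 0 then l p.2 else r p.2

section Sides

variable {Z : Type*} {b t l r : ℝ → Z}

theorem sides_bottom (x : ℝ) : sides b t l r (x, 0) = b x := by simp [sides]

theorem sides_top (x : ℝ) : sides b t l r (x, 1) = t x := by simp [sides]

theorem sides_left (h0 : l 0 = b 0) (h1 : l 1 = t 0) (y : ℝ) : sides b t l r (0, y) = l y := by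
  unfold sides
  dsimp only
  split_ifs with h h'
  · rw [h, h0]
  · rw [h', h1]
  · rfl
  · contradiction

theorem sides_right (h0 : r 0 = b 1) (h1 : r 1 = t 1) (y : ℝ) : sides b t l r (1, y) = r y := by
  unfold sides
  dsimp only
  split_ifs with h h' h''
  · rw [h, h0]
  · rw [h', h1]
  · exact absurd h'' one_ne_zero
  · rfl

theorem continuousOn_sides [TopologicalSpace Z] (hb : ContinuousOn b (Set.Icc 0 1))
    (ht : ContinuousOn t (Set.Icc 0 1)) (hl : ContinuousOn l (Set.Icc 0 1))
    (hr : ContinuousOn r (Set.Icc 0 1)) (hl0 : l 0 = b 0) (hl1 : l 1 = t 0) (hr0 : r 0 = b 1)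
    (hr1 : r 1 = t 1) : ContinuousOn (sides b t l r) sqBoundary := by
  have e : sqBoundary = (unitSq ∩ {p | p.2 = 0}) ∪ ((unitSq ∩ {p | p.2 = 1}) ∪
      ((unitSq ∩ {p | p.1 = 0}) ∪ (unitSq ∩ {p | p.1 = 1}))) := by
    ext p
    simp only [sqBoundary, Set.mem_ofPred_eq, Set.mem_union, Set.mem_inter_iff]
    tauto
  have c1 : IsClosed (unitSq ∩ {p | p.2 = 0}) :=
    isClosed_unitSq.inter (isClosed_eq continuous_snd continuous_const)
  have c2 : IsClosed (unitSq ∩ {p | p.2 = 1}) :=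
    isClosed_unitSq.inter (isClosed_eq continuous_snd continuous_const)
  have c3 : IsClosed (unitSq ∩ {p | p.1 = 0}) :=
    isClosed_unitSq.inter (isClosed_eq continuous_fst continuous_const)
  have c4 : IsClosed (unitSq ∩ {p | p.1 = 1}) :=
    isClosed_unitSq.inter (isClosed_eq continuous_fst continuous_const)
  rw [e]
  refine ContinuousOn.union_of_isClosed ?_ (ContinuousOn.union_of_isClosed ?_
    (ContinuousOn.union_of_isClosed ?_ ?_ c3 c4) c2 (c3.union c4)) c1 (c2.union (c3.union c4))
  · refine (hb.comp continuousOn_fst fun p hp => hp.1.1).congr fun p hp => ?_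
    obtain ⟨x, y⟩ := p
    obtain rfl : y = 0 := hp.2
    exact sides_bottom x
  · refine (ht.comp continuousOn_fst fun p hp => hp.1.1).congr fun p hp => ?_
    obtain ⟨x, y⟩ := p
    obtain rfl : y = 1 := hp.2
    exact sides_top x
  · refine (hl.comp continuousOn_snd fun p hp => hp.1.2).congr fun p hp => ?_
    obtain ⟨x, y⟩ := p
    obtain rfl : x = 0 := hp.2
    exact sides_left hl0 hl1 y
  · refine (hr.comp continuousOn_snd fun p hp => hp.1.2).congr fun p hp => ?_
    obtain ⟨x, y⟩ := p
    obtain rfl : x = 1 := hp.2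
    exact sides_right hr0 hr1 y

end Sides

/-! ### Homotopies as maps on the square -/

section Homotopy

open unitInterval

variable {X : Type*} [TopologicalSpace X]

theorem Path.Homotopic.of_continuousOn {x y : X} {p q : Path x y} {F : ℝ × ℝ → X}
    (hF : ContinuousOn F unitSq) (h0 : ∀ s : I, F (0, s) = p s) (h1 : ∀ s : I, F (1, s) = q s)
    (hx : ∀ t ∈ Set.Icc (0 : ℝ) 1, F (t, 0) = x) (hy : ∀ t ∈ Set.Icc (0 : ℝ) 1, F (t, 1) = y) :
    p.Homotopic q := by
  refine ⟨⟨⟨⟨fun z : I × I => F (z.1, z.2), ?_⟩, ?_, ?_⟩, ?_⟩⟩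
  · exact hF.comp_continuous (by fun_prop) fun z => ⟨z.1.2, z.2.2⟩
  · intro s; exact h0 s
  · intro s; exact h1 s
  · rintro t s (rfl | rfl)
    · simpa using hx t t.2
    · simpa using hy t t.2

theorem Path.Homotopic.exists_continuous {x y : X} {p q : Path x y} (h : p.Homotopic q) :
    ∃ F : ℝ × ℝ → X, Continuous F ∧ (∀ s : I, F (0, s) = p s) ∧ (∀ s : I, F (1, s) = q s) ∧
      (∀ t, F (t, 0) = x) ∧ ∀ t, F (t, 1) = y := by
  obtain ⟨H⟩ := h
  refine ⟨fun z => H (Set.projIcc 0 1 zero_le_one z.1, Set.projIcc 0 1 zero_le_one z.2),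
    ?_, ?_, ?_, ?_, ?_⟩
  · exact H.continuous.comp ((continuous_projIcc.comp continuous_fst).prodMk
      (continuous_projIcc.comp continuous_snd))
  · intro s; simp
  · intro s; simp
  · intro t; simp
  · intro t; simp

/-- A path connected space with the extension property is simply connected. -/
theorem UniformExtension.simplyConnectedSpace {Z : Type*} [PseudoMetricSpace Z]
    [PathConnectedSpace Z] {C : ℝ} (hZ : UniformExtension Z C) : SimplyConnectedSpace Z := by
  refine simply_connected_iff_paths_homotopic'.2 ⟨inferInstance, fun {x y} p q => ?_⟩
  obtain ⟨E, hE, hEf⟩ := hZ.exists_continuousOn sqBoundary_subset isClosed_sqBoundary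
    (continuousOn_sides (b := fun _ => x) (t := fun _ => y) (l := p.extend) (r := q.extend)
      continuousOn_const continuousOn_const p.extend.continuous.continuousOn
      q.extend.continuous.continuousOn (by simp) (by simp) (by simp) (by simp))
  have h0 : (0 : ℝ) ∈ Set.Icc (0 : ℝ) 1 := by simp
  have h1 : (1 : ℝ) ∈ Set.Icc (0 : ℝ) 1 := by simp
  refine Path.Homotopic.of_continuousOn hE (fun s => ?_) (fun s => ?_) (fun t ht => ?_)
    fun t ht => ?_
  · rw [hEf ⟨⟨h0, s.2⟩, by simp⟩, sides_left (by simp) (by simp)]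
    simp
  · rw [hEf ⟨⟨h1, s.2⟩, by simp⟩, sides_right (by simp) (by simp)]
    simp
  · rw [hEf ⟨⟨ht, h0⟩, by simp⟩, sides_bottom]
  · rw [hEf ⟨⟨ht, h1⟩, by simp⟩, sides_top]

/-- In a simply connected space, maps on the boundary of the square extend to the square. -/
theorem exists_continuousOn_unitSq_of_simplyConnected {Z : Type*} [PseudoMetricSpace Z]
    [SimplyConnectedSpace Z] {b : ℝ × ℝ → Z} (hb : ContinuousOn b sqBoundary) :
    ∃ g : ℝ × ℝ → Z, ContinuousOn g unitSq ∧ Set.EqOn g b sqBoundary := by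
  have h0 : (0 : ℝ) ∈ Set.Icc (0 : ℝ) 1 := by simp
  have h1 : (1 : ℝ) ∈ Set.Icc (0 : ℝ) 1 := by simp
  -- the four sides as paths
  let pb : Path (b (0, 0)) (b (1, 0)) := ⟨⟨fun s => b (s, 0), hb.comp_continuous (by fun_prop)
    fun s => ⟨⟨s.2, h0⟩, by simp⟩⟩, by simp, by simp⟩
  let pt : Path (b (0, 1)) (b (1, 1)) := ⟨⟨fun s => b (s, 1), hb.comp_continuous (by fun_prop)
    fun s => ⟨⟨s.2, h1⟩, by simp⟩⟩, by simp, by simp⟩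
  let pl : Path (b (0, 0)) (b (0, 1)) := ⟨⟨fun s => b (0, s), hb.comp_continuous (by fun_prop)
    fun s => ⟨⟨h0, s.2⟩, by simp⟩⟩, by simp, by simp⟩
  let pr : Path (b (1, 0)) (b (1, 1)) := ⟨⟨fun s => b (1, s), hb.comp_continuous (by fun_prop)
    fun s => ⟨⟨h1, s.2⟩, by simp⟩⟩, by simp, by simp⟩
  obtain ⟨H, hH, hH0, hH1, hHx, hHy⟩ :=
    (SimplyConnectedSpace.paths_homotopic (pb.trans pr) (pl.trans pt)).exists_continuous
  -- the antidiagonals of the square correspond to the tracks of the homotopy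
  set T : ℝ × ℝ → ℝ := fun p => min p.2 (1 - p.1) / min (p.1 + p.2) (2 - p.1 - p.2) with hT
  set S : ℝ × ℝ → ℝ := fun p => (p.1 + p.2) / 2 with hS
  have hSc : Continuous S := by fun_prop
  have hT01 : ∀ p ∈ unitSq, T p ∈ Set.Icc (0 : ℝ) 1 := by
    rintro ⟨x, y⟩ ⟨⟨hx0, hx1⟩, ⟨hy0, hy1⟩⟩
    dsimp only at hx0 hx1 hy0 hy1
    have a1 : 0 ≤ min y (1 - x) := le_min hy0 (by linarith)
    have a2 : min y (1 - x) ≤ min (x + y) (2 - x - y) :=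
      le_min ((min_le_left _ _).trans (by linarith)) ((min_le_right _ _).trans (by linarith))
    exact ⟨div_nonneg a1 (a1.trans a2), div_le_one_of_le₀ a2 (a1.trans a2)⟩
  -- `T` has no limit at the corners `(0, 0)` and `(1, 1)`, but `H` does not depend on `T` there
  have hcorner : ∀ s z, (∀ t, H (t, s) = z) → ∀ p, S p = s →
      ContinuousWithinAt (fun p => H (T p, S p)) unitSq p := by
    intro s z hz p hp
    have huc : UniformContinuousOn H (Set.Icc 0 1 ×ˢ Set.Icc (s - 1) (s + 1)) :=
      (isCompact_Icc.prod isCompact_Icc).uniformContinuousOn_of_continuous hH.continuousOn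
    refine Metric.continuousWithinAt_iff'.2 fun ε hε => ?_
    obtain ⟨δ, hδ, h⟩ := Metric.uniformContinuousOn_iff.1 huc ε hε
    have : ∀ᶠ q in 𝓝[unitSq] p, dist (S q) (S p) < min δ 1 :=
      nhdsWithin_le_nhds ((Metric.tendsto_nhds.1 hSc.continuousAt) _ (lt_min hδ one_pos))
    filter_upwards [self_mem_nhdsWithin, this] with q hq hd
    rw [hp] at hd ⊢
    rw [hz (T p), ← hz (T q)]
    have hd1 := hd.trans_le (min_le_right _ _)
    rw [Real.dist_eq, abs_lt] at hd1
    refine h (T q, S q) ⟨hT01 q hq, by constructor <;> linarith⟩ (T q, s)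
      ⟨hT01 q hq, by constructor <;> linarith⟩ ?_
    rw [Prod.dist_eq, dist_self]
    exact max_lt hδ (hd.trans_le (min_le_left _ _))
  refine ⟨fun p => H (T p, S p), fun p hp => ?_, ?_⟩
  · by_cases hS0 : S p = 0
    · exact hcorner 0 _ hHx p hS0
    by_cases hS1 : S p = 1
    · exact hcorner 1 _ hHy p hS1
    have hden : min (p.1 + p.2) (2 - p.1 - p.2) ≠ 0 := by
      obtain ⟨⟨hx0, hx1⟩, ⟨hy0, hy1⟩⟩ := hp
      have a0 : p.1 + p.2 ≠ 0 := fun h => hS0 (by simp only [hS]; linarith)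
      have a1 : p.1 + p.2 ≠ 2 := fun h => hS1 (by simp only [hS]; linarith)
      refine (lt_min ?_ ?_).ne'
      · exact lt_of_le_of_ne (by linarith) a0.symm
      · have := lt_of_le_of_ne (by linarith : p.1 + p.2 ≤ 2) a1
        linarith
    have hTc : ContinuousAt T p := by
      refine ContinuousAt.div ?_ ?_ hden <;> fun_prop
    exact (hH.continuousAt.comp (hTc.prodMk hSc.continuousAt)).continuousWithinAt
  · rintro ⟨x, y⟩ ⟨⟨⟨hx0, hx1⟩, ⟨hy0, hy1⟩⟩, h⟩
    dsimp only at hx0 hx1 hy0 hy1 h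
    have hval0 : ∀ s (hs : s ∈ Set.Icc (0 : ℝ) 1), H (0, s) = (pb.trans pr) ⟨s, hs⟩ :=
      fun s hs => hH0 ⟨s, hs⟩
    have hval1 : ∀ s (hs : s ∈ Set.Icc (0 : ℝ) 1), H (1, s) = (pl.trans pt) ⟨s, hs⟩ :=
      fun s hs => hH1 ⟨s, hs⟩
    have hs : (x + y) / 2 ∈ Set.Icc (0 : ℝ) 1 := ⟨by linarith, by linarith⟩
    simp only [hT, hS]
    rcases h with rfl | rfl | rfl | rfl
    · rw [min_eq_left (by linarith : (0 : ℝ) ≤ 1 - x), zero_div, hval0 _ hs, Path.trans_apply,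
        dif_pos (by simp; linarith)]
      simp only [pb, Path.coe_mk', ContinuousMap.coe_mk]
      congr 2; ring
    · by_cases hx : x = 1
      · subst hx
        norm_num
        rw [hHy]
      · have hx' : 1 - x ≠ 0 := fun h => hx (by linarith)
        rw [min_eq_right (by linarith : 1 - x ≤ 1),
          min_eq_right (by linarith : 2 - x - 1 ≤ x + 1), show 2 - x - 1 = 1 - x by ring,
          div_self hx', hval1 _ hs, Path.trans_apply]
        split_ifs with hle
        · have : x = 0 := by simp only at hle; linarith
          subst this
          simp only [pl, Path.coe_mk', ContinuousMap.coe_mk]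
          congr 2; norm_num
        · simp only [pt, Path.coe_mk', ContinuousMap.coe_mk]
          congr 2; ring
    · by_cases hy : y = 0
      · subst hy
        norm_num
        rw [hHx]
      · rw [show (1 : ℝ) - 0 = 1 by ring, min_eq_left hy1, zero_add,
          min_eq_left (by linarith : y ≤ 2 - 0 - y), div_self hy, ← zero_add y, hval1 _ hs,
          Path.trans_apply, dif_pos (by simp; linarith)]
        simp only [pl, Path.coe_mk', ContinuousMap.coe_mk]
        congr 2; ring
    · rw [sub_self, min_eq_right hy0, zero_div, hval0 _ hs, Path.trans_apply]
      split_ifs with hle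
      · have : y = 0 := by simp only at hle; linarith
        subst this
        simp only [pb, Path.coe_mk', ContinuousMap.coe_mk]
        congr 2; norm_num
      · simp only [pr, Path.coe_mk', ContinuousMap.coe_mk]
        congr 2; ring

end Homotopy

/-! ### Loops separated by a simply connected subspace -/

section Separation

open unitInterval

/-- A pointwise relation between paths is preserved by concatenation. -/
theorem Path.trans_rel {X Y W : Type*} [TopologicalSpace X] [TopologicalSpace Y]
    [TopologicalSpace W] (R : X → Y → W → Prop) {x₀ x₁ x₂ : X} {y₀ y₁ y₂ : Y} {w₀ w₁ w₂ : W}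
    {p : Path x₀ x₁} {q : Path x₁ x₂} {p' : Path y₀ y₁} {q' : Path y₁ y₂} {p'' : Path w₀ w₁}
    {q'' : Path w₁ w₂} (hp : ∀ s, R (p s) (p' s) (p'' s)) (hq : ∀ s, R (q s) (q' s) (q'' s))
    (s : I) : R ((p.trans q) s) ((p'.trans q') s) ((p''.trans q'') s) := by
  simp only [Path.trans_apply]
  split_ifs with h
  · exact hp _
  · exact hq _

theorem continuousOn_ite_of_cover {α X : Type*} [TopologicalSpace α] [TopologicalSpace X]
    {S₁ S₂ : Set α} (h₁ : IsClosed S₁) (h₂ : IsClosed S₂) {f g : α → X} {T : Set α}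
    (hT : T ⊆ S₁ ∪ S₂) (hTc : IsClosed T) (hf : ContinuousOn f T) (hg : ContinuousOn g T)
    (heq : ∀ p ∈ T, p ∈ S₁ → p ∈ S₂ → f p = g p) :
    ContinuousOn (fun p => open Classical in if p ∈ S₁ then f p else g p) T := by
  have : T = (T ∩ S₁) ∪ (T ∩ S₂) := by
    rw [← Set.inter_union_distrib_left, Set.inter_eq_left.2 hT]
  rw [this]
  refine ContinuousOn.union_of_isClosed ?_ ?_ (hTc.inter h₁) (hTc.inter h₂)
  · exact (hf.mono Set.inter_subset_left).congr fun p hp => if_pos hp.2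
  · refine (hg.mono Set.inter_subset_left).congr fun p hp => ?_
    split_ifs with h
    · exact heq p hp.1 h hp.2
    · rfl

/-- Suppose that the range of `ι`, a simply connected space with the extension property, separates
`X` into the sides `S₁` and `S₂`. If a loop `γ` in `S₁` is freely homotopic to a loop in `S₂`, then
`γ` is null-homotopic: the part of the homotopy that lies in `S₂` can be replaced by a map into the
separating subspace. -/
theorem Path.Homotopic.refl_of_separated {X Y : Type*} [MetricSpace X] [MetricSpace Y]
    [SimplyConnectedSpace Y] {C : ℝ} (hY : UniformExtension Y C) {ι : Y → X}
    (hι : IsClosedEmbedding ι) {S₁ S₂ : Set X} (hS₁ : IsClosed S₁) (hS₂ : IsClosed S₂)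
    (hcov : ∀ z, z ∈ S₁ ∨ z ∈ S₂) (hint : S₁ ∩ S₂ = Set.range ι) {x y : X} {γ : Path x x}
    {δ : Path x y} {γ' : Path y y} (hγ : ∀ s, γ s ∈ S₁) (hγ' : ∀ s, γ' s ∈ S₂)
    (h : γ.Homotopic ((δ.trans γ').trans δ.symm)) : γ.Homotopic (Path.refl x) := by
  classical
  have h0 : (0 : ℝ) ∈ Set.Icc (0 : ℝ) 1 := by simp
  have h1 : (1 : ℝ) ∈ Set.Icc (0 : ℝ) 1 := by simp
  have : Nonempty Y := inferInstance
  set κ : X → Y := Function.invFun ι with hκdef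
  have hκ : ∀ z ∈ Set.range ι, ι (κ z) = z := fun z hz => Function.invFun_eq hz
  have hκc : ∀ {α : Type} [TopologicalSpace α] {f : α → X} {B : Set α}, ContinuousOn f B →
      (∀ p ∈ B, f p ∈ Set.range ι) → ContinuousOn (fun p => κ (f p)) B := by
    intro α _ f B hf hB
    rw [hι.isInducing.continuousOn_iff]
    exact hf.congr fun p hp => hκ _ (hB p hp)
  have hrange : IsClosed (Set.range ι) := hι.isClosed_range
  have hx₁ : x ∈ S₁ := by simpa using hγ 0
  have hy₂ : y ∈ S₂ := by simpa using hγ' 0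
  -- the replacement of `δ`
  have hδc : ContinuousOn δ.extend (Set.Icc 0 1) := δ.extend.continuous.continuousOn
  obtain ⟨eδ, heδ, heδ'⟩ := hY.exists_continuousOn_Icc
    (B := Set.Icc 0 1 ∩ δ.extend ⁻¹' Set.range ι) Set.inter_subset_left
    (isClosed_Icc.inter (hrange.preimage δ.extend.continuous))
    (hκc (hδc.mono Set.inter_subset_left) fun p hp => hp.2)
  let pδ : Path (eδ 0) (eδ 1) := ⟨⟨fun s => eδ s, heδ.comp_continuous (by fun_prop)
    fun s => s.2⟩, by simp, by simp⟩
  have hδι : ∀ s : I, δ s ∈ Set.range ι → pδ s = κ (δ s) := by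
    intro s hs
    have := heδ' (x := (s : ℝ)) ⟨s.2, by simpa using hs⟩
    simpa [pδ] using this
  -- the replacement of `γ'`
  obtain ⟨eγ, heγ, heγ'⟩ := hY.exists_continuousOn_Icc
    (B := (Set.Icc 0 1 ∩ γ'.extend ⁻¹' Set.range ι) ∪ {0, 1})
    (f := fun s => if s = 0 ∨ s = 1 then eδ 1 else κ (γ'.extend s))
    (Set.union_subset Set.inter_subset_left (by rintro s (rfl | rfl) <;> simp))
    ((isClosed_Icc.inter (hrange.preimage γ'.extend.continuous)).union
      (Set.toFinite _).isClosed) (by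
      refine ContinuousOn.union_of_isClosed ?_ ?_
        (isClosed_Icc.inter (hrange.preimage γ'.extend.continuous)) (Set.toFinite _).isClosed
      · refine (hκc (f := γ'.extend) γ'.extend.continuous.continuousOn
          fun p hp => hp.2).congr fun s hs => ?_
        dsimp only
        split_ifs with hs01
        · have hys : γ'.extend s = y := by rcases hs01 with rfl | rfl <;> simp
          have hyr : y ∈ Set.range ι := hys ▸ hs.2
          have := hδι 1 (by simpa using hyr)
          rw [hys]
          simpa [pδ] using this
        · rfl
      · exact continuousOn_const.congr fun s hs => if_pos hs)
  have heγ0 : eγ 0 = eδ 1 := by rw [heγ' (by simp)]; simp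
  have heγ1 : eγ 1 = eδ 1 := by rw [heγ' (by simp)]; simp
  let pγ : Path (eδ 1) (eδ 1) := ⟨⟨fun s => eγ s, heγ.comp_continuous (by fun_prop)
    fun s => s.2⟩, by simpa using heγ0, by simpa using heγ1⟩
  have hγι : ∀ s : I, γ' s ∈ Set.range ι → pγ s = κ (γ' s) := by
    intro s hs
    have := heγ' (x := (s : ℝ)) (Or.inl ⟨s.2, by simpa using hs⟩)
    simp only at this
    split_ifs at this with hs01
    · have hys : γ' s = y := by
        rcases hs01 with h | h
        · rw [show s = 0 from Subtype.ext h]; simp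
        · rw [show s = 1 from Subtype.ext h]; simp
      have h2 := hδι 1 (by simpa [← hys] using hs)
      rw [hys]
      simpa [pδ, pγ, this] using h2
    · simpa [pγ] using this
  -- the paths in `X` that result from the replacements
  have hδ'c : Continuous fun s : I => if δ s ∈ S₁ then δ s else ι (pδ s) := by
    rw [← continuousOn_univ]
    refine continuousOn_ite_of_cover (S₁ := δ ⁻¹' S₁) (S₂ := δ ⁻¹' S₂)
      (hS₁.preimage δ.continuous) (hS₂.preimage δ.continuous) (fun s _ => hcov _) isClosed_univ
      δ.continuous.continuousOn (hι.continuous.comp pδ.continuous).continuousOn ?_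
    intro s _ hs₁ hs₂
    have hs : δ s ∈ Set.range ι := hint ▸ ⟨hs₁, hs₂⟩
    rw [hδι s hs, hκ _ hs]
  let δ' : Path x (ι (eδ 1)) := ⟨⟨_, hδ'c⟩, by simp [hx₁], by
    simp only [Path.target]
    split_ifs with hy₁
    · have hyr : y ∈ Set.range ι := hint ▸ ⟨hy₁, hy₂⟩
      have := hδι 1 (by simpa using hyr)
      rw [Path.target, Path.target] at this
      rw [this, hκ _ hyr]
    · rfl⟩
  let γ'' : Path (ι (eδ 1)) (ι (eδ 1)) := pγ.map hι.continuous
  -- the relation between the three paths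
  -- which is preserved by concatenation (`Path.trans_rel`)
  let R : X → Y → X → Prop := fun a b c =>
    (a ∈ Set.range ι → b = κ a) ∧ c = if a ∈ S₁ then a else ι b
  have hRδ : ∀ s, R (δ s) (pδ s) (δ' s) := fun s => ⟨hδι s, rfl⟩
  have hRγ : ∀ s, R (γ' s) (pγ s) (γ'' s) := by
    refine fun s => ⟨hγι s, ?_⟩
    change ι (pγ s) = _
    split_ifs with hs
    · have hr : γ' s ∈ Set.range ι := hint ▸ ⟨hs, hγ' s⟩
      rw [hγι s hr, hκ _ hr]
    · rfl
  have hR := Path.trans_rel R (Path.trans_rel R hRδ hRγ) (p := δ.trans γ') (q := δ.symm)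
    (q' := pδ.symm) (q'' := δ'.symm) fun s => hRδ (σ s)
  -- the homotopy and its replacement
  obtain ⟨F, hF, hF0, hF1, hFx, hFy⟩ := h.exists_continuous
  set w := (pδ.trans pγ).trans pδ.symm with hw
  have hrightc : IsClosed (unitSq ∩ {p : ℝ × ℝ | p.1 = 1}) :=
    isClosed_unitSq.inter (isClosed_eq continuous_fst continuous_const)
  obtain ⟨E, hE, hEf⟩ := hY.exists_continuousOn
    (A := (unitSq ∩ F ⁻¹' Set.range ι) ∪ (unitSq ∩ {p : ℝ × ℝ | p.1 = 1}))
    (f := fun p => if p.1 = 1 then w.extend p.2 else κ (F p))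
    (Set.union_subset Set.inter_subset_left Set.inter_subset_left)
    ((isClosed_unitSq.inter (hrange.preimage hF)).union hrightc) (by
      refine ContinuousOn.union_of_isClosed ?_ ?_
        (isClosed_unitSq.inter (hrange.preimage hF)) hrightc
      · refine (hκc hF.continuousOn fun p hp => hp.2).congr fun p hp => ?_
        dsimp only
        split_ifs with hp1
        · obtain ⟨t, s⟩ := p
          obtain rfl : t = 1 := hp1
          have h1s := hF1 ⟨s, hp.1.2⟩
          have hr : F (1, s) ∈ Set.range ι := hp.2
          simp only at h1s
          rw [h1s] at hr ⊢
          rw [w.extend_apply hp.1.2]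
          exact (hR ⟨s, hp.1.2⟩).1 hr
        · rfl
      · exact (w.extend.continuous.comp continuous_snd).continuousOn.congr
          fun p hp => if_pos hp.2)
  have hF'c : ContinuousOn (fun p => if p ∈ F ⁻¹' S₁ then F p else ι (E p)) unitSq := by
    refine continuousOn_ite_of_cover (hS₁.preimage hF) (hS₂.preimage hF) (fun s _ => hcov _)
      isClosed_unitSq hF.continuousOn (hι.continuous.comp_continuousOn hE) ?_
    intro p hp hp₁ hp₂
    have hr : F p ∈ Set.range ι := hint ▸ ⟨hp₁, hp₂⟩
    rw [hEf (Or.inl ⟨hp, hr⟩)]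
    dsimp only
    split_ifs with hp1
    · obtain ⟨t, s⟩ := p
      obtain rfl : t = 1 := hp1
      have h1s := hF1 ⟨s, hp.2⟩
      simp only at h1s
      have hr' : ((δ.trans γ').trans δ.symm) ⟨s, hp.2⟩ ∈ Set.range ι := h1s ▸ hr
      rw [w.extend_apply hp.2, h1s, (hR ⟨s, hp.2⟩).1 hr', hκ _ hr']
    · rw [hκ _ hr]
  have key : γ.Homotopic ((δ'.trans γ'').trans δ'.symm) := by
    refine Path.Homotopic.of_continuousOn hF'c (fun s => ?_) (fun s => ?_) (fun t ht => ?_)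
      fun t ht => ?_
    · simp [hF0, hγ s]
    · rw [(hR s).2]
      simp only [Set.mem_preimage, hF1]
      split_ifs with hs
      · rfl
      · rw [hEf (Or.inr ⟨⟨h1, s.2⟩, rfl⟩)]
        simp [hw]
    · simp [hFx, hx₁]
    · simp [hFy, hx₁]
  have hnull : γ''.Homotopic (Path.refl _) := by
    have := (SimplyConnectedSpace.paths_homotopic pγ (Path.refl _)).map ⟨ι, hι.continuous⟩
    exact this
  refine key.trans ?_
  rw [← Path.Homotopic.Quotient.eq] at hnull ⊢
  simp [hnull]

end Separation

/-! ### Asymptotic cones: limits of distances, completeness -/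

namespace ConeSequence

variable {X : Type*} [PseudoMetricSpace X] {ω : Ultrafilter ℕ} {e : ℕ → X} {d : ℕ → ℝ}
  {hd : Tendsto d ω atTop}

theorem dist_le_of_eventually {x y : ConeSequence X ω e d hd} {r : ℝ}
    (h : ∀ᶠ n in (ω : Filter ℕ), dist (x.1 n) (y.1 n) ≤ r * d n) : dist x y ≤ r := by
  refine le_of_tendsto (tendsto_dist x y) ?_
  filter_upwards [h, hd.eventually_gt_atTop 0] with n h1 h2
  rwa [div_le_iff₀ h2]

theorem eventually_of_dist_lt {x y : ConeSequence X ω e d hd} {r : ℝ} (h : dist x y < r) :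
    ∀ᶠ n in (ω : Filter ℕ), dist (x.1 n) (y.1 n) ≤ r * d n := by
  filter_upwards [(tendsto_dist x y).eventually (gt_mem_nhds h), hd.eventually_gt_atTop 0]
    with n h1 h2
  rw [← div_le_iff₀ h2]
  exact h1.le

theorem mk_eq_mk {x y : ConeSequence X ω e d hd} :
    SeparationQuotient.mk x = SeparationQuotient.mk y ↔ dist x y = 0 := by
  rw [← SeparationQuotient.dist_mk, dist_eq_zero]

theorem mk_eq_mk_of_eventuallyEq {x y : ConeSequence X ω e d hd}
    (h : ∀ᶠ n in (ω : Filter ℕ), x.1 n = y.1 n) :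
    SeparationQuotient.mk x = SeparationQuotient.mk y := by
  rw [mk_eq_mk]
  refine le_antisymm (dist_le_of_eventually ?_) dist_nonneg
  filter_upwards [h] with n hn
  simp [hn]

/-- Sequences that stay within rescaled bounded distance of a cone sequence are cone sequences. -/
def ofDistLE (x : ConeSequence X ω e d hd) (y : ℕ → X) {M : ℝ}
    (h : ∀ᶠ n in (ω : Filter ℕ), dist (y n) (x.1 n) ≤ M * d n) : ConeSequence X ω e d hd :=
  ⟨y, by
    obtain ⟨N, hN⟩ := x.2
    refine ⟨M + N, ?_⟩
    filter_upwards [h, hN, hd.eventually_gt_atTop 0] with n h1 h2 h3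
    calc dist (y n) (e n) / d n ≤ (dist (y n) (x.1 n) + dist (x.1 n) (e n)) / d n := by
          gcongr; exact dist_triangle _ _ _
      _ ≤ M + N := by
          rw [add_div]
          exact add_le_add ((div_le_iff₀ h3).2 h1) h2⟩

/-- The base point. -/
def base : ConeSequence X ω e d hd := ⟨e, 0, by simp⟩

instance : Nonempty (ConeSequence X ω e d hd) := ⟨base⟩

end ConeSequence

/-- Asymptotic cones are complete: a fast Cauchy sequence of cone sequences is majorized by a
diagonal sequence. -/
instance AsymptoticCone.completeSpace {X : Type*} [PseudoMetricSpace X] {ω : Ultrafilter ℕ}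
    {e : ℕ → X} {d : ℕ → ℝ} {hd : Tendsto d ω atTop} :
    CompleteSpace (AsymptoticCone X ω e d hd) := by
  classical
  have hB : ∀ n : ℕ, (0 : ℝ) < (1 / 2) ^ n := fun n => by positivity
  refine Metric.complete_of_convergent_controlled_sequences (fun n => (1 / 2 : ℝ) ^ n) hB
    fun u hu => ?_
  choose x hx using fun j => SeparationQuotient.surjective_mk (u j)
  have hxd : ∀ i j, i ≤ j → ∀ᶠ n in (ω : Filter ℕ),
      dist ((x i).1 n) ((x j).1 n) ≤ (1 / 2) ^ i * d n := by
    intro i j hij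
    refine ConeSequence.eventually_of_dist_lt ?_
    rw [← SeparationQuotient.dist_mk, hx, hx]
    exact hu i i j le_rfl hij
  -- the indices at which the first `j` sequences are controlled
  set U : ℕ → ℕ → Prop := fun n j => (j : ℝ) ≤ d n ∧
    ∀ i ∈ Finset.range (j + 1), dist ((x i).1 n) ((x j).1 n) ≤ (1 / 2) ^ i * d n with hU
  have hUj : ∀ j, ∀ᶠ n in (ω : Filter ℕ), U n j := by
    intro j
    refine (hd.eventually_ge_atTop (j : ℝ)).and ?_
    rw [Filter.eventually_all_finset]
    exact fun i hi => hxd i j (Nat.lt_succ_iff.1 (Finset.mem_range.1 hi))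
  set J : ℕ → ℕ := fun n => Nat.findGreatest (U n) ⌊d n⌋₊ with hJ
  have hJj : ∀ j n, U n j → j ≤ J n ∧ U n (J n) := by
    intro j n h
    have hj : j ≤ ⌊d n⌋₊ := Nat.le_floor h.1
    exact ⟨Nat.le_findGreatest hj h, Nat.findGreatest_spec hj h⟩
  have hy : ∀ j, ∀ᶠ n in (ω : Filter ℕ),
      dist ((x (J n)).1 n) ((x j).1 n) ≤ (1 / 2) ^ j * d n := by
    intro j
    filter_upwards [hUj j] with n hn
    obtain ⟨h1, h2⟩ := hJj j n hn
    rw [dist_comm]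
    exact h2.2 j (Finset.mem_range.2 (Nat.lt_succ_iff.2 h1))
  set y : ConeSequence X ω e d hd := (x 0).ofDistLE (fun n => (x (J n)).1 n) (hy 0)
  refine ⟨SeparationQuotient.mk y, ?_⟩
  rw [tendsto_iff_dist_tendsto_zero]
  refine squeeze_zero (fun _ => dist_nonneg) (fun j => ?_)
    (tendsto_pow_atTop_nhds_zero_of_lt_one (by norm_num : (0 : ℝ) ≤ 1 / 2) (by norm_num))
  rw [← hx j, SeparationQuotient.dist_mk, dist_comm]
  exact ConeSequence.dist_le_of_eventually (hy j)

/-! ### The combing of an asymptotic cone -/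

section Combing

variable {X : Type*} [PseudoMetricSpace X] {ω : Ultrafilter ℕ} {e : ℕ → X} {d : ℕ → ℝ}
  {hd : Tendsto d ω atTop} {κ : ℝ} {c : X → X → ℝ → X}

/-- The limit of the paths between the terms of two cone sequences. The parameter is projected to
the unit interval. -/
noncomputable def conePath (hc : IsCombing κ c) (x y : ConeSequence X ω e d hd) (s : ℝ) :
    AsymptoticCone X ω e d hd :=
  SeparationQuotient.mk <| x.ofDistLE (M := |(Set.projIcc 0 1 zero_le_one s : ℝ) - 0| *
      (dist x y + 1) + 1) (fun n => c (x.1 n) (y.1 n) (Set.projIcc 0 1 zero_le_one s)) <| by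
    filter_upwards [ConeSequence.eventually_of_dist_lt (lt_add_one (dist x y)),
      hd.eventually_ge_atTop κ] with n h1 h2
    have h := hc.dist_le (x.1 n) (y.1 n) _ (Set.projIcc 0 1 zero_le_one s).2 0 (by simp)
    rw [hc.zero] at h
    rw [add_mul, one_mul, mul_assoc]
    exact h.trans (add_le_add (by gcongr) h2)

theorem conePath_of_mem (hc : IsCombing κ c) (x y : ConeSequence X ω e d hd) {s : ℝ}
    (hs : s ∈ Set.Icc (0 : ℝ) 1) : ∃ z : ConeSequence X ω e d hd,
      conePath hc x y s = SeparationQuotient.mk z ∧ ∀ n, z.1 n = c (x.1 n) (y.1 n) s := by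
  refine ⟨_, rfl, fun n => ?_⟩
  change c _ _ (Set.projIcc 0 1 zero_le_one s : ℝ) = _
  rw [Set.projIcc_of_mem _ hs]

theorem conePath_zero (hc : IsCombing κ c) (x y : ConeSequence X ω e d hd) :
    conePath hc x y 0 = SeparationQuotient.mk x := by
  obtain ⟨z, hz, h⟩ := conePath_of_mem hc x y (s := 0) (by simp)
  rw [hz]
  exact ConeSequence.mk_eq_mk_of_eventuallyEq (Eventually.of_forall fun n => by rw [h, hc.zero])

theorem conePath_one (hc : IsCombing κ c) (x y : ConeSequence X ω e d hd) :
    conePath hc x y 1 = SeparationQuotient.mk y := by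
  obtain ⟨z, hz, h⟩ := conePath_of_mem hc x y (s := 1) (by simp)
  rw [hz]
  exact ConeSequence.mk_eq_mk_of_eventuallyEq (Eventually.of_forall fun n => by rw [h, hc.one])

theorem dist_conePath_le (hc : IsCombing κ c) (x y : ConeSequence X ω e d hd) {s t : ℝ}
    (hs : s ∈ Set.Icc (0 : ℝ) 1) (ht : t ∈ Set.Icc (0 : ℝ) 1) :
    dist (conePath hc x y s) (conePath hc x y t) ≤ |s - t| * dist x y := by
  obtain ⟨z, hz, hzn⟩ := conePath_of_mem hc x y hs
  obtain ⟨w, hw, hwn⟩ := conePath_of_mem hc x y ht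
  rw [hz, hw, SeparationQuotient.dist_mk]
  have hlim : Tendsto (fun n => |s - t| * (dist (x.1 n) (y.1 n) / d n) + κ / d n) ω
      (𝓝 (|s - t| * dist x y)) := by
    simpa using ((ConeSequence.tendsto_dist x y).const_mul |s - t|).add
      (tendsto_const_nhds.div_atTop hd)
  refine le_of_tendsto_of_tendsto (ConeSequence.tendsto_dist z w) hlim ?_
  · filter_upwards [hd.eventually_gt_atTop 0] with n hn
    rw [hzn, hwn, mul_div_assoc', ← add_div]
    gcongr
    exact hc.dist_le _ _ s hs t ht

theorem continuousOn_conePath (hc : IsCombing κ c) (x y : ConeSequence X ω e d hd) :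
    ContinuousOn (conePath hc x y) (Set.Icc 0 1) := by
  refine (LipschitzOnWith.of_dist_le_mul (K := ⟨dist x y, dist_nonneg⟩)
    fun s hs t ht => ?_).continuousOn
  rw [mul_comm]
  exact dist_conePath_le hc x y hs ht

/-- A cone sequence that represents the given point of the cone. -/
noncomputable def AsymptoticCone.rep (p : AsymptoticCone X ω e d hd) : ConeSequence X ω e d hd :=
  (SeparationQuotient.surjective_mk p).choose

open AsymptoticCone

theorem AsymptoticCone.mk_rep (p : AsymptoticCone X ω e d hd) :
    SeparationQuotient.mk (rep p) = p :=
  (SeparationQuotient.surjective_mk p).choose_spec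

theorem AsymptoticCone.dist_rep (p q : AsymptoticCone X ω e d hd) :
    dist (rep p) (rep q) = dist p q := by
  rw [← SeparationQuotient.dist_mk, mk_rep, mk_rep]

/-- The combing of an asymptotic cone by limits of paths. -/
noncomputable def coneComb (hc : IsCombing κ c) (p q : AsymptoticCone X ω e d hd) (s : ℝ) :
    AsymptoticCone X ω e d hd :=
  conePath hc (rep p)
    (rep q) s

theorem isCombing_coneComb (hc : IsCombing κ c) :
    IsCombing 0 (coneComb hc : AsymptoticCone X ω e d hd → _) where
  zero p q := by
    rw [coneComb, conePath_zero, mk_rep]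
  one p q := by
    rw [coneComb, conePath_one, mk_rep]
  dist_le p q s hs t ht := by
    have := dist_conePath_le hc (rep p)
      (rep q) hs ht
    rw [dist_rep] at this
    rw [add_zero]
    exact this

theorem pathConnectedSpace_cone (hc : IsCombing κ c) :
    PathConnectedSpace (AsymptoticCone X ω e d hd) where
  nonempty := inferInstance
  joined p q := by
    have h := isCombing_coneComb (ω := ω) (e := e) (d := d) (hd := hd) hc
    refine ⟨⟨⟨fun s => coneComb hc p q s, ?_⟩, by simp [h.zero], by simp [h.one]⟩⟩
    exact (continuousOn_conePath hc _ _).comp_continuous (by fun_prop) fun s => s.2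

/-- A division of the quadrilaterals in a space yields one in its asymptotic cones. -/
theorem LoopDivision.coneComb {n : ℕ} {R : ℝ} (hc : IsCombing κ c)
    (h : LoopDivision c n (1 / 4) R) :
    LoopDivision (coneComb hc : AsymptoticCone X ω e d hd → _) n (1 / 2) 0 := by
  classical
  have hcc := isCombing_coneComb (ω := ω) (e := e) (d := d) (hd := hd) hc
  intro r hr a b p q hab hpq hap hbq
  have hI : ∀ {i : ℕ}, i ≤ n → (i : ℝ) / n ∈ Set.Icc (0 : ℝ) 1 := fun {i} hi =>
    ⟨by positivity, div_le_one_of_le₀ (by exact_mod_cast hi) (by positivity)⟩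
  rcases hr.eq_or_lt with rfl | hr
  · obtain rfl : a = b := dist_le_zero.1 hab
    obtain rfl : a = p := dist_le_zero.1 hap
    obtain rfl : a = q := dist_le_zero.1 hpq
    have hconst : ∀ i ≤ n, a = _root_.coneComb hc a a (i / n) := by
      intro i hi
      have := hcc.dist_le a a 0 (by simp) _ (hI hi)
      rw [hcc.zero, dist_self, mul_zero, add_zero] at this
      exact dist_le_zero.1 this
    exact ⟨fun _ _ => a, hconst, hconst, hconst, hconst, by simp, by simp⟩
  set a' := rep a with ha'
  set b' := rep b with hb'
  set p' := rep p with hp'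
  set q' := rep q with hq'
  have hlt : ∀ u v : AsymptoticCone X ω e d hd, dist u v ≤ r →
      ∀ᶠ m in (ω : Filter ℕ), dist ((rep u).1 m)
        ((rep v).1 m) ≤ 2 * r * d m := by
    intro u v huv
    refine ConeSequence.eventually_of_dist_lt ?_
    rw [dist_rep]
    linarith
  have hgrid : ∀ᶠ m in (ω : Filter ℕ), ∃ g, IsGridFilling c n (1 / 4 * (2 * r * d m))
      (a'.1 m) (b'.1 m) (p'.1 m) (q'.1 m) g := by
    filter_upwards [hlt a b hab, hlt p q hpq, hlt a p hap, hlt b q hbq,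
      hd.eventually_ge_atTop (R / (2 * r))] with m h1 h2 h3 h4 h5
    refine h _ ?_ _ _ _ _ h1 h2 h3 h4
    rwa [div_le_iff₀ (by positivity), mul_comm] at h5
  obtain ⟨G, hG⟩ := hgrid.choice
  have hbound : ∀ i ≤ n, ∀ j ≤ n, ∀ᶠ m in (ω : Filter ℕ),
      dist (G m i j) (a'.1 m) ≤ (i + j) * (r / 2) * d m := by
    intro i hi j hj
    filter_upwards [hG] with m hm
    have := hm.dist_corner_le hi hj
    rw [hm.bottom 0 (Nat.zero_le _), Nat.cast_zero, zero_div, hc.zero] at this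
    linarith
  let y : ℕ → ℕ → ConeSequence X ω e d hd := fun i j =>
    if hij : i ≤ n ∧ j ≤ n then a'.ofDistLE (fun m => G m i j) (hbound i hij.1 j hij.2) else a'
  have hy : ∀ i ≤ n, ∀ j ≤ n, ∀ m, (y i j).1 m = G m i j := by
    intro i hi j hj m
    simp only [y, dif_pos (And.intro hi hj)]
    rfl
  have hside : ∀ (u v : AsymptoticCone X ω e d hd) (i : ℕ) (hi : i ≤ n)
      (w : ConeSequence X ω e d hd), (∀ᶠ m in (ω : Filter ℕ),
        w.1 m = c ((rep u).1 m)
          ((rep v).1 m) (i / n)) →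
      SeparationQuotient.mk w = _root_.coneComb hc u v (i / n) := by
    intro u v i hi w hw
    obtain ⟨z, hz, hzn⟩ := conePath_of_mem hc (rep u)
      (rep v) (hI hi)
    rw [_root_.coneComb, hz]
    refine ConeSequence.mk_eq_mk_of_eventuallyEq ?_
    filter_upwards [hw] with m hm
    rw [hm, hzn]
  refine ⟨fun i j => SeparationQuotient.mk (y i j), ?_, ?_, ?_, ?_, ?_, ?_⟩
  · intro i hi
    refine hside a b i hi _ ?_
    filter_upwards [hG] with m hm
    rw [hy i hi 0 (Nat.zero_le _), hm.bottom i hi]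
  · intro i hi
    refine hside p q i hi _ ?_
    filter_upwards [hG] with m hm
    rw [hy i hi n le_rfl, hm.top i hi]
  · intro i hi
    refine hside a p i hi _ ?_
    filter_upwards [hG] with m hm
    rw [hy 0 (Nat.zero_le _) i hi, hm.left i hi]
  · intro i hi
    refine hside b q i hi _ ?_
    filter_upwards [hG] with m hm
    rw [hy n le_rfl i hi, hm.right i hi]
  · intro i hi j hj
    rw [SeparationQuotient.dist_mk]
    refine ConeSequence.dist_le_of_eventually ?_
    filter_upwards [hG] with m hm
    rw [hy i hi.le j hj, hy (i + 1) hi j hj]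
    linarith [hm.horiz i hi j hj]
  · intro i hi j hj
    rw [SeparationQuotient.dist_mk]
    refine ConeSequence.dist_le_of_eventually ?_
    filter_upwards [hG] with m hm
    rw [hy i hi j hj.le, hy i hi (j + 1) hj]
    linarith [hm.vert i hi j hj]

/-- If a space has a division of its quadrilaterals then its asymptotic cones have the extension
property. -/
theorem LoopDivision.exists_uniformExtension {n : ℕ} (hn : 4 ≤ n) {R : ℝ} (hc : IsCombing κ c)
    (h : LoopDivision c n (1 / 4) R) :
    ∃ C, UniformExtension (AsymptoticCone X ω e d hd) C :=
  exists_extension hn (isCombing_coneComb hc) (h.coneComb hc)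

end Combing

/-! ### From fillings in all asymptotic cones to a uniform division -/

/-- Maps on the boundary of the square extend to the square, with continuity up to any error. -/
def AlmostFillable (Z : Type*) [PseudoMetricSpace Z] : Prop :=
  ∀ ε > 0, ∀ b : ℝ × ℝ → Z, ContinuousOn b sqBoundary →
    ∃ g : ℝ × ℝ → Z, EpsContOn ε g unitSq ∧ Set.EqOn g b sqBoundary

theorem almostFillable_of_simplyConnected {Z : Type*} [PseudoMetricSpace Z]
    [SimplyConnectedSpace Z] : AlmostFillable Z := by
  intro ε hε b hb
  obtain ⟨g, hg, hgb⟩ := exists_continuousOn_unitSq_of_simplyConnected hb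
  exact ⟨g, hg.epsContOn hε, hgb⟩

theorem EpsContOn.exists_uniform {α Z : Type*} [PseudoMetricSpace α] [PseudoMetricSpace Z]
    {ε : ℝ} {g : α → Z} {S : Set α} (hS : IsCompact S) (h : EpsContOn ε g S) :
    ∃ δ > 0, ∀ p ∈ S, ∀ q ∈ S, dist p q < δ → dist (g p) (g q) ≤ 2 * ε := by
  have h' : ∀ p : S, ∃ U : Set α, IsOpen U ∧ (p : α) ∈ U ∧
      ∀ q ∈ U, q ∈ S → dist (g q) (g p) ≤ ε := by
    intro p
    obtain ⟨U, hU, hpU, hUS⟩ := mem_nhdsWithin.1 (h p p.2)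
    exact ⟨U, hU, hpU, fun q hq hqS => hUS ⟨hq, hqS⟩⟩
  choose U hU hpU hUS using h'
  obtain ⟨δ, hδ, hball⟩ := lebesgue_number_lemma_of_metric hS hU
    fun p hp => Set.mem_iUnion.2 ⟨⟨p, hp⟩, hpU ⟨p, hp⟩⟩
  refine ⟨δ, hδ, fun p hp q hq hpq => ?_⟩
  obtain ⟨z, hz⟩ := hball p hp
  have h1 := hUS z p (hz (Metric.mem_ball_self hδ)) hp
  have h2 := hUS z q (hz (by rwa [Metric.mem_ball, dist_comm])) hq
  linarith [dist_triangle_right (g p) (g q) (g z)]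

/-- Rounding the position `I / n` down to a multiple of `1 / N` moves it by at most `1 / N`. -/
theorem abs_div_sub_floor_le {N n : ℕ} (hN : 0 < N) (hn : 0 < n) (I : ℕ) :
    |(I : ℝ) / n - ((I * N / n : ℕ) : ℝ) / N| ≤ 1 / N := by
  have hN' : (0 : ℝ) < N := by positivity
  have hn' : (0 : ℝ) < n := by positivity
  have h1 : ((I * N / n : ℕ) : ℝ) ≤ I * N / n := by
    have := @Nat.cast_div_le ℝ _ _ _ (I * N) n
    push_cast at this
    exact this
  have h2 : (I * N / n : ℝ) < (I * N / n : ℕ) + 1 := by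
    rw [div_lt_iff₀ hn']
    have h := Nat.lt_div_mul_add (a := I * N) hn
    have h' : ((I * N : ℕ) : ℝ) < (I * N / n * n + n : ℕ) := Nat.cast_lt.2 h
    push_cast at h' ⊢
    linarith
  have h3 : (I : ℝ) / n - ((I * N / n : ℕ) : ℝ) / N = (I * N / n - (I * N / n : ℕ)) / N := by
    field_simp
  rw [h3, abs_of_nonneg (div_nonneg (by linarith) hN'.le)]
  gcongr
  linarith

/-- **Uniform division.** If maps on the boundary of the square are almost fillable in all
asymptotic cones of `X`, then the large quadrilaterals of `X` have a uniform division: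
counterexamples for finer and finer grids would have a limit in some asymptotic cone. -/
theorem exists_loopDivision {X : Type*} [PseudoMetricSpace X] {κ : ℝ} {c : X → X → ℝ → X}
    (hc : IsCombing κ c)
    (hfill : ∀ (ω : Ultrafilter ℕ) (e : ℕ → X) (d : ℕ → ℝ) (hd : Tendsto d ω atTop),
      AlmostFillable (AsymptoticCone X ω e d hd)) (N₀ : ℕ) :
    ∃ n ≥ N₀, ∃ R > 0, LoopDivision c n (1 / 4) R := by
  classical
  by_contra! hcon
  have hcon' : ∀ k : ℕ, ∃ (r : ℝ) (a b p q : X), (k + 1 : ℝ) ≤ r ∧ dist a b ≤ r ∧ dist p q ≤ r ∧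
      dist a p ≤ r ∧ dist b q ≤ r ∧ ∀ g, ¬ IsGridFilling c (N₀ + k) (1 / 4 * r) a b p q g := by
    intro k
    have := hcon (N₀ + k) (by omega) (k + 1) (by positivity)
    unfold LoopDivision at this
    push Not at this
    obtain ⟨r, hr, a, b, p, q, h1, h2, h3, h4, h5⟩ := this
    exact ⟨r, a, b, p, q, hr, h1, h2, h3, h4, h5⟩
  choose r a b p q hr hab hpq hap hbq hno using hcon'
  have hω : ((hyperfilter ℕ : Ultrafilter ℕ) : Filter ℕ) ≤ atTop := Nat.hyperfilter_le_atTop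
  have hd : Tendsto r (hyperfilter ℕ : Ultrafilter ℕ) atTop := by
    refine Tendsto.mono_left ?_ hω
    refine tendsto_atTop_mono (f := fun k : ℕ => (k : ℝ)) (fun k => ?_)
      tendsto_natCast_atTop_atTop
    linarith [hr k]
  set ω : Ultrafilter ℕ := hyperfilter ℕ
  have hr0 : ∀ k, 0 < r k := fun k => by
    have := hr k
    have : (0 : ℝ) ≤ k := by positivity
    linarith [hr k]
  -- the corners, and the sides, of the limit quadrilateral
  let A : ConeSequence X ω a r hd := ConeSequence.base
  let B : ConeSequence X ω a r hd := A.ofDistLE (M := 1) b (Eventually.of_forall fun k => by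
    rw [one_mul, dist_comm]; exact hab k)
  let P : ConeSequence X ω a r hd := A.ofDistLE (M := 1) p (Eventually.of_forall fun k => by
    rw [one_mul, dist_comm]; exact hap k)
  let Q : ConeSequence X ω a r hd := B.ofDistLE (M := 1) q (Eventually.of_forall fun k => by
    rw [one_mul, dist_comm]; exact hbq k)
  have hl0 : conePath hc A P 0 = conePath hc A B 0 := by rw [conePath_zero, conePath_zero]
  have hl1 : conePath hc A P 1 = conePath hc P Q 0 := by rw [conePath_one, conePath_zero]
  have hr0' : conePath hc B Q 0 = conePath hc A B 1 := by rw [conePath_one, conePath_zero]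
  have hr1' : conePath hc B Q 1 = conePath hc P Q 1 := by rw [conePath_one, conePath_one]
  -- the edges of the contradicting grid will have length at most `9 * ε * r k = r k / 4`
  obtain ⟨ε, hε⟩ : ∃ ε : ℝ, ε = 1 / 36 := ⟨_, rfl⟩
  obtain ⟨g, hg, hgb⟩ := hfill ω a r hd ε (by norm_num [hε]) _ (continuousOn_sides
    (continuousOn_conePath hc A B) (continuousOn_conePath hc P Q) (continuousOn_conePath hc A P)
    (continuousOn_conePath hc B Q) hl0 hl1 hr0' hr1')
  obtain ⟨δ, hδ, hδg⟩ := hg.exists_uniform isCompact_unitSq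
  obtain ⟨N, hN36, hNδ⟩ : ∃ N : ℕ, 36 ≤ N ∧ 1 / (N : ℝ) < δ := by
    obtain ⟨N, hN⟩ := exists_nat_one_div_lt hδ
    refine ⟨N + 36, by omega, lt_of_le_of_lt ?_ hN⟩
    push_cast
    gcongr
    linarith
  have hN0 : 0 < N := by omega
  have hN' : (36 : ℝ) ≤ N := by exact_mod_cast hN36
  have hNε : 1 / (N : ℝ) ≤ ε := by rw [hε]; gcongr
  have hI : ∀ {i : ℕ}, i ≤ N → (i : ℝ) / N ∈ Set.Icc (0 : ℝ) 1 := fun {i} hi =>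
    ⟨by positivity, div_le_one_of_le₀ (by exact_mod_cast hi) (by positivity)⟩
  have h0I : (0 : ℝ) ∈ Set.Icc (0 : ℝ) 1 := by simp
  have h1I : (1 : ℝ) ∈ Set.Icc (0 : ℝ) 1 := by simp
  choose y hy using fun i j : ℕ => SeparationQuotient.surjective_mk (g ((i : ℝ) / N, (j : ℝ) / N))
  -- neighbouring points of the coarse grid
  have hstep : ∀ i j i' j' : ℕ, i ≤ N → j ≤ N → i' ≤ N → j' ≤ N →
      dist ((i : ℝ) / N) (i' / N) ≤ 1 / N → dist ((j : ℝ) / N) (j' / N) ≤ 1 / N →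
      ∀ᶠ k in (ω : Filter ℕ), dist ((y i j).1 k) ((y i' j').1 k) ≤ 3 * ε * r k := by
    intro i j i' j' hi hj hi' hj' h1 h2
    refine ConeSequence.eventually_of_dist_lt ?_
    rw [← SeparationQuotient.dist_mk, hy, hy]
    have := hδg (i / N, j / N) ⟨hI hi, hI hj⟩ (i' / N, j' / N) ⟨hI hi', hI hj'⟩
      ((max_le h1 h2).trans_lt hNδ)
    have hε0 : 0 < ε := by norm_num [hε]
    linarith
  have hadj : ∀ i : ℕ, dist ((i : ℝ) / N) ((i + 1 : ℕ) / N) ≤ 1 / N := by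
    intro i
    rw [Real.dist_eq, show (i : ℝ) / N - (i + 1 : ℕ) / N = -(1 / N) by push_cast; ring, abs_neg,
      abs_of_nonneg (by positivity)]
  have hsame : ∀ i : ℕ, dist ((i : ℝ) / N) (i / N) ≤ 1 / N := by
    intro i
    rw [dist_self]; positivity
  have hH : ∀ᶠ k in (ω : Filter ℕ), ∀ i ∈ Set.Iio N, ∀ j ∈ Set.Iic N,
      dist ((y i j).1 k) ((y (i + 1) j).1 k) ≤ 3 * ε * r k := by
    rw [Filter.eventually_all_finite (Set.finite_Iio N)]
    intro i hi
    rw [Filter.eventually_all_finite (Set.finite_Iic N)]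
    exact fun j hj => hstep _ _ _ _ (le_of_lt hi) hj hi hj (hadj i) (hsame j)
  have hV : ∀ᶠ k in (ω : Filter ℕ), ∀ i ∈ Set.Iic N, ∀ j ∈ Set.Iio N,
      dist ((y i j).1 k) ((y i (j + 1)).1 k) ≤ 3 * ε * r k := by
    rw [Filter.eventually_all_finite (Set.finite_Iic N)]
    intro i hi
    rw [Filter.eventually_all_finite (Set.finite_Iio N)]
    exact fun j hj => hstep _ _ _ _ hi (le_of_lt hj) hi hj (hsame i) (hadj j)
  -- the sides of the quadrilateral
  have hside : ∀ (U V : ConeSequence X ω a r hd) (z : ℕ → ConeSequence X ω a r hd),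
      (∀ i ≤ N, SeparationQuotient.mk (z i) = conePath hc U V (i / N)) →
      ∀ᶠ k in (ω : Filter ℕ), ∀ i ∈ Set.Iic N,
        dist ((z i).1 k) (c (U.1 k) (V.1 k) (i / N)) ≤ ε * r k := by
    intro U V z hz
    rw [Filter.eventually_all_finite (Set.finite_Iic N)]
    intro i hi
    obtain ⟨w, hw, hwn⟩ := conePath_of_mem hc U V (hI hi)
    have h0 : dist (z i) w < ε := by
      rw [ConeSequence.mk_eq_mk.1 ((hz i hi).trans hw)]
      norm_num [hε]
    filter_upwards [ConeSequence.eventually_of_dist_lt h0] with k hk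
    rwa [hwn] at hk
  have hNN : (N : ℝ) / N = 1 := div_self (by linarith)
  have hbot := hside A B (fun i => y i 0) fun i hi => by
    rw [hy, hgb ⟨⟨hI hi, by simp⟩, by simp⟩, Nat.cast_zero, zero_div, sides_bottom]
  have htop := hside P Q (fun i => y i N) fun i hi => by
    rw [hy, hNN, hgb ⟨⟨hI hi, h1I⟩, by simp⟩, sides_top]
  have hleft := hside A P (fun j => y 0 j) fun i hi => by
    rw [hy, Nat.cast_zero, zero_div, hgb ⟨⟨h0I, hI hi⟩, by simp⟩, sides_left hl0 hl1]
  have hright := hside B Q (fun j => y N j) fun i hi => by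
    rw [hy, hNN, hgb ⟨⟨h1I, hI hi⟩, by simp⟩, sides_right hr0' hr1']
  obtain ⟨k, hHk, hVk, hbot, htop, hleft, hright, hkN, hκ⟩ := (hH.and (hV.and (hbot.and (htop.and
    (hleft.and (hright.and (((eventually_ge_atTop N).filter_mono hω).and
      (hd.eventually_ge_atTop (κ / ε))))))))).exists
  rw [div_le_iff₀ (by norm_num [hε])] at hκ
  -- the contradicting grid: the sides are given by the combing, and an inner vertex is mapped like
  -- the vertex of the coarse `N × N` grid below it
  obtain ⟨n, hn⟩ : ∃ n : ℕ, n = N₀ + k := ⟨_, rfl⟩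
  have hn0 : 0 < n := by omega
  have hn' : (n : ℝ) / n = 1 := div_self (by positivity)
  have hrk := hr0 k
  have hno' := hno k
  set G : ℕ → ℕ → X := fun I J => if J = 0 then c (a k) (b k) (I / n) else
    if J = n then c (p k) (q k) (I / n) else if I = 0 then c (a k) (p k) (J / n) else
    if I = n then c (b k) (q k) (J / n) else (y (I * N / n) (J * N / n)).1 k with hG
  have hIn : ∀ {i : ℕ}, i ≤ n → (i : ℝ) / n ∈ Set.Icc (0 : ℝ) 1 := fun {i} hi =>
    ⟨by positivity, div_le_one_of_le₀ (by exact_mod_cast hi) (by positivity)⟩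
  have hfl : ∀ {I : ℕ}, I ≤ n → I * N / n ≤ N := fun {I} hi =>
    Nat.div_le_of_le_mul (Nat.mul_le_mul_right _ hi)
  have hsideclose : ∀ (u v : X) (z : ℕ → X), dist u v ≤ r k →
      (∀ i ∈ Set.Iic N, dist (z i) (c u v (i / N)) ≤ ε * r k) → ∀ I ≤ n,
      dist (c u v (I / n)) (z (I * N / n)) ≤ 3 * ε * r k := by
    intro u v z huv hz I hIle
    have h1 := hc.dist_le u v _ (hIn hIle) _ (hI (hfl hIle))
    have h2 := abs_div_sub_floor_le hN0 hn0 I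
    have h3 := hz _ (hfl hIle)
    have h4 : |(I : ℝ) / n - ((I * N / n : ℕ) : ℝ) / N| * dist u v ≤ ε * r k :=
      mul_le_mul (h2.trans hNε) huv dist_nonneg (by norm_num [hε])
    have h5 := dist_triangle_right (c u v (I / n)) (z (I * N / n))
      (c u v ((I * N / n : ℕ) / N))
    linarith
  have hclose : ∀ I ≤ n, ∀ J ≤ n, dist (G I J) ((y (I * N / n) (J * N / n)).1 k) ≤
      3 * ε * r k := by
    intro I hIle J hJle
    have hnN : n * N / n = N := Nat.mul_div_cancel_left _ hn0
    simp only [hG]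
    split_ifs with h1 h2 h3 h4
    · rw [h1, zero_mul, Nat.zero_div]
      exact hsideclose (a k) (b k) (fun i => (y i 0).1 k) (hab k) hbot I hIle
    · rw [h2, hnN]
      exact hsideclose (p k) (q k) (fun i => (y i N).1 k) (hpq k) htop I hIle
    · rw [h3, zero_mul, Nat.zero_div]
      exact hsideclose (a k) (p k) (fun i => (y 0 i).1 k) (hap k) hleft J hJle
    · rw [h4, hnN]
      exact hsideclose (b k) (q k) (fun i => (y N i).1 k) (hbq k) hright J hJle
    · rw [dist_self]
      have : 0 < ε := by norm_num [hε]
      positivity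
  have hflstep : ∀ I < n, (I + 1) * N / n = I * N / n ∨
      (I * N / n < N ∧ (I + 1) * N / n = I * N / n + 1) := by
    intro I hlt
    have h1 : I * N / n ≤ (I + 1) * N / n := Nat.div_le_div_right (by gcongr; omega)
    have h2 : (I + 1) * N / n ≤ I * N / n + 1 := by
      rw [← Nat.add_div_right _ hn0]
      refine Nat.div_le_div_right ?_
      rw [add_mul, one_mul]
      omega
    have h3 := hfl (Nat.succ_le_of_lt hlt)
    simp only [Nat.succ_eq_add_one] at h3
    omega
  have hε0 : 0 < ε := by norm_num [hε]
  have h9 : 1 / 4 * r k = 9 * ε * r k := by rw [hε]; ring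
  rw [← hn] at hno'
  refine hno' G ⟨?_, ?_, ?_, ?_, ?_, ?_⟩
  · intro I hIle
    simp [hG]
  · intro I hIle
    simp [hG, hn0.ne']
  · intro J hJle
    simp only [hG]
    split_ifs with h1 h2
    · rw [h1]; simp [hc.zero]
    · rw [h2, hn']; simp [hc.zero, hc.one]
    · rfl
  · intro J hJle
    simp only [hG]
    split_ifs with h1 h2 h3
    · rw [h1, hn']; simp [hc.zero, hc.one]
    · rw [h2, hn']; simp [hc.one]
    · omega
    · rfl
  · intro I hlt J hJle
    have h1 := hclose I hlt.le J hJle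
    have h2 := hclose (I + 1) hlt J hJle
    have h3 : dist ((y (I * N / n) (J * N / n)).1 k) ((y ((I + 1) * N / n) (J * N / n)).1 k) ≤
        3 * ε * r k := by
      rcases hflstep I hlt with h | ⟨h, h'⟩
      · rw [h, dist_self]; positivity
      · rw [h']
        exact hHk _ h _ (hfl hJle)
    rw [dist_comm] at h2
    rw [h9]
    linarith [dist_triangle4 (G I J) ((y (I * N / n) (J * N / n)).1 k)
      ((y ((I + 1) * N / n) (J * N / n)).1 k) (G (I + 1) J)]
  · intro I hIle J hlt
    have h1 := hclose I hIle J hlt.le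
    have h2 := hclose I hIle (J + 1) hlt
    have h3 : dist ((y (I * N / n) (J * N / n)).1 k) ((y (I * N / n) ((J + 1) * N / n)).1 k) ≤
        3 * ε * r k := by
      rcases hflstep J hlt with h | ⟨h, h'⟩
      · rw [h, dist_self]; positivity
      · rw [h']
        exact hVk _ (hfl hIle) _ h
    rw [dist_comm] at h2
    rw [h9]
    linarith [dist_triangle4 (G I J) ((y (I * N / n) (J * N / n)).1 k)
      ((y (I * N / n) ((J + 1) * N / n)).1 k) (G I (J + 1))]

/-! ### Maps between asymptotic cones -/

section ConeMap

variable {X Y : Type*} [PseudoMetricSpace X] [PseudoMetricSpace Y] {ω : Ultrafilter ℕ} {e : ℕ → X}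
  {e' : ℕ → Y} {d : ℕ → ℝ} {hd : Tendsto d ω atTop} {φ : ℕ → Y → X} {L C M : ℝ}

/-- A uniformly coarsely Lipschitz sequence of maps that moves the observation sequence `e'` to
rescaled bounded distance from `e`. -/
structure IsConeMap (ω : Ultrafilter ℕ) (e' : ℕ → Y) (e : ℕ → X) (d : ℕ → ℝ) (φ : ℕ → Y → X)
    (L C M : ℝ) : Prop where
  nonneg : 0 ≤ L
  dist_le : ∀ n y z, dist (φ n y) (φ n z) ≤ L * dist y z + C
  base : ∀ᶠ n in (ω : Filter ℕ), dist (φ n (e' n)) (e n) ≤ M * d n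

/-- The image of a cone sequence under a sequence of maps. -/
noncomputable def ConeSequence.map (hφ : IsConeMap ω e' e d φ L C M)
    (y : ConeSequence Y ω e' d hd) :
    ConeSequence X ω e d hd :=
  (ConeSequence.base (hd := hd)).ofDistLE (M := L * (dist y ConeSequence.base + 1) + 1 + M)
      (fun n => φ n (y.1 n)) <| by
    filter_upwards [ConeSequence.eventually_of_dist_lt (lt_add_one (dist y ConeSequence.base)),
      hφ.base, hd.eventually_ge_atTop C] with n h1 h2 h3
    have h4 := hφ.dist_le n (y.1 n) (e' n)
    have h5 : L * dist (y.1 n) (e' n) ≤ L * ((dist y ConeSequence.base + 1) * d n) :=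
      mul_le_mul_of_nonneg_left h1 hφ.nonneg
    have h6 := dist_triangle (φ n (y.1 n)) (φ n (e' n)) (e n)
    change dist _ (e n) ≤ _
    linarith

theorem ConeSequence.dist_map_le (hφ : IsConeMap ω e' e d φ L C M)
    (y z : ConeSequence Y ω e' d hd) : dist (y.map hφ) (z.map hφ) ≤ L * dist y z := by
  have hlim : Tendsto (fun n => L * (dist (y.1 n) (z.1 n) / d n) + C / d n) ω
      (𝓝 (L * dist y z)) := by
    simpa using ((ConeSequence.tendsto_dist y z).const_mul L).add
      (tendsto_const_nhds.div_atTop hd)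
  refine le_of_tendsto_of_tendsto (ConeSequence.tendsto_dist _ _) hlim ?_
  filter_upwards [hd.eventually_gt_atTop 0] with n h
  rw [← mul_div_assoc, ← add_div]
  gcongr
  exact hφ.dist_le n _ _

theorem ConeSequence.le_dist_map (hφ : IsConeMap ω e' e d φ L C M) {L' C' : ℝ}
    (h : ∀ n y z, dist y z ≤ L' * dist (φ n y) (φ n z) + C')
    (y z : ConeSequence Y ω e' d hd) : dist y z ≤ L' * dist (y.map hφ) (z.map hφ) := by
  have hlim : Tendsto (fun n => L' * (dist ((y.map hφ).1 n) ((z.map hφ).1 n) / d n) + C' / d n) ω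
      (𝓝 (L' * dist (y.map hφ) (z.map hφ))) := by
    simpa using ((ConeSequence.tendsto_dist (y.map hφ) (z.map hφ)).const_mul L').add
      (tendsto_const_nhds.div_atTop hd)
  refine le_of_tendsto_of_tendsto (ConeSequence.tendsto_dist _ _) hlim ?_
  filter_upwards [hd.eventually_gt_atTop 0] with n hn
  rw [← mul_div_assoc, ← add_div]
  gcongr
  exact h n _ _

/-- The map of asymptotic cones induced by a sequence of maps. -/
noncomputable def coneMap (hφ : IsConeMap ω e' e d φ L C M) (p : AsymptoticCone Y ω e' d hd) :
    AsymptoticCone X ω e d hd :=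
  SeparationQuotient.mk ((AsymptoticCone.rep p).map hφ)

theorem dist_coneMap_le (hφ : IsConeMap ω e' e d φ L C M) (p q : AsymptoticCone Y ω e' d hd) :
    dist (coneMap hφ p) (coneMap hφ q) ≤ L * dist p q := by
  rw [coneMap, coneMap, SeparationQuotient.dist_mk, ← AsymptoticCone.dist_rep p q]
  exact ConeSequence.dist_map_le hφ _ _

theorem coneMap_mk (hφ : IsConeMap ω e' e d φ L C M) (y : ConeSequence Y ω e' d hd) :
    coneMap hφ (SeparationQuotient.mk y) = SeparationQuotient.mk (y.map hφ) := by
  rw [coneMap, ConeSequence.mk_eq_mk]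
  refine le_antisymm ((ConeSequence.dist_map_le hφ _ _).trans_eq ?_) dist_nonneg
  rw [ConeSequence.mk_eq_mk.1 (AsymptoticCone.mk_rep _), mul_zero]

theorem continuous_coneMap (hφ : IsConeMap ω e' e d φ L C M) :
    Continuous (coneMap hφ : AsymptoticCone Y ω e' d hd → AsymptoticCone X ω e d hd) :=
  (LipschitzWith.of_dist_le_mul (K := ⟨L, hφ.nonneg⟩) fun p q => dist_coneMap_le hφ p q).continuous

theorem le_dist_coneMap (hφ : IsConeMap ω e' e d φ L C M) {L' C' : ℝ}
    (h : ∀ n y z, dist y z ≤ L' * dist (φ n y) (φ n z) + C')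
    (p q : AsymptoticCone Y ω e' d hd) : dist p q ≤ L' * dist (coneMap hφ p) (coneMap hφ q) := by
  rw [coneMap, coneMap, SeparationQuotient.dist_mk, ← AsymptoticCone.dist_rep p q]
  exact ConeSequence.le_dist_map hφ h _ _

theorem isClosedEmbedding_coneMap (hφ : IsConeMap ω e' e d φ L C M) {L' C' : ℝ} (hL' : 0 ≤ L')
    (h : ∀ n y z, dist y z ≤ L' * dist (φ n y) (φ n z) + C') :
    IsClosedEmbedding
      (coneMap hφ : AsymptoticCone Y ω e' d hd → AsymptoticCone X ω e d hd) := by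
  have h1 : AntilipschitzWith ⟨L', hL'⟩
      (coneMap hφ : AsymptoticCone Y ω e' d hd → AsymptoticCone X ω e d hd) :=
    AntilipschitzWith.of_le_mul_dist fun p q => le_dist_coneMap hφ h p q
  exact h1.isClosedEmbedding (LipschitzWith.of_dist_le_mul (K := ⟨L, hφ.nonneg⟩)
    fun p q => dist_coneMap_le hφ p q).uniformContinuous

end ConeMap

/-! ### Separation by a closed set -/

/-- If points of `A` and `B` that are close to each other are close to the closed set `D`, then
`B ∪ D` is closed. -/
theorem isClosed_union_of_dist_le {X : Type*} [PseudoMetricSpace X] {A B D : Set X}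
    (hD : IsClosed D) (hcov : ∀ z, z ∈ A ∨ z ∈ B)
    (hsep : ∀ a ∈ A, ∀ b ∈ B, ∃ q ∈ D, dist a q ≤ 2 * dist a b) : IsClosed (B ∪ D) := by
  refine isClosed_of_closure_subset fun z hz => ?_
  rcases hcov z with hzA | hzB
  · refine Or.inr (hD.closure_subset (Metric.mem_closure_iff.2 fun ε hε => ?_))
    obtain ⟨b, hb, hzb⟩ := Metric.mem_closure_iff.1 hz (ε / 2) (by positivity)
    rcases hb with hb | hb
    · obtain ⟨q, hq, hzq⟩ := hsep z hzA b hb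
      exact ⟨q, hq, by linarith⟩
    · exact ⟨b, hb, by linarith⟩
  · exact Or.inl hzB

theorem inter_union_of_dist_le {X : Type*} [PseudoMetricSpace X] {A B D : Set X}
    (hD : IsClosed D)
    (hsep : ∀ a ∈ A, ∀ b ∈ B, ∃ q ∈ D, dist a q ≤ 2 * dist a b) :
    (A ∪ D) ∩ (B ∪ D) = D := by
  rw [← Set.inter_union_distrib_right]
  refine Set.union_eq_self_of_subset_left fun z hz => ?_
  refine hD.closure_subset (Metric.mem_closure_iff.2 fun ε hε => ?_)
  obtain ⟨q, hq, hzq⟩ := hsep z hz.1 z hz.2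
  rw [dist_self, mul_zero] at hzq
  exact ⟨q, hq, hzq.trans_lt hε⟩

/-! ### Coset limits and the two sides of a branch -/

/-- A subset `P` of the metric group `X` whose frontier consists of points close to the subgroup
`f Y`, such that both `P` and its complement contain arbitrarily deep points: the powers of `y` in
`P`, and the elements `y⁻ᵏ xᵐ yˡ` outside of it. The depth of a point is measured by a
function `ℓ` that is invariant under `f Y`. -/
structure IsBranch {X Y : Type*} [Group X] [PseudoMetricSpace X] [Group Y] (f : Y →* X) (P : Set X)
    (ℓ : X → ℕ) (Λ K : ℝ) (x y : X) : Prop where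
  isometry : ∀ g a b : X, dist (g * a) (g * b) = dist a b
  nonneg : 0 ≤ Λ
  crossing : ∀ g ∈ P, ∀ g' ∉ P, ∃ h, dist g (f h) ≤ dist g g' + K
  depth_map_mul : ∀ h g, ℓ (f h * g) = ℓ g
  depth_mul_le : ∀ w g, (ℓ (w * g) : ℝ) ≤ ℓ g + Λ * dist 1 w
  pow_mem : ∀ j, 1 ≤ j → y ^ j ∈ P ∧ j ≤ ℓ (y ^ j)
  notMem : ∀ k m l, 1 ≤ k → 1 ≤ m → 1 ≤ l →
    (y ^ k)⁻¹ * x ^ m * y ^ l ∉ P ∧ k ≤ ℓ ((y ^ k)⁻¹ * x ^ m * y ^ l)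

namespace IsBranch

variable {X Y : Type*} [Group X] [PseudoMetricSpace X] [Group Y] {f : Y →* X} {P : Set X}
  {ℓ : X → ℕ} {Λ K : ℝ} {x y : X}

theorem dist_one_mul_le (hP : IsBranch f P ℓ Λ K x y) (a b : X) :
    dist 1 (a * b) ≤ dist 1 a + dist 1 b := by
  have h := dist_triangle 1 a (a * b)
  have h' := hP.isometry a 1 b
  rw [mul_one] at h'
  linarith

theorem dist_one_pow_le (hP : IsBranch f P ℓ Λ K x y) (a : X) (m : ℕ) :
    dist 1 (a ^ m) ≤ m * dist 1 a := by
  induction m with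
  | zero => simp
  | succ m ih =>
    rw [pow_succ]
    push_cast
    linarith [hP.dist_one_mul_le (a ^ m) a]

theorem depth_le (hP : IsBranch f P ℓ Λ K x y) (p : X) (h : Y) :
    (ℓ p : ℝ) ≤ ℓ 1 + Λ * dist p (f h) := by
  have h1 := hP.depth_mul_le ((f h)⁻¹ * p) 1
  rw [mul_one, ← map_inv, hP.depth_map_mul] at h1
  have h2 := hP.isometry (f h) 1 (f h⁻¹ * p)
  rw [map_inv, mul_inv_cancel_left, mul_one] at h2
  rwa [map_inv, ← h2, dist_comm] at h1

/-- Points close to a deep point are on the same side of the branch. -/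
theorem mem_iff_of_deep (hP : IsBranch f P ℓ Λ K x y) {p v : X} {r : ℝ} (hpv : dist p v ≤ r)
    (hp : ℓ 1 + Λ * (2 * r + K) < ℓ p) : v ∈ P ↔ p ∈ P := by
  have key : ∀ h, ¬ dist p (f h) ≤ 2 * r + K := by
    intro h hle
    have h1 := hP.depth_le p h
    have h2 := mul_le_mul_of_nonneg_left hle hP.nonneg
    linarith
  have hr : 0 ≤ r := dist_nonneg.trans hpv
  constructor
  · intro hv
    by_contra hpP
    obtain ⟨h, hh⟩ := hP.crossing v hv p hpP
    refine key h ?_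
    rw [dist_comm v p] at hh
    linarith [dist_triangle p v (f h)]
  · intro hpP
    by_contra hv
    obtain ⟨h, hh⟩ := hP.crossing p hpP v hv
    exact key h (by linarith)

end IsBranch

section Sides

variable {X Y : Type*} [Group X] [PseudoMetricSpace X] [Group Y] [PseudoMetricSpace Y] {f : Y →* X}
  {P : Set X} {ℓ : X → ℕ} {Λ K L C M : ℝ} {x y : X} {ω : Ultrafilter ℕ} {e : ℕ → X} {d : ℕ → ℝ}
  {hd : Tendsto d ω atTop} {t : ℕ → X}

/-- The points of the cone that are limits of sequences in the translates of `P` by `t n`. -/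
def coneSide (hd : Tendsto d ω atTop) (e t : ℕ → X) (P : Set X) :
    Set (AsymptoticCone X ω e d hd) :=
  {z | ∃ w : ConeSequence X ω e d hd, SeparationQuotient.mk w = z ∧
    ∀ᶠ n in (ω : Filter ℕ), (t n)⁻¹ * w.1 n ∈ P}

theorem coneSide_or_compl (z : AsymptoticCone X ω e d hd) :
    z ∈ coneSide hd e t P ∨ z ∈ coneSide hd e t Pᶜ := by
  rcases ω.em fun n => (t n)⁻¹ * (AsymptoticCone.rep z).1 n ∈ P with h | h
  · exact Or.inl ⟨_, AsymptoticCone.mk_rep z, h⟩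
  · exact Or.inr ⟨_, AsymptoticCone.mk_rep z, h⟩

theorem isConeMap_translate_comp (hP : IsBranch f P ℓ Λ K x y) (hL : 0 ≤ L)
    (hf : ∀ a b, dist (f a) (f b) ≤ L * dist a b + C)
    (ht : ∀ᶠ n in (ω : Filter ℕ), dist (t n) (e n) ≤ M * d n) :
    IsConeMap ω (fun _ => (1 : Y)) e d (fun n h => t n * f h) L C M where
  nonneg := hL
  dist_le n a b := by rw [hP.isometry]; exact hf a b
  base := by simpa using ht

/-- The limit of the cosets `t n * f Y` separates the two sides of the branch. -/
theorem exists_dist_coneMap_le (hP : IsBranch f P ℓ Λ K x y) {L' C' : ℝ} (hL' : 0 ≤ L')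
    (hf' : ∀ a b, dist a b ≤ L' * dist (f a) (f b) + C')
    (hι : IsConeMap ω (fun _ => (1 : Y)) e d (fun n h => t n * f h) L C M)
    {a b : AsymptoticCone X ω e d hd} (ha : a ∈ coneSide hd e t P) (hb : b ∈ coneSide hd e t Pᶜ) :
    ∃ q, dist a (coneMap (hd := hd) hι q) ≤ dist a b := by
  classical
  obtain ⟨w, rfl, hw⟩ := ha
  obtain ⟨v, rfl, hv⟩ := hb
  have h1 : ∀ n, ∃ h, (t n)⁻¹ * w.1 n ∈ P → (t n)⁻¹ * v.1 n ∉ P →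
      dist (w.1 n) (t n * f h) ≤ dist (w.1 n) (v.1 n) + K := by
    intro n
    by_cases h2 : (t n)⁻¹ * w.1 n ∈ P ∧ (t n)⁻¹ * v.1 n ∉ P
    · obtain ⟨h, hh⟩ := hP.crossing _ h2.1 _ h2.2
      refine ⟨h, fun _ _ => ?_⟩
      rw [← hP.isometry (t n), ← hP.isometry (t n) ((t n)⁻¹ * w.1 n)] at hh
      simpa using hh
    · exact ⟨1, fun h3 h4 => absurd ⟨h3, h4⟩ h2⟩
  choose h hh using h1
  have hh' : ∀ᶠ n in (ω : Filter ℕ),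
      dist (w.1 n) (t n * f (h n)) ≤ dist (w.1 n) (v.1 n) + K := by
    filter_upwards [hw, hv] with n h2 h3 using hh n h2 h3
  -- the chosen elements form a cone sequence
  set B := dist w ConeSequence.base + 1 with hB
  have hbound : ∀ᶠ n in (ω : Filter ℕ), dist (h n) 1 ≤
      (L' * (B + (dist w v + 1) + 1 + M) + 1) * d n := by
    filter_upwards [hh', hι.base, hd.eventually_ge_atTop K, hd.eventually_ge_atTop C',
      ConeSequence.eventually_of_dist_lt (lt_add_one (dist w v)),
      ConeSequence.eventually_of_dist_lt (lt_add_one (dist w ConeSequence.base))]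
      with n h1 h2 h3 h4 h5 h6
    have h7 := hf' (h n) 1
    rw [← hP.isometry (t n)] at h7
    have h8 : dist (t n * f (h n)) (t n * f 1) ≤ (B + (dist w v + 1) + 1 + M) * d n := by
      have h9 := dist_triangle4 (t n * f (h n)) (w.1 n) (e n) (t n * f 1)
      rw [dist_comm (t n * f (h n)) (w.1 n), dist_comm (e n)] at h9
      change dist (w.1 n) (e n) ≤ _ at h6
      rw [hB]
      linarith
    have h9 := mul_le_mul_of_nonneg_left h8 hL'
    linarith
  set q : ConeSequence Y ω (fun _ => (1 : Y)) d hd := ConeSequence.base.ofDistLE h hbound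
  refine ⟨SeparationQuotient.mk q, ?_⟩
  rw [coneMap_mk, SeparationQuotient.dist_mk, SeparationQuotient.dist_mk]
  have hlim : Tendsto (fun n => dist (w.1 n) (v.1 n) / d n + K / d n) ω (𝓝 (dist w v)) := by
    simpa using (ConeSequence.tendsto_dist w v).add (tendsto_const_nhds.div_atTop hd)
  refine le_of_tendsto_of_tendsto (ConeSequence.tendsto_dist _ _) hlim ?_
  filter_upwards [hd.eventually_gt_atTop 0, hh'] with n hn h1
  rw [← add_div]
  gcongr
  exact h1

end Sides

/-! ### Uncountably many loops -/

/-- Loops such that none is freely homotopic to another one represent different elements of the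
fundamental group. -/
theorem uncountable_fundamentalGroup_of_loops {Z : Type*} [TopologicalSpace Z]
    [PathConnectedSpace Z] (z : Set.Ioo (0 : ℝ) 1 → Z) (γ : ∀ s, Path (z s) (z s))
    (h : ∀ s s' : Set.Ioo (0 : ℝ) 1, s < s' → ∀ δ : Path (z s) (z s'),
      ¬ (γ s).Homotopic ((δ.trans (γ s')).trans δ.symm)) (p : Z) :
    Uncountable (FundamentalGroup Z p) := by
  have η : ∀ s, Path p (z s) := fun s => PathConnectedSpace.somePath p (z s)
  let F : Set.Ioo (0 : ℝ) 1 → FundamentalGroup Z p := fun s =>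
    FundamentalGroup.fromPath (.mk (((η s).trans (γ s)).trans (η s).symm))
  have key : ∀ s s', s < s' → F s ≠ F s' := by
    intro s s' hss hF
    refine h s s' hss ((η s).symm.trans (η s')) ?_
    have hF' : Path.Homotopic.Quotient.mk (((η s).trans (γ s)).trans (η s).symm) =
        Path.Homotopic.Quotient.mk (((η s').trans (γ s')).trans (η s').symm) := hF
    rw [← Path.Homotopic.Quotient.eq]
    have h2 := congrArg (fun c => ((Path.Homotopic.Quotient.mk (η s)).symm.trans c).trans
      (Path.Homotopic.Quotient.mk (η s))) hF'
    simp only [Path.Homotopic.Quotient.mk_trans, Path.Homotopic.Quotient.mk_symm,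
      Path.Homotopic.Quotient.trans_assoc, Path.Homotopic.Quotient.symm_trans,
      Path.Homotopic.Quotient.trans_refl] at h2
    rw [← Path.Homotopic.Quotient.trans_assoc, Path.Homotopic.Quotient.symm_trans,
      Path.Homotopic.Quotient.refl_trans] at h2
    simpa using h2
  have hinj : Function.Injective F := by
    intro s s' hF
    rcases lt_trichotomy s s' with h1 | h1 | h1
    · exact absurd hF (key s s' h1)
    · exact h1
    · exact absurd hF.symm (key s' s h1)
  have : Uncountable (Set.Ioo (0 : ℝ) 1) := by
    rw [← not_countable_iff, Set.countable_coe_iff, Cardinal.Real.Ioo_countable_iff]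
    norm_num
  exact hinj.uncountable

theorem Path.Homotopic.refl_of_leftInverse {A B : Type*} [TopologicalSpace A] [TopologicalSpace B]
    {Φ : A → B} {Ψ : B → A} (hΦ : Continuous Φ) (hΨ : Continuous Ψ) (h : ∀ z, Ψ (Φ z) = z) {z : A}
    {γ : Path z z} (hγ : (γ.map hΦ).Homotopic (Path.refl _)) : γ.Homotopic (Path.refl z) := by
  have h1 := hγ.map ⟨Ψ, hΨ⟩
  have h2 : ((γ.map hΦ).map hΨ) = γ.cast (h z) (h z) := by
    ext s
    exact h (γ s)
  have h3 : ∀ (z' : A) (hz : z' = z), (γ.cast hz hz).Homotopic (Path.refl z') →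
      γ.Homotopic (Path.refl z) := by
    rintro _ rfl h4
    exact h4
  refine h3 _ (h z) ?_
  rw [← h2]
  exact h1

section Translates

variable {X Y : Type*} [Group X] [PseudoMetricSpace X] [Group Y] [PseudoMetricSpace Y] {f : Y →* X}
  {P : Set X} {ℓ : X → ℕ} {Λ K L C κ : ℝ} {x y : X} {ω : Ultrafilter ℕ} {e : ℕ → X} {d : ℕ → ℝ}
  {hd : Tendsto d ω atTop} {c : X → X → ℝ → X}

omit [PseudoMetricSpace Y] in
theorem isConeMap_mul_left (hP : IsBranch f P ℓ Λ K x y) {g : ℕ → X} {M : ℝ}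
    (hg : ∀ᶠ n in (ω : Filter ℕ), dist 1 (g n) ≤ M * d n) :
    IsConeMap ω e e d (fun n w => e n * g n * (e n)⁻¹ * w) 1 0 M where
  nonneg := zero_le_one
  dist_le n a b := by rw [hP.isometry, one_mul, add_zero]
  base := by
    filter_upwards [hg] with n hn
    have h := hP.isometry (e n) 1 (g n)
    rw [mul_one] at h
    rw [inv_mul_cancel_right, dist_comm, h]
    exact hn

omit [PseudoMetricSpace Y] in
theorem isConeMap_mul_left_inv (hP : IsBranch f P ℓ Λ K x y) {g : ℕ → X} {M : ℝ}
    (hg : ∀ᶠ n in (ω : Filter ℕ), dist 1 (g n) ≤ M * d n) :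
    IsConeMap ω e e d (fun n w => e n * (g n)⁻¹ * (e n)⁻¹ * w) 1 0 M := by
  refine isConeMap_mul_left hP (g := fun n => (g n)⁻¹) ?_
  filter_upwards [hg] with n hn
  rwa [← hP.isometry (g n), mul_one, mul_inv_cancel, dist_comm]

omit [PseudoMetricSpace Y] in
/-- The left inverse of a translation. -/
theorem coneMap_mul_left_inv (hP : IsBranch f P ℓ Λ K x y) {g : ℕ → X} {M : ℝ}
    (hg : ∀ᶠ n in (ω : Filter ℕ), dist 1 (g n) ≤ M * d n) (z : AsymptoticCone X ω e d hd) :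
    coneMap (hd := hd) (isConeMap_mul_left_inv hP hg)
      (coneMap (isConeMap_mul_left hP hg) z) = z := by
  obtain ⟨w, rfl⟩ := SeparationQuotient.surjective_mk z
  rw [coneMap_mk, coneMap_mk]
  refine ConeSequence.mk_eq_mk_of_eventuallyEq (Eventually.of_forall fun n => ?_)
  change e n * (g n)⁻¹ * (e n)⁻¹ * (e n * g n * (e n)⁻¹ * w.1 n) = w.1 n
  group

/-- **Branching.** Let `X` be a group with a branch along the image of `Y`, and suppose that the
asymptotic cone of `Y` is simply connected. An essential loop in the asymptotic cone of `X` has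
uncountably many translates which are pairwise separated by limits of cosets of the image of `Y`;
they represent different elements of the fundamental group. -/
theorem IsBranch.simplyConnectedSpace_or_uncountable (hP : IsBranch f P ℓ Λ K x y)
    (hc : IsCombing κ c) (hL : 0 ≤ L) (hf : ∀ a b, dist (f a) (f b) ≤ L * dist a b + C)
    (hf' : ∀ a b, dist a b ≤ L * dist (f a) (f b) + C)
    [SimplyConnectedSpace (AsymptoticCone Y ω (fun _ => (1 : Y)) d hd)] {C₀ : ℝ}
    (hY : UniformExtension (AsymptoticCone Y ω (fun _ => (1 : Y)) d hd) C₀) :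
    SimplyConnectedSpace (AsymptoticCone X ω e d hd) ∨
      ∀ p : AsymptoticCone X ω e d hd,
        Uncountable (FundamentalGroup (AsymptoticCone X ω e d hd) p) := by
  have hpc : PathConnectedSpace (AsymptoticCone X ω e d hd) := pathConnectedSpace_cone hc
  rw [or_iff_not_imp_left, simply_connected_iff_loops_nullhomotopic]
  intro hnot p
  push Not at hnot
  obtain ⟨z, γ, hγ⟩ := hnot hpc
  -- the size of the loop
  obtain ⟨R, hR⟩ : ∃ R, ∀ s, dist (γ s) (SeparationQuotient.mk ConeSequence.base) < R := by
    obtain ⟨R, hR⟩ := (isCompact_range γ.continuous).isBounded.subset_ball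
      (SeparationQuotient.mk ConeSequence.base)
    exact ⟨R, fun s => hR ⟨s, rfl⟩⟩
  have hR0 : 0 < R := dist_nonneg.trans_lt (hR 0)
  -- the depth `k n` of the translates is large compared to the size of the loop
  set Q : ℝ := Λ * (2 * R) + 2 with hQ
  have hQ0 : 0 < Q := by
    have := mul_nonneg hP.nonneg (mul_nonneg zero_le_two hR0.le)
    linarith
  set k : ℕ → ℕ := fun n => ⌊Q * d n⌋₊ with hk
  set m : ℝ → ℕ → ℕ := fun s n => ⌊s * d n⌋₊ with hm
  -- The translation with parameter `s` is by `x ^ m s n * y ^ (2 * k n)`. It moves the loop beyond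
  -- the coset of `x ^ m s n * y ^ k n`, and larger parameters leave the loop on the other side.
  have hkd : ∀ᶠ n in (ω : Filter ℕ), 1 ≤ k n ∧ ℓ 1 + Λ * (2 * (R * d n) + K) < k n := by
    filter_upwards [hd.eventually_gt_atTop 0, hd.eventually_gt_atTop 1,
      hd.eventually_gt_atTop (ℓ 1 + Λ * K)] with n h0 h1 h2
    have h3 := Nat.lt_floor_add_one (Q * d n)
    have h4 : Q * d n = Λ * (2 * (R * d n)) + 2 * d n := by rw [hQ]; ring
    have h5 : 0 ≤ Λ * (2 * (R * d n)) := mul_nonneg hP.nonneg (by positivity)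
    refine ⟨Nat.le_floor ?_, ?_⟩
    · rw [h4]; push_cast; linarith
    · change _ < ((⌊Q * d n⌋₊ : ℕ) : ℝ)
      rw [mul_add]
      linarith
  have hpow : ∀ (s r : ℝ) (b : ℕ → ℕ), 0 ≤ s → 0 ≤ r → (∀ n, (b n : ℝ) ≤ r * k n) →
      ∀ᶠ n in (ω : Filter ℕ), dist 1 (x ^ m s n * y ^ b n) ≤
        (s * dist 1 x + r * Q * dist 1 y) * d n := by
    intro s r b hs hr hb
    filter_upwards [hd.eventually_ge_atTop 0] with n h0
    have h1 := hP.dist_one_mul_le (x ^ m s n) (y ^ b n)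
    have h2 := hP.dist_one_pow_le x (m s n)
    have h3 := hP.dist_one_pow_le y (b n)
    have h4 : (m s n : ℝ) * dist 1 x ≤ s * d n * dist 1 x :=
      mul_le_mul_of_nonneg_right (Nat.floor_le (by positivity)) dist_nonneg
    have h5 : (b n : ℝ) * dist 1 y ≤ r * (Q * d n) * dist 1 y :=
      mul_le_mul_of_nonneg_right ((hb n).trans (mul_le_mul_of_nonneg_left
        (Nat.floor_le (by positivity)) hr)) dist_nonneg
    nlinarith
  -- the translates of the loop
  set g : ℝ → ℕ → X := fun s n => x ^ m s n * y ^ (2 * k n) with hg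
  have hgd : ∀ s : Set.Ioo (0 : ℝ) 1, ∀ᶠ n in (ω : Filter ℕ), dist 1 (g s n) ≤
      (s * dist 1 x + 2 * Q * dist 1 y) * d n := fun s =>
    hpow s 2 (fun n => 2 * k n) s.2.1.le zero_le_two fun n => by push_cast; rfl
  have hmem : ∀ (s : Set.Ioo (0 : ℝ) 1) (r : ℝ) (P' : Set X),
      (∀ᶠ n in (ω : Filter ℕ), ∀ v, dist 1 v ≤ R * d n →
        (y ^ k n)⁻¹ * ((x ^ m r n)⁻¹ * x ^ m s n) * (y ^ (2 * k n) * v) ∈ P') →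
      ∀ i, coneMap (isConeMap_mul_left hP (hgd s)) (γ i) ∈
        coneSide hd e (fun n => e n * (x ^ m r n * y ^ k n)) P' := by
    intro s r P' hv i
    rw [← AsymptoticCone.mk_rep (γ i), coneMap_mk]
    refine ⟨_, rfl, ?_⟩
    have h1 : dist (AsymptoticCone.rep (γ i)) ConeSequence.base < R := by
      rw [← SeparationQuotient.dist_mk, AsymptoticCone.mk_rep]
      exact hR i
    filter_upwards [hv, ConeSequence.eventually_of_dist_lt h1] with n h2 h3
    have h4 := h2 ((e n)⁻¹ * (AsymptoticCone.rep (γ i)).1 n) (by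
      rw [← hP.isometry (e n), mul_one, mul_inv_cancel_left, dist_comm]
      exact h3)
    change (e n * (x ^ m r n * y ^ k n))⁻¹ * (e n * (x ^ m s n * y ^ (2 * k n)) * (e n)⁻¹ *
      (AsymptoticCone.rep (γ i)).1 n) ∈ P'
    convert h4 using 1
    group
  refine uncountable_fundamentalGroup_of_loops _
    (fun s => γ.map (continuous_coneMap (isConeMap_mul_left hP (hgd s)))) ?_ p
  intro s s' hss δ hδ
  -- the separating limit of cosets
  set t : ℕ → X := fun n => e n * (x ^ m s n * y ^ k n) with ht
  have htd : ∀ᶠ n in (ω : Filter ℕ), dist (t n) (e n) ≤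
      (s * dist 1 x + 1 * Q * dist 1 y) * d n := by
    filter_upwards [hpow s 1 k s.2.1.le zero_le_one fun n => by rw [one_mul]] with n hn
    have h := hP.isometry (e n) 1 (x ^ m s n * y ^ k n)
    rw [mul_one] at h
    rw [dist_comm]
    exact h.trans_le hn
  have hι := isConeMap_translate_comp (Y := Y) hP hL hf htd
  have hemb := isClosedEmbedding_coneMap (hd := hd) hι hL fun n a b => by
    rw [hP.isometry]; exact hf' a b
  set D := Set.range (coneMap (hd := hd) hι) with hD
  have hDc : IsClosed D := hemb.isClosed_range
  have hsep : ∀ a ∈ coneSide hd e t P, ∀ b ∈ coneSide hd e t Pᶜ, ∃ q ∈ D,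
      dist a q ≤ 2 * dist a b := by
    intro a ha b hb
    obtain ⟨q, hq⟩ := exists_dist_coneMap_le hP hL hf' hι ha hb
    exact ⟨_, ⟨q, rfl⟩, by linarith [dist_nonneg (x := a) (y := b)]⟩
  have hsep' : ∀ b ∈ coneSide hd e t Pᶜ, ∀ a ∈ coneSide hd e t P, ∃ q ∈ D,
      dist b q ≤ 2 * dist b a := by
    intro b hb a ha
    obtain ⟨q, hq⟩ := exists_dist_coneMap_le hP hL hf' hι ha hb
    refine ⟨_, ⟨q, rfl⟩, ?_⟩
    rw [dist_comm b a]
    linarith [dist_triangle_left b (coneMap (hd := hd) hι q) a]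
  have hS₁ : IsClosed (coneSide hd e t P ∪ D) :=
    isClosed_union_of_dist_le hDc (fun z => (coneSide_or_compl z).symm) hsep'
  have hS₂ : IsClosed (coneSide hd e t Pᶜ ∪ D) :=
    isClosed_union_of_dist_le hDc (fun z => coneSide_or_compl z) hsep
  have hγ₁ : ∀ i, coneMap (isConeMap_mul_left hP (hgd s)) (γ i) ∈ coneSide hd e t P := by
    refine hmem s s P ?_
    filter_upwards [hkd] with n hn v hv
    obtain ⟨h1, h2⟩ := hP.pow_mem (k n) hn.1
    rw [inv_mul_cancel, mul_one, two_mul, pow_add, mul_assoc, inv_mul_cancel_left,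
      hP.mem_iff_of_deep (p := y ^ k n) (r := R * d n)]
    · exact h1
    · rwa [← hP.isometry (y ^ k n), mul_one] at hv
    · exact hn.2.trans_le (by exact_mod_cast h2)
  have hγ₂ : ∀ i, coneMap (isConeMap_mul_left hP (hgd s')) (γ i) ∈ coneSide hd e t Pᶜ := by
    refine hmem s' s Pᶜ ?_
    have hss' : 0 < (s' - s : ℝ) := sub_pos.2 hss
    filter_upwards [hkd, hd.eventually_ge_atTop (2 / (s' - s)), hd.eventually_ge_atTop 0]
      with n hn hn2 hn0 v hv
    have h0 : m s n + 1 ≤ m s' n := by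
      rw [div_le_iff₀ hss'] at hn2
      refine Nat.le_floor ?_
      have h3 : (m s n : ℝ) ≤ s * d n := Nat.floor_le (mul_nonneg s.2.1.le hn0)
      push_cast
      linarith
    obtain ⟨j, hj⟩ := Nat.exists_eq_add_of_le h0
    obtain ⟨h1, h2⟩ := hP.notMem (k n) (1 + j) (2 * k n) hn.1 (by omega) (by omega)
    rw [hj, add_assoc, pow_add x, inv_mul_cancel_left, Set.mem_compl_iff, ← mul_assoc,
      hP.mem_iff_of_deep (p := (y ^ k n)⁻¹ * x ^ (1 + j) * y ^ (2 * k n)) (r := R * d n)]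
    · exact h1
    · rwa [← hP.isometry ((y ^ k n)⁻¹ * x ^ (1 + j) * y ^ (2 * k n)), mul_one] at hv
    · exact hn.2.trans_le (by exact_mod_cast h2)
  have hnull := Path.Homotopic.refl_of_separated hY hemb hS₁ hS₂
    (fun z => (coneSide_or_compl z).imp Or.inl Or.inl) (inter_union_of_dist_le hDc hsep)
    (fun i => Or.inl (hγ₁ i)) (fun i => Or.inl (hγ₂ i)) hδ
  -- undo the translation
  exact hγ (Path.Homotopic.refl_of_leftInverse (continuous_coneMap (isConeMap_mul_left hP (hgd s)))
    (continuous_coneMap (isConeMap_mul_left_inv hP (hgd s)))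
    (fun z => coneMap_mul_left_inv hP (hgd s) z) hnull)

end Translates

/-! ### Word metrics: translations, combings, prairie groups -/

namespace WordMetric

variable {G : Type*} [Group G] {S : Set G} {hS : Subgroup.closure S = ⊤}

instance : Group (WordMetric S hS) := inferInstanceAs (Group G)

theorem dist_eq (a b : G) : dist (α := WordMetric S hS) a b = wordLength S (a⁻¹ * b) := rfl

theorem dist_mul_left (g a b : G) :
    dist (α := WordMetric S hS) (g * a : G) (g * b : G) = dist (α := WordMetric S hS) a b := by
  rw [dist_eq, dist_eq]
  congr 2
  group

theorem dist_mul_prod_le (g : G) {l : List G} (hl : ∀ x ∈ l, x ∈ S ∨ x⁻¹ ∈ S) :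
    dist (α := WordMetric S hS) g (g * l.prod : G) ≤ l.length := by
  rw [dist_eq, inv_mul_cancel_left]
  exact_mod_cast wordLength_le_of_word l hl

/-- A shortest word that leads from `p` to `q`. -/
noncomputable def geodesic (hS : Subgroup.closure S = ⊤) (p q : G) : List G :=
  (exists_word hS (p⁻¹ * q)).choose

theorem length_geodesic (p q : G) :
    ((geodesic hS p q).length : ℝ) = dist (α := WordMetric S hS) p q :=
  congrArg Nat.cast (exists_word hS (p⁻¹ * q)).choose_spec.1

theorem mem_geodesic (p q : G) : ∀ x ∈ geodesic hS p q, x ∈ S ∨ x⁻¹ ∈ S :=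
  (exists_word hS (p⁻¹ * q)).choose_spec.2.1

theorem mul_prod_geodesic (p q : G) : p * (geodesic hS p q).prod = q := by
  rw [geodesic, (exists_word hS (p⁻¹ * q)).choose_spec.2.2, mul_inv_cancel_left]

/-- The point at time `s` of the path from `p` to `q` along a geodesic word. -/
noncomputable def walk (hS : Subgroup.closure S = ⊤) (p q : G) (s : ℝ) : G :=
  p * ((geodesic hS p q).take ⌊s * (geodesic hS p q).length⌋₊).prod

/-- The combing of a group by geodesics of the Cayley graph. -/
noncomputable def comb (p q : WordMetric S hS) (s : ℝ) : WordMetric S hS :=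
  walk hS p q s

theorem dist_take_le (p q : G) {i j : ℕ} (hij : i ≤ j) :
    dist (α := WordMetric S hS) (p * ((geodesic hS p q).take i).prod : G)
      (p * ((geodesic hS p q).take j).prod : G) ≤ (j - i : ℝ) := by
  have h1 : ((geodesic hS p q).take j).prod =
      ((geodesic hS p q).take i).prod * (((geodesic hS p q).take j).drop i).prod := by
    rw [← List.prod_append]
    congr 1
    conv_lhs => rw [← List.take_append_drop i ((geodesic hS p q).take j)]
    rw [List.take_take, min_eq_left hij]
  rw [h1, ← mul_assoc]
  refine (dist_mul_prod_le _ fun x hx =>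
    mem_geodesic p q x (List.mem_of_mem_take (List.mem_of_mem_drop hx))).trans ?_
  rw [← Nat.cast_sub hij, List.length_drop, List.length_take]
  exact_mod_cast Nat.sub_le_sub_right (min_le_left _ _) _

theorem isCombing_comb : IsCombing 1 (comb : WordMetric S hS → _) where
  zero (p q : G) := by
    change walk hS p q 0 = p
    rw [walk, zero_mul, Nat.floor_zero, List.take_zero, List.prod_nil, mul_one]
  one (p q : G) := by
    change walk hS p q 1 = q
    rw [walk, one_mul, Nat.floor_natCast, List.take_length, mul_prod_geodesic]
  dist_le := fun (p q : G) => by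
    have key : ∀ s ∈ Set.Icc (0 : ℝ) 1, ∀ t ∈ Set.Icc (0 : ℝ) 1, s ≤ t →
        dist (α := WordMetric S hS) (walk hS p q s) (walk hS p q t) ≤
          |s - t| * dist (α := WordMetric S hS) p q + 1 := by
      intro s hs t ht hst
      rw [← length_geodesic]
      set m := (geodesic hS p q).length with hm
      have h1 : ⌊s * m⌋₊ ≤ ⌊t * m⌋₊ := Nat.floor_le_floor (by gcongr)
      refine (dist_take_le p q h1).trans ?_
      rw [abs_sub_comm, abs_of_nonneg (by linarith)]
      have h2 := Nat.floor_le (a := t * m) (mul_nonneg ht.1 (Nat.cast_nonneg _))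
      have h3 := Nat.lt_floor_add_one (s * m)
      linarith
    intro s hs t ht
    rcases le_total s t with h | h
    · exact key s hs t ht h
    · rw [dist_comm, abs_sub_comm]
      exact key t ht s hs h

end WordMetric

theorem IsPrairieGroup.exists_uniformExtension {H : Type*} [Group H] (hH : IsPrairieGroup H)
    {T : Set H} (hT : T.Finite) (hT' : Subgroup.closure T = ⊤) {ω : Ultrafilter ℕ}
    {e : ℕ → WordMetric T hT'} {d : ℕ → ℝ} {hd : Tendsto d ω atTop} :
    ∃ C, UniformExtension (AsymptoticCone (WordMetric T hT') ω e d hd) C := by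
  obtain ⟨n, hn, R, -, h⟩ := exists_loopDivision (X := WordMetric T hT') WordMetric.isCombing_comb
    (fun ω e d hd => by
      have := hH.2 T hT hT' ω e d hd
      exact almostFillable_of_simplyConnected) 4
  exact h.exists_uniformExtension hn WordMetric.isCombing_comb

/-- A set that is almost invariant relative to `f Y`: a path that leaves `P` passes close to
`f Y`. -/
theorem exists_crossing {G Y : Type*} [Group G] [Group Y] (f : Y →* G) {S : Set G}
    (hSf : S.Finite) (hS : Subgroup.closure S = ⊤) {P : Set G}
    (hP : ∀ s : G, ∃ F : Set G, F.Finite ∧ ∀ g ∈ P, g * s ∉ P → ∃ h, ∃ k ∈ F, g = f h * k) :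
    ∃ K : ℝ, ∀ g ∈ P, ∀ g' ∉ P, ∃ h,
      dist (α := WordMetric S hS) g (f h) ≤ dist (α := WordMetric S hS) g g' + K := by
  choose F hF hFP using hP
  have hlet : {s : G | s ∈ S ∨ s⁻¹ ∈ S}.Finite := hSf.union (hSf.preimage inv_injective.injOn)
  obtain ⟨K, hK⟩ := ((hlet.biUnion fun s _ => hF s).image
    fun k => dist (α := WordMetric S hS) k 1).bddAbove
  have hK' : ∀ s, (s ∈ S ∨ s⁻¹ ∈ S) → ∀ k ∈ F s, dist (α := WordMetric S hS) k 1 ≤ K :=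
    fun s hs k hk => hK ⟨k, Set.mem_biUnion hs hk, rfl⟩
  have key : ∀ (l : List G), (∀ x ∈ l, x ∈ S ∨ x⁻¹ ∈ S) → ∀ g ∈ P, g * l.prod ∉ P →
      ∃ h, dist (α := WordMetric S hS) g (f h) ≤ l.length + K := by
    intro l
    induction l with
    | nil =>
      intro _ g hg hg'
      exact absurd hg (by simpa using hg')
    | cons a l ih =>
      intro hl g hg hg'
      have ha := hl a (by simp)
      by_cases hga : g * a ∈ P
      · rw [List.prod_cons, ← mul_assoc] at hg'
        obtain ⟨h, hh⟩ := ih (fun x hx => hl x (by simp [hx])) (g * a) hga hg'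
        refine ⟨h, ?_⟩
        have h1 : dist (α := WordMetric S hS) g (g * a : G) ≤ 1 := by
          have := WordMetric.dist_mul_prod_le (hS := hS) g (l := [a]) (by simpa using ha)
          simpa using this
        have h2 := dist_triangle (α := WordMetric S hS) g (g * a : G) (f h)
        rw [List.length_cons]
        push_cast
        linarith
      · obtain ⟨h, k, hk, rfl⟩ := hFP a g hg hga
        refine ⟨h, ?_⟩
        have h1 := WordMetric.dist_mul_left (S := S) (hS := hS) (f h) k 1
        rw [mul_one] at h1
        refine (h1.trans_le (hK' a ha k hk)).trans ?_
        have : (0 : ℝ) ≤ (a :: l).length := Nat.cast_nonneg _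
        linarith
  refine ⟨K, fun g hg g' hg' => ?_⟩
  have h1 := key (WordMetric.geodesic hS g g') (WordMetric.mem_geodesic _ _) g hg
    (by rw [WordMetric.mul_prod_geodesic (hS := hS)]; exact hg')
  rwa [WordMetric.length_geodesic] at h1

/-- A depth function that changes boundedly under left multiplication by every element changes
linearly in the word length. -/
theorem exists_depth_bound {G : Type*} [Group G] {S : Set G}
    (hSf : S.Finite) (hS : Subgroup.closure S = ⊤) {ℓ : G → ℕ}
    (hℓ : ∀ s, ∃ c, ∀ g, ℓ (s * g) ≤ ℓ g + c) :
    ∃ Λ : ℝ, 0 ≤ Λ ∧ ∀ w g : G, (ℓ (w * g) : ℝ) ≤ ℓ g + Λ * dist (α := WordMetric S hS) 1 w := by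
  choose c hc using hℓ
  have hlet : {s : G | s ∈ S ∨ s⁻¹ ∈ S}.Finite := hSf.union (hSf.preimage inv_injective.injOn)
  obtain ⟨Λ, hΛ⟩ := (hlet.image c).bddAbove
  have hΛ' : ∀ s, (s ∈ S ∨ s⁻¹ ∈ S) → c s ≤ Λ := fun s hs => hΛ ⟨s, hs, rfl⟩
  have key : ∀ (l : List G), (∀ x ∈ l, x ∈ S ∨ x⁻¹ ∈ S) → ∀ g,
      ℓ (l.prod * g) ≤ ℓ g + Λ * l.length := by
    intro l
    induction l with
    | nil => intro _ g; simp
    | cons a l ih =>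
      intro hl g
      have h1 := ih (fun x hx => hl x (by simp [hx])) g
      have h2 := hc a (l.prod * g)
      have h3 := hΛ' a (hl a (by simp))
      rw [List.prod_cons, mul_assoc, List.length_cons, mul_add]
      linarith
  refine ⟨Λ, Nat.cast_nonneg _, fun w g => ?_⟩
  have h1 := key (WordMetric.geodesic hS 1 w) (WordMetric.mem_geodesic _ _) g
  have h2 := WordMetric.mul_prod_geodesic (hS := hS) 1 w
  rw [show (WordMetric.geodesic hS 1 w).prod = w from (one_mul (M := G) _).symm.trans h2]
    at h1
  have h3 := WordMetric.length_geodesic (hS := hS) 1 w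
  refine le_of_le_of_eq ?_ (congrArg (fun t : ℝ => (ℓ g : ℝ) + Λ * t) h3)
  exact_mod_cast h1

/-- The dichotomy for a group `G` with a subset `P` that is invariant, and almost invariant from the
right, under a quasi-isometrically embedded prairie group, and has deep points on both sides. -/
theorem satisfiesConeDichotomy_of_branch {G Y : Type*} [Group G] [Group Y] (f : Y →* G)
    (hY : IsPrairieGroup Y) (hf : IsQuasiIsometricallyEmbedded f) (P : Set G) (ℓ : G → ℕ) (x y : G)
    (hP : ∀ s : G, ∃ F : Set G, F.Finite ∧ ∀ g ∈ P, g * s ∉ P → ∃ h, ∃ k ∈ F, g = f h * k)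
    (hℓ : ∀ s, ∃ c, ∀ g, ℓ (s * g) ≤ ℓ g + c) (hℓf : ∀ h g, ℓ (f h * g) = ℓ g)
    (hpow : ∀ j, 1 ≤ j → y ^ j ∈ P ∧ j ≤ ℓ (y ^ j))
    (hnot : ∀ k m l, 1 ≤ k → 1 ≤ m → 1 ≤ l →
      (y ^ k)⁻¹ * x ^ m * y ^ l ∉ P ∧ k ≤ ℓ ((y ^ k)⁻¹ * x ^ m * y ^ l)) :
    SatisfiesConeDichotomy G := by
  intro S hSf hS ω e d hd
  obtain ⟨T, hT, hTf⟩ := Group.fg_iff.1 hY.1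
  obtain ⟨L, C, hL, hC, hLC⟩ := hf.2.2 T hTf hT S hSf hS
  obtain ⟨K, hK⟩ := exists_crossing f hSf hS hP
  obtain ⟨Λ, hΛ, hΛℓ⟩ := exists_depth_bound hSf hS hℓ
  have hL0 : 0 < L := by linarith
  let f' : WordMetric T hT →* WordMetric S hS := f
  have hb : IsBranch f' P ℓ Λ K x y :=
    { isometry := WordMetric.dist_mul_left
      nonneg := hΛ
      crossing := hK
      depth_map_mul := hℓf
      depth_mul_le := hΛℓ
      pow_mem := hpow
      notMem := hnot }
  have hsc : SimplyConnectedSpace (AsymptoticCone (WordMetric T hT) ω (fun _ => 1) d hd) :=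
    hY.2 T hTf hT ω _ d hd
  obtain ⟨C₀, hC₀⟩ := hY.exists_uniformExtension hTf hT (ω := ω) (e := fun _ => 1) (hd := hd)
  refine hb.simplyConnectedSpace_or_uncountable (L := L) (C := L * C) WordMetric.isCombing_comb
    hL0.le (fun a b => ?_) (fun a b => ?_) hC₀
  · have h1 := (hLC a b).2
    have h2 : C ≤ L * C := le_mul_of_one_le_left hC hL
    exact h1.trans (by linarith)
  · have h1 := (hLC a b).1
    rw [sub_le_iff_le_add, div_le_iff₀ hL0] at h1
    refine h1.trans_eq ?_
    change _ = L * dist (α := WordMetric S hS) (f a) (f b) + L * C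
    ring

/-! ### Almost invariant sets -/

/-- Right multiplication by `s` changes the membership in `P` for finitely many cosets of the image
of `f` only. -/
def IsAlmostInvariant {G Y : Type*} [Group G] [Group Y] (f : Y →* G) (P : Set G) (s : G) : Prop :=
  ∃ F : Set G, F.Finite ∧ ∀ g, ¬ (g ∈ P ↔ g * s ∈ P) → ∃ h, ∃ k ∈ F, g = f h * k

namespace IsAlmostInvariant

variable {G Y : Type*} [Group G] [Group Y] {f : Y →* G} {P : Set G} {s s' : G}

theorem mul (h : IsAlmostInvariant f P s) (h' : IsAlmostInvariant f P s') :
    IsAlmostInvariant f P (s * s') := by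
  obtain ⟨F, hF, hFP⟩ := h
  obtain ⟨F', hF', hFP'⟩ := h'
  refine ⟨F ∪ (· * s⁻¹) '' F', hF.union (hF'.image _), fun g hg => ?_⟩
  by_cases h1 : g ∈ P ↔ g * s ∈ P
  · rw [h1, ← mul_assoc] at hg
    obtain ⟨y, k, hk, hgk⟩ := hFP' _ hg
    exact ⟨y, _, Or.inr ⟨k, hk, rfl⟩, by rw [← mul_assoc, ← hgk, mul_inv_cancel_right]⟩
  · obtain ⟨y, k, hk, hgk⟩ := hFP _ h1
    exact ⟨y, k, Or.inl hk, hgk⟩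

theorem inv (h : IsAlmostInvariant f P s) : IsAlmostInvariant f P s⁻¹ := by
  obtain ⟨F, hF, hFP⟩ := h
  refine ⟨(· * s) '' F, hF.image _, fun g hg => ?_⟩
  obtain ⟨y, k, hk, hgk⟩ := hFP (g * s⁻¹) (by rwa [inv_mul_cancel_right, iff_comm])
  exact ⟨y, _, ⟨k, hk, rfl⟩, by rw [← mul_assoc, ← hgk, inv_mul_cancel_right]⟩

end IsAlmostInvariant

/-- Left multiplication by `s` changes the depth by a bounded amount. -/
def IsDepthBounded {G : Type*} [Group G] (ℓ : G → ℕ) (s : G) : Prop :=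
  ∃ c, ∀ g, ℓ (s * g) ≤ ℓ g + c ∧ ℓ g ≤ ℓ (s * g) + c

namespace IsDepthBounded

variable {G : Type*} [Group G] {ℓ : G → ℕ} {s s' : G}

theorem mul (h : IsDepthBounded ℓ s) (h' : IsDepthBounded ℓ s') : IsDepthBounded ℓ (s * s') := by
  obtain ⟨c, hc⟩ := h
  obtain ⟨c', hc'⟩ := h'
  refine ⟨c + c', fun g => ?_⟩
  have h1 := hc (s' * g)
  have h2 := hc' g
  rw [mul_assoc]
  omega

theorem inv (h : IsDepthBounded ℓ s) : IsDepthBounded ℓ s⁻¹ := by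
  obtain ⟨c, hc⟩ := h
  refine ⟨c, fun g => ?_⟩
  have h1 := hc (s⁻¹ * g)
  rw [mul_inv_cancel_left] at h1
  exact ⟨h1.2, h1.1⟩

end IsDepthBounded

/-! ### The branch of an HNN extension -/

namespace HNNExtension

open NormalWord

variable {A : Type u} [Group A] {H K : Subgroup A} {φ : H ≃* K} (d : TransversalPair A H K)

/-- The elements whose normal form begins with an element of the associated subgroup followed by
the letter `t ^ u`. -/
def leading (φ : H ≃* K) (d : TransversalPair A H K) (u : ℤˣ) : Set (HNNExtension A H K φ) :=
  {g | Cancels (-u) (g • (empty : NormalWord d))}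

/-- The number of letters `t`, `t⁻¹` in the normal form. -/
noncomputable def depth (g : HNNExtension A H K φ) : ℕ :=
  (g • (empty : NormalWord d)).toList.length

variable {d} {g g' : HNNExtension A H K φ} {a : A} {u v : ℤˣ}

theorem of_smul_empty (a : A) : (of a : HNNExtension A H K φ) • (empty : NormalWord d) =
    ofGroup a := by
  rw [of_smul_eq_smul]
  ext <;> simp

theorem depth_of_mul : depth d (of a * g) = depth d g := by
  rw [depth, mul_smul, of_smul_eq_smul, group_smul_toList, depth]

theorem depth_of : depth d (of a : HNNExtension A H K φ) = 0 := by
  rw [depth, of_smul_empty]; rfl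

theorem of_notMem_leading : (of a : HNNExtension A H K φ) ∉ leading φ d u := by
  intro h
  have h2 := h.2
  rw [of_smul_empty] at h2
  simp at h2

theorem one_notMem_leading : (1 : HNNExtension A H K φ) ∉ leading φ d u := by
  have := of_notMem_leading (φ := φ) (d := d) (a := 1) (u := u)
  rwa [map_one] at this

theorem t_zpow_mul_mem_leading_iff :
    (t ^ (u : ℤ) * g : HNNExtension A H K φ) ∈ leading φ d u ↔ g ∉ leading φ d (-u) := by
  change Cancels _ _ ↔ ¬ Cancels _ _
  rw [mul_smul, t_pow_smul_eq_unitsSMul, unitsSMul_cancels_iff, neg_neg]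

theorem eq_of_mem_leading (h : g ∈ leading φ d u) (h' : g ∈ leading φ d v) : u = v := by
  have h1 := h.2.symm.trans h'.2
  simpa using h1

theorem depth_t_zpow_mul (h : g ∉ leading φ d (-u)) :
    depth d (t ^ (u : ℤ) * g : HNNExtension A H K φ) = depth d g + 1 := by
  have h' : ¬ Cancels u (g • (empty : NormalWord d)) := by
    rwa [leading, neg_neg] at h
  rw [depth, mul_smul, t_pow_smul_eq_unitsSMul, unitsSMul, dif_neg h']
  simp [depth]

theorem of_mul_mem_leading_iff (hg : g ∈ leading φ d u) :
    of a * g ∈ leading φ d v ↔ v = u ∧ a ∈ toSubgroup H K (-u) := by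
  have h1 : of a * g ∈ leading φ d v ↔ a * (g • (empty : NormalWord d)).head ∈
      toSubgroup H K (-v) ∧ u = v := by
    change _ ∧ _ ↔ _
    rw [mul_smul, of_smul_eq_smul, group_smul_toList, hg.2, group_smul_head]
    simp
  rw [h1]
  constructor
  · rintro ⟨h2, rfl⟩
    exact ⟨rfl, (Subgroup.mul_mem_cancel_right _ hg.1).1 h2⟩
  · rintro ⟨rfl, h2⟩
    exact ⟨(Subgroup.mul_mem_cancel_right _ hg.1).2 h2, rfl⟩

/-- Every element is in the base group, or a reduced product that begins with `a * t ^ u`. -/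
theorem eq_of_or_exists_reduced (g : HNNExtension A H K φ) : (∃ a, g = of a) ∨
    ∃ (a : A) (u : ℤˣ) (g' : HNNExtension A H K φ), g' ∉ leading φ d (-u) ∧
      g = of a * (t ^ (u : ℤ) * g') := by
  have h1 : g = (g • (empty : NormalWord d)).prod φ := by simp
  generalize g • (empty : NormalWord d) = w at h1
  subst h1
  cases w using consRecOn with
  | ofGroup a => exact Or.inl ⟨a, by simp [ReducedWord.prod]⟩
  | cons a u w h1 h2 =>
    refine Or.inr ⟨a, u, w.prod φ, ?_, by simp⟩
    change ¬ Cancels (- -u) _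
    rw [prod_smul_empty, neg_neg]
    exact not_cancels_of_cons_hyp u w h2

/-- Induction on the number of letters `t`, `t⁻¹` in a reduced product. -/
theorem reduced_induction {motive : HNNExtension A H K φ → Prop} (d : TransversalPair A H K)
    (of : ∀ a, motive (of a))
    (cons : ∀ (a : A) (u : ℤˣ) (g : HNNExtension A H K φ), g ∉ leading φ d (-u) → motive g →
      motive (HNNExtension.of a * (t ^ (u : ℤ) * g))) (g : HNNExtension A H K φ) : motive g := by
  induction hn : depth d g using Nat.strong_induction_on generalizing g with
  | _ n ih =>
    rcases eq_of_or_exists_reduced (d := d) g with ⟨a, rfl⟩ | ⟨a, u, g', hg', rfl⟩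
    · exact of a
    · refine cons a u g' hg' (ih _ ?_ g' rfl)
      rw [← hn, depth_of_mul, depth_t_zpow_mul hg']
      omega

theorem mul_of_mem_leading_iff (b : A) (u : ℤˣ) :
    g * of b ∈ leading φ d u ↔ g ∈ leading φ d u := by
  induction g using reduced_induction (d := d) generalizing u with
  | of a =>
    rw [← map_mul]
    exact iff_of_false of_notMem_leading of_notMem_leading
  | cons a v g hg ih =>
    rw [mul_assoc, mul_assoc, of_mul_mem_leading_iff (t_zpow_mul_mem_leading_iff.2 hg),
      of_mul_mem_leading_iff (t_zpow_mul_mem_leading_iff.2 (by rwa [ih]))]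

theorem t_zpow_mul_of_mul_t_zpow {k : A} (hk : k ∈ toSubgroup H K u) :
    ∃ b, (t ^ (u : ℤ) * (of k * t ^ ((-u : ℤˣ) : ℤ)) : HNNExtension A H K φ) = of b := by
  rcases Int.units_eq_one_or u with rfl | rfl
  · refine ⟨φ ⟨k, hk⟩, ?_⟩
    rw [equiv_eq_conj]
    simp [mul_assoc]
  · refine ⟨φ.symm ⟨k, hk⟩, ?_⟩
    rw [equiv_symm_eq_conj]
    simp [mul_assoc]

/-- Right multiplication by `t ^ ε` takes only elements of the associated subgroup into the set of
elements that begin with `t ^ u`. -/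
theorem mem_of_mul_t_zpow_mem_leading {ε : ℤˣ} (hg : g ∉ leading φ d u)
    (hg' : g * t ^ (ε : ℤ) ∈ leading φ d u) : u = ε ∧ ∃ a ∈ toSubgroup H K (-u), g = of a := by
  induction g using reduced_induction (d := d) generalizing u with
  | of a =>
    have h1 := (of_mul_mem_leading_iff (g := t ^ (ε : ℤ)) (u := ε) (a := a) (v := u) (by
      have := t_zpow_mul_mem_leading_iff (d := d) (u := ε) (g := (1 : HNNExtension A H K φ))
      rw [mul_one] at this
      exact this.2 one_notMem_leading)).1 hg'
    obtain ⟨rfl, h2⟩ := h1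
    exact ⟨rfl, a, h2, rfl⟩
  | cons a v g hg'' ih =>
    exfalso
    rw [mul_assoc, mul_assoc] at hg'
    by_cases h1 : g * t ^ (ε : ℤ) ∈ leading φ d (-v)
    · obtain ⟨h2, k, hk, rfl⟩ := ih hg'' h1
      rw [neg_neg] at hk
      rw [← h2] at hg'
      obtain ⟨b, hb⟩ := t_zpow_mul_of_mul_t_zpow (φ := φ) hk
      rw [hb, ← map_mul] at hg'
      exact of_notMem_leading hg'
    · rw [of_mul_mem_leading_iff (t_zpow_mul_mem_leading_iff.2 h1)] at hg'
      rw [of_mul_mem_leading_iff (t_zpow_mul_mem_leading_iff.2 hg'')] at hg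
      exact hg hg'

/-- A right multiplication changes whether the normal form begins with `t` only for elements close
to `K`. -/
theorem isAlmostInvariant_leading (s : HNNExtension A H K φ) :
    IsAlmostInvariant ((of : A →* HNNExtension A H K φ).comp K.subtype) (leading φ d 1) s := by
  induction s using induction_on with
  | of a =>
    exact ⟨∅, Set.finite_empty, fun g hg => absurd (mul_of_mem_leading_iff a 1).symm hg⟩
  | t =>
    refine ⟨{1, t⁻¹}, Set.toFinite _, fun g hg => ?_⟩
    by_cases h1 : g ∈ leading φ d 1
    · have h2 : g * t ∉ leading φ d 1 := fun h => hg (iff_of_true h1 h)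
      have h3 := mem_of_mul_t_zpow_mem_leading (ε := -1) h2 (by simpa using h1)
      exact absurd h3.1 (by decide)
    · have h2 : g * t ∈ leading φ d 1 := by
        by_contra h
        exact hg (iff_of_false h1 h)
      obtain ⟨-, a, ha, rfl⟩ := mem_of_mul_t_zpow_mem_leading (ε := 1) h1 (by simpa using h2)
      exact ⟨⟨a, ha⟩, 1, by simp, by simp⟩
  | mul x y hx hy => exact hx.mul hy
  | inv x hx => exact hx.inv

theorem isDepthBounded_depth (s : HNNExtension A H K φ) :
    IsDepthBounded (depth d : HNNExtension A H K φ → ℕ) s := by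
  induction s using induction_on with
  | of a => exact ⟨0, fun g => by rw [depth_of_mul]; simp⟩
  | t =>
    refine ⟨1, fun g => ?_⟩
    by_cases h : g ∈ leading φ d (-1)
    · have h1 : t * g ∉ leading φ d 1 := by
        have := t_zpow_mul_mem_leading_iff (φ := φ) (d := d) (u := 1) (g := g)
        simpa using this.not.2 (not_not.2 h)
      have h2 := depth_t_zpow_mul (φ := φ) (d := d) (u := -1) (g := t * g) (by simpa using h1)
      simp at h2
      omega
    · have h2 := depth_t_zpow_mul (φ := φ) (d := d) (u := 1) (g := g) h
      simp at h2
      omega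
  | mul x y hx hy => exact hx.mul hy
  | inv x hx => exact hx.inv

theorem t_pow_leading (l : ℕ) : (t ^ l : HNNExtension A H K φ) ∉ leading φ d (-1) ∧
    depth d (t ^ l : HNNExtension A H K φ) = l ∧
    (1 ≤ l → (t ^ l : HNNExtension A H K φ) ∈ leading φ d 1) := by
  induction l with
  | zero =>
    refine ⟨by simpa using one_notMem_leading, ?_, by omega⟩
    simpa using depth_of (φ := φ) (d := d) (a := 1)
  | succ l ih =>
    have h1 : (t ^ (l + 1) : HNNExtension A H K φ) ∈ leading φ d 1 := by
      have := t_zpow_mul_mem_leading_iff (φ := φ) (d := d) (u := 1) (g := t ^ l)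
      simpa [pow_succ'] using this.2 ih.1
    refine ⟨fun h => absurd (eq_of_mem_leading h h1) (by decide), ?_, fun _ => h1⟩
    have := depth_t_zpow_mul (φ := φ) (d := d) (u := 1) ih.1
    simpa [pow_succ', ih.2.1] using this

/-- The dichotomy for the asymptotic cones of an HNN extension. The set of elements whose normal
form begins with `t`, up to an element of `K`, is a branch along `K`. For `v ∉ K`, the products
`(v t)ᵐ tˡ` with `m ≥ 1` are outside of it, since the leading `v` blocks cancellation. -/
theorem satisfiesConeDichotomy (hK : K ≠ ⊤) (hKp : IsPrairieGroup K)
    (hKq : IsQuasiIsometricallyEmbedded ((of : A →* HNNExtension A H K φ).comp K.subtype)) :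
    SatisfiesConeDichotomy (HNNExtension A H K φ) := by
  obtain ⟨d⟩ := TransversalPair.nonempty A H K
  obtain ⟨v, hv⟩ : ∃ v, v ∉ K := by
    by_contra! h
    exact hK ((Subgroup.eq_top_iff' K).2 h)
  have hx : ∀ (m l : ℕ), ((of v * t) ^ m * t ^ l : HNNExtension A H K φ) ∉ leading φ d (-1) ∧
      (1 ≤ m → ((of v * t) ^ m * t ^ l : HNNExtension A H K φ) ∉ leading φ d 1) := by
    intro m l
    induction m with
    | zero => exact ⟨by simpa using (t_pow_leading l).1, by omega⟩
    | succ m ih =>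
      have h1 : ∀ u, ((of v * t) ^ (m + 1) * t ^ l : HNNExtension A H K φ) ∉ leading φ d u := by
        intro u h
        have h2 := (t_zpow_mul_mem_leading_iff (φ := φ) (d := d) (u := 1)).2 ih.1
        have h3 := (of_mul_mem_leading_iff (a := v) (v := u) h2).1 (by
          simpa [pow_succ', mul_assoc] using h)
        exact hv h3.2
      exact ⟨h1 _, fun _ => h1 _⟩
  have hyk : ∀ (w : HNNExtension A H K φ), w ∉ leading φ d 1 → ∀ k : ℕ,
      (t ^ k)⁻¹ * w ∉ leading φ d 1 ∧ k ≤ depth d ((t ^ k)⁻¹ * w) := by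
    intro w hw k
    induction k with
    | zero => simpa using hw
    | succ k ih =>
      have h0 : (t ^ (k + 1))⁻¹ * w = t ^ ((-1 : ℤˣ) : ℤ) * ((t ^ k)⁻¹ * w) := by
        rw [pow_succ]
        simp [mul_assoc]
      rw [h0]
      have h1 := (t_zpow_mul_mem_leading_iff (φ := φ) (d := d) (u := -1)).2
        (by simpa using ih.1)
      refine ⟨fun h => absurd (eq_of_mem_leading h h1) (by decide), ?_⟩
      rw [depth_t_zpow_mul (by simpa using ih.1)]
      omega
  refine satisfiesConeDichotomy_of_branch _ hKp hKq (leading φ d 1) (depth d) (of v * t) t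
    (fun s => ?_) (fun s => ?_) (fun h g => depth_of_mul) (fun j hj => ?_) fun k m l _ hm _ => ?_
  · obtain ⟨F, hF, h⟩ := isAlmostInvariant_leading (d := d) s
    exact ⟨F, hF, fun g h1 h2 => h g fun h3 => h2 (h3.1 h1)⟩
  · obtain ⟨c, hc⟩ := isDepthBounded_depth (d := d) s
    exact ⟨c, fun g => (hc g).1⟩
  · exact ⟨(t_pow_leading j).2.2 hj, (t_pow_leading j).2.1.ge⟩
  · rw [mul_assoc]
    exact hyk _ ((hx m l).2 hm) k

end HNNExtension

/-! ### The branch of an amalgamated product -/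

namespace Monoid.PushoutI

open NormalWord

variable {ι : Type*} [DecidableEq ι] {A : ι → Type*} [∀ i, Group (A i)] [∀ i, DecidableEq (A i)]
  {H : Type*} [Group H] {φ : ∀ i, H →* A i}
  (d : NormalWord.Transversal φ)

/-- The elements whose normal form begins with a letter in the factor `A i`. -/
def leading (i : ι) : Set (PushoutI φ) :=
  {g | (g • (empty : NormalWord d)).fstIdx = some i}

/-- The number of letters of the normal form. -/
noncomputable def depth (g : PushoutI φ) : ℕ :=
  (g • (empty : NormalWord d)).toList.length

variable {d} {g : PushoutI φ} {i j k : ι} {a b : A i} {h : H}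

theorem base_mul_mem_leading_iff : base φ h * g ∈ leading d i ↔ g ∈ leading d i := by
  change Option.map _ _ = _ ↔ Option.map _ _ = _
  rw [mul_smul, base_smul_def]

theorem depth_base_mul : depth d (base φ h * g) = depth d g := by
  rw [depth, mul_smul, base_smul_def, depth]

theorem one_notMem_leading : (1 : PushoutI φ) ∉ leading d i := by
  intro h
  change Option.map _ _ = _ at h
  rw [one_smul] at h
  simp at h

theorem depth_one : depth d (1 : PushoutI φ) = 0 := by
  rw [depth, one_smul]
  simp

theorem base_notMem_leading : base φ h ∉ leading d i := by
  rw [← mul_one (base φ h), base_mul_mem_leading_iff]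
  exact one_notMem_leading

theorem eq_of_mem_leading (h : g ∈ leading d i) (h' : g ∈ leading d j) : i = j :=
  Option.some_injective _ (h.symm.trans h')

theorem map_fst_toList_of_mul (ha : a ∉ (φ i).range) (hg : g ∉ leading d i) :
    ((of i a * g) • (empty : NormalWord d)).toList.map Sigma.fst =
      i :: (g • (empty : NormalWord d)).toList.map Sigma.fst := by
  have hg' : (g • (empty : NormalWord d)).fstIdx ≠ some i := hg
  rw [mul_smul, ← cons_eq_smul a _ hg' ha]
  simp

theorem of_mul_mem_leading (ha : a ∉ (φ i).range) (hg : g ∉ leading d i) :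
    of i a * g ∈ leading d i := by
  change Option.map _ _ = _
  rw [← List.head?_map, map_fst_toList_of_mul ha hg, List.head?_cons]

theorem depth_of_mul (ha : a ∉ (φ i).range) (hg : g ∉ leading d i) :
    depth d (of i a * g) = depth d g + 1 := by
  have h := congrArg List.length (map_fst_toList_of_mul ha hg)
  simpa [depth] using h

/-- Induction on the number of letters of a reduced product. -/
theorem reduced_induction {motive : PushoutI φ → Prop} (d : NormalWord.Transversal φ)
    (base : ∀ h, motive (base φ h))
    (cons : ∀ (i : ι) (a : A i) (g : PushoutI φ), a ∉ (φ i).range → g ∉ leading d i → motive g →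
      motive (of i a * g)) (g : PushoutI φ) : motive g := by
  have key : ∀ w : NormalWord d, ∀ h, motive (Monoid.PushoutI.base φ h * w.prod) := by
    intro w
    induction w using consRecOn with
    | empty => intro h; simpa using base h
    | cons i a w hw _ ha _ ih =>
      intro h
      rw [prod_cons, ← mul_assoc, ← of_apply_eq_base φ i, ← map_mul]
      refine cons i _ _ ?_ ?_ (by simpa using ih 1)
      · rwa [Subgroup.mul_mem_cancel_left _ (MonoidHom.mem_range.2 ⟨h, rfl⟩)]
      · change ¬ _ = _
        rwa [prod_smul_empty]
    | base h' w _ ih =>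
      intro h
      rw [base_smul_eq_smul, prod_base_smul, ← mul_assoc, ← map_mul]
      exact ih _
  have := key (g • empty) 1
  simpa using this

theorem of_mem_leading (h : (of i a : PushoutI φ) ∈ leading d j) : i = j := by
  by_cases ha : a ∈ (φ i).range
  · obtain ⟨h', rfl⟩ := ha
    rw [of_apply_eq_base] at h
    exact absurd h base_notMem_leading
  · have h1 := of_mul_mem_leading (d := d) ha one_notMem_leading
    rw [mul_one] at h1
    exact eq_of_mem_leading h1 h

/-- Right multiplication by a letter takes only elements of the base group into the set of
elements that begin with a letter in `A i`. -/
theorem mem_base_of_mul_of_mem_leading {b : A j} (hg : g ∉ leading d i)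
    (hg' : g * of j b ∈ leading d i) : ∃ h, g = base φ h := by
  induction g using reduced_induction (d := d) generalizing i with
  | base h => exact ⟨h, rfl⟩
  | cons k a g ha hgk ih =>
    exfalso
    have hk := of_mul_mem_leading ha hgk
    have hki : k ≠ i := by
      rintro rfl
      exact hg hk
    rw [mul_assoc] at hg'
    by_cases h1 : g * of j b ∈ leading d k
    · obtain ⟨h, rfl⟩ := ih hgk h1
      rw [base_mul_mem_leading_iff] at h1
      obtain rfl := of_mem_leading h1
      rw [← of_apply_eq_base φ j, ← map_mul, ← map_mul] at hg'
      exact hki (of_mem_leading hg')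
    · exact hki (eq_of_mem_leading (of_mul_mem_leading ha h1) hg')

theorem isAlmostInvariant_leading (d : NormalWord.Transversal φ) (i : ι) (s : PushoutI φ) :
    IsAlmostInvariant (base φ) (leading d i) s := by
  have key : ∀ (j : ι) (b : A j), IsAlmostInvariant (base φ) (leading d i) (of j b) := by
    intro j b
    refine ⟨{1, of j b⁻¹}, Set.toFinite _, fun g hg => ?_⟩
    by_cases h1 : g ∈ leading d i
    · have h2 : g * of j b ∉ leading d i := fun h => hg (iff_of_true h1 h)
      obtain ⟨h, hh⟩ := mem_base_of_mul_of_mem_leading (b := b⁻¹) h2 (by simpa [mul_assoc] using h1)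
      exact ⟨h, _, Or.inr rfl, by rw [← hh]; simp [mul_assoc]⟩
    · have h2 : g * of j b ∈ leading d i := by
        by_contra h
        exact hg (iff_of_false h1 h)
      obtain ⟨h, rfl⟩ := mem_base_of_mul_of_mem_leading h1 h2
      exact ⟨h, 1, by simp, by simp⟩
  induction s using induction_on with
  | of j b => exact key j b
  | base h =>
    rw [← of_apply_eq_base φ i]
    exact key i _
  | mul x y hx hy => exact hx.mul hy

theorem isDepthBounded_depth (d : NormalWord.Transversal φ) (s : PushoutI φ) :
    IsDepthBounded (depth d) s := by
  induction s using induction_on with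
  | of j b =>
    refine ⟨1, fun g => ?_⟩
    by_cases hb : b ∈ (φ j).range
    · obtain ⟨h, rfl⟩ := hb
      rw [of_apply_eq_base, depth_base_mul]
      omega
    by_cases hg : g ∈ leading d j
    · induction g using reduced_induction (d := d) with
      | base h => exact absurd hg base_notMem_leading
      | cons k a g ha hgk _ =>
        obtain rfl := eq_of_mem_leading (of_mul_mem_leading ha hgk) hg
        rw [depth_of_mul ha hgk, ← mul_assoc, ← map_mul]
        by_cases hba : b * a ∈ (φ k).range
        · obtain ⟨h, hh⟩ := hba
          rw [← hh, of_apply_eq_base, depth_base_mul]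
          omega
        · rw [depth_of_mul hba hgk]
          omega
    · rw [depth_of_mul hb hg]
      omega
  | base h => exact ⟨0, fun g => by rw [depth_base_mul]; omega⟩
  | mul x y hx hy => exact hx.mul hy

/-- The dichotomy for the asymptotic cones of an amalgamated product over a subgroup whose index in
one of the factors is at least three. The elements whose normal form begins with a letter in `A i`
are a branch, with `x = a b` and `y = a' b`: as `a'⁻¹ a` is not in the edge group, there is no
further cancellation in `y⁻ᵏ xᵐ yˡ`, which begins with `b⁻¹`. -/
theorem satisfiesConeDichotomy_of_index (hφ : ∀ i, Function.Injective (φ i))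
    (hH : IsPrairieGroup H) (hq : IsQuasiIsometricallyEmbedded (base φ)) (hij : i ≠ j)
    {a a' : A i} (ha : a ∉ (φ i).range) (ha' : a' ∉ (φ i).range)
    (haa : a'⁻¹ * a ∉ (φ i).range) {b : A j} (hb : b ∉ (φ j).range) :
    SatisfiesConeDichotomy (PushoutI φ) := by
  obtain ⟨d⟩ := transversal_nonempty φ hφ
  have hnot : ∀ {g : PushoutI φ}, g ∈ leading d i → g ∉ leading d j :=
    fun h h' => hij (eq_of_mem_leading h h')
  have hnot' : ∀ {g : PushoutI φ}, g ∈ leading d j → g ∉ leading d i :=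
    fun h h' => hij (eq_of_mem_leading h' h)
  have hinv : ∀ {k : ι} {c : A k}, c ∉ (φ k).range → c⁻¹ ∉ (φ k).range :=
    fun h => by rwa [inv_mem_iff]
  have hab : ∀ {c : A i}, c ∉ (φ i).range → ∀ {g : PushoutI φ}, g ∉ leading d j →
      of i c * of j b * g ∈ leading d i ∧ depth d (of i c * of j b * g) = depth d g + 2 := by
    intro c hc g hg
    have h1 := of_mul_mem_leading hb hg
    rw [mul_assoc, depth_of_mul hc (hnot' h1), depth_of_mul hb hg]
    exact ⟨of_mul_mem_leading hc (hnot' h1), rfl⟩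
  have hy : ∀ l : ℕ, (of i a' * of j b : PushoutI φ) ^ l ∉ leading d j ∧
      depth d ((of i a' * of j b : PushoutI φ) ^ l) = 2 * l ∧
      (1 ≤ l → (of i a' * of j b : PushoutI φ) ^ l ∈ leading d i) := by
    intro l
    induction l with
    | zero =>
      rw [pow_zero]
      exact ⟨one_notMem_leading, depth_one, by omega⟩
    | succ l ih =>
      rw [pow_succ']
      obtain ⟨h1, h2⟩ := hab ha' ih.1
      exact ⟨hnot h1, by rw [h2, ih.2.1]; ring, fun _ => h1⟩
  have hx : ∀ m l : ℕ,
      (of i a * of j b : PushoutI φ) ^ m * (of i a' * of j b) ^ l ∉ leading d j := by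
    intro m l
    induction m with
    | zero => simpa using (hy l).1
    | succ m ih =>
      rw [pow_succ', mul_assoc]
      exact hnot (hab ha ih).1
  have hyk : ∀ (m l k : ℕ), ((of i a' * of j b : PushoutI φ) ^ (k + 1))⁻¹ *
      ((of i a * of j b) ^ (m + 1) * (of i a' * of j b) ^ l) ∈ leading d j ∧
      k + 1 ≤ depth d (((of i a' * of j b : PushoutI φ) ^ (k + 1))⁻¹ *
        ((of i a * of j b) ^ (m + 1) * (of i a' * of j b) ^ l)) := by
    intro m l k
    induction k with
    | zero =>
      have h1 := of_mul_mem_leading hb (hx m l)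
      have h2 := of_mul_mem_leading haa (hnot' h1)
      have h3 : ((of i a' * of j b : PushoutI φ) ^ (0 + 1))⁻¹ *
          ((of i a * of j b) ^ (m + 1) * (of i a' * of j b) ^ l) =
          of j b⁻¹ * (of i (a'⁻¹ * a) *
            (of j b * ((of i a * of j b) ^ m * (of i a' * of j b) ^ l))) := by
        rw [pow_succ' (of i a * of j b)]
        simp [mul_assoc]
      rw [h3, depth_of_mul (hinv hb) (hnot h2)]
      exact ⟨of_mul_mem_leading (hinv hb) (hnot h2), by omega⟩
    | succ k ih =>
      have h1 := of_mul_mem_leading (hinv ha') (hnot' ih.1)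
      have h3 : ((of i a' * of j b : PushoutI φ) ^ (k + 1 + 1))⁻¹ *
          ((of i a * of j b) ^ (m + 1) * (of i a' * of j b) ^ l) =
          of j b⁻¹ * (of i a'⁻¹ * (((of i a' * of j b : PushoutI φ) ^ (k + 1))⁻¹ *
            ((of i a * of j b) ^ (m + 1) * (of i a' * of j b) ^ l))) := by
        rw [pow_succ (of i a' * of j b) (k + 1)]
        simp [mul_assoc]
      rw [h3, depth_of_mul (hinv hb) (hnot h1), depth_of_mul (hinv ha') (hnot' ih.1)]
      exact ⟨of_mul_mem_leading (hinv hb) (hnot h1), by omega⟩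
  refine satisfiesConeDichotomy_of_branch _ hH hq (leading d i) (depth d) (of i a * of j b)
    (of i a' * of j b) (fun s => ?_) (fun s => ?_) (fun h g => depth_base_mul) (fun l hl => ?_)
    fun k m l hk hm _ => ?_
  · obtain ⟨F, hF, h⟩ := isAlmostInvariant_leading d i s
    exact ⟨F, hF, fun g h1 h2 => h g fun h3 => h2 (h3.1 h1)⟩
  · obtain ⟨c, hc⟩ := isDepthBounded_depth d s
    exact ⟨c, fun g => (hc g).1⟩
  · exact ⟨(hy l).2.2 hl, by rw [(hy l).2.1]; omega⟩
  · obtain ⟨k, rfl⟩ := Nat.exists_eq_add_of_le' hk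
    obtain ⟨m, rfl⟩ := Nat.exists_eq_add_of_le' hm
    rw [mul_assoc]
    exact ⟨hnot' (hyk m l k).1, (hyk m l k).2⟩

end Monoid.PushoutI

/-! ### Spaces that are foliated by simply connected levels -/

/-- The space `X` is foliated by bi-Lipschitz copies `ι c` of `Y`, the levels of the function
`lev`, and the distance of a point to a level is controlled by the difference of the levels. -/
structure IsFoliated {X Y : Type*} [PseudoMetricSpace X] [PseudoMetricSpace Y] (lev : X → ℝ)
    (ι : ℝ → Y → X) (L K : ℝ) : Prop where
  pos : 0 < L
  nonneg : 0 ≤ K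
  continuous : Continuous lev
  dist_le : ∀ c y z, dist (ι c y) (ι c z) ≤ L * dist y z
  le_dist : ∀ c y z, dist y z ≤ L * dist (ι c y) (ι c z)
  lev_eq : ∀ c y, lev (ι c y) = c
  exists_dist_le : ∀ x c, ∃ y, dist x (ι c y) ≤ K * |lev x - c|

namespace IsFoliated

variable {X Y : Type*} [PseudoMetricSpace X] [PseudoMetricSpace Y] {lev : X → ℝ} {ι : ℝ → Y → X}
  {L K C : ℝ}

/-- A map whose values are close to a level can be projected to the level and extended. -/
theorem exists_extension (h : IsFoliated lev ι L K) (hY : UniformExtension Y C)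
    {A : Set (ℝ × ℝ)} (hA : A ⊆ unitSq) (hAc : IsClosed A) (g : ℝ × ℝ → X) {c r : ℝ} (hr : 0 ≤ r)
    (hg : ∀ p ∈ A, |lev (g p) - c| ≤ r) :
    ∃ E : ℝ × ℝ → X, (∀ p, lev (E p) = c) ∧ (∀ p ∈ A, dist (g p) (E p) ≤ K * r) ∧
      ∀ η > 0, EpsContOn η g A → EpsContOn (L * (C * (L * (2 * (K * r) + η)))) E unitSq := by
  choose π hπ using fun x => h.exists_dist_le x c
  have hπA : ∀ p ∈ A, dist (g p) (ι c (π (g p))) ≤ K * r := fun p hp =>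
    (hπ _).trans (mul_le_mul_of_nonneg_left (hg p hp) h.nonneg)
  obtain ⟨E, hEA, hE⟩ := hY.2 A hA hAc fun p => π (g p)
  have hK0 := h.nonneg
  have hL0 := h.pos
  refine ⟨fun p => ι c (E p), fun p => h.lev_eq c _, fun p hp => ?_, fun η hη hgη => ?_⟩
  · have h1 : E p = π (g p) := hEA hp
    simp only [h1]
    exact hπA p hp
  · have h1 : EpsContOn (L * (2 * (K * r) + η)) (fun p => π (g p)) A := by
      intro p hp
      filter_upwards [hgη p hp, self_mem_nhdsWithin] with q hq hqA
      refine (h.le_dist c _ _).trans (mul_le_mul_of_nonneg_left ?_ hL0.le)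
      have h2 := hπA p hp
      have h3 := hπA q hqA
      have h4 := dist_triangle4 (ι c (π (g q))) (g q) (g p) (ι c (π (g p)))
      rw [dist_comm] at h3
      linarith
    have h2 := hE _ (by positivity) h1
    intro p hp
    filter_upwards [h2 p hp] with q hq
    exact (h.dist_le c _ _).trans (mul_le_mul_of_nonneg_left hq hL0.le)

end IsFoliated

/-- Near `x`, the floor function takes only the values `⌈x⌉ - 1` and `⌊x⌋`. -/
theorem eventually_floor_mem (x : ℝ) : ∀ᶠ y in 𝓝 x, ⌊y⌋ ∈ Set.Icc (⌈x⌉ - 1) ⌊x⌋ := by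
  have h1 : (⌈x⌉ - 1 : ℝ) < x := by linarith [Int.ceil_lt_add_one x]
  filter_upwards [lt_mem_nhds h1, gt_mem_nhds (Int.lt_floor_add_one x)] with y h2 h3
  refine ⟨Int.le_floor.2 (by push_cast; exact h2.le), ?_⟩
  rw [← Int.lt_add_one_iff, Int.floor_lt]
  push_cast
  exact h3

/-- In a space foliated by levels with the extension property, the boundary of the square can be
filled almost continuously. The levels of the values on the boundary extend to a function `Φ` on the
square. The level sets of `Φ` at the multiples of a small number are mapped to the corresponding
levels of the space, and the slabs in between to one of the two neighbouring levels. -/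
theorem IsFoliated.almostFillable {X Y : Type*} [PseudoMetricSpace X] [PseudoMetricSpace Y]
    {lev : X → ℝ} {ι : ℝ → Y → X} {L K C : ℝ} (h : IsFoliated lev ι L K)
    (hY : UniformExtension Y C) : AlmostFillable X := by
  classical
  intro ε hε b hb
  have hK0 := h.nonneg
  have hL0 := h.pos
  have hC0 : 0 < C := by linarith [hY.1]
  -- the distance `σ` of the levels
  set M : ℝ := L * (C * (L * (2 * K + 1))) + K + 1 with hM
  have hM0 : 0 < M := by positivity
  obtain ⟨σ, hσ, hσM⟩ : ∃ σ > 0, M * σ = ε := ⟨ε / M, by positivity, mul_div_cancel₀ _ hM0.ne'⟩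
  -- the extension of the level function
  obtain ⟨Φ, hΦ⟩ : ∃ Φ : C(ℝ × ℝ, ℝ), ∀ p ∈ sqBoundary, Φ p = lev (b p) := by
    obtain ⟨Φ, hΦ⟩ := ContinuousMap.exists_restrict_eq isClosed_sqBoundary
      (⟨fun p : sqBoundary => lev (b p), h.continuous.comp hb.domRestrict⟩ : C(sqBoundary, ℝ))
    exact ⟨Φ, fun p hp => congrArg (fun f : C(sqBoundary, ℝ) => f ⟨p, hp⟩) hΦ⟩
  have hΨ : Continuous fun p => Φ p / σ := Φ.continuous.div_const σ
  -- the maps on the level sets of `Φ`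
  have hE : ∀ j : ℤ, ∃ E : ℝ × ℝ → X, (∀ p, lev (E p) = j * σ) ∧ ContinuousOn E unitSq ∧
      ∀ p ∈ sqBoundary, Φ p = j * σ → dist (b p) (E p) = 0 := by
    intro j
    obtain ⟨E, h1, h2, h3⟩ := h.exists_extension hY (A := sqBoundary ∩ {p | Φ p = j * σ})
      (Set.inter_subset_left.trans sqBoundary_subset)
      (isClosed_sqBoundary.inter (isClosed_eq Φ.continuous continuous_const)) b (c := j * σ) le_rfl
      fun p hp => by rw [← hΦ p hp.1, hp.2, sub_self, abs_zero]
    refine ⟨E, h1, continuousOn_of_epsContOn fun η hη => ?_, fun p hp hpj => ?_⟩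
    · have h4 := h3 (η / (L * (C * L))) (by positivity)
        ((hb.mono Set.inter_subset_left).epsContOn (by positivity))
      have h5 : L * (C * (L * (2 * (K * 0) + η / (L * (C * L))))) = η := by
        field_simp
        ring
      rwa [h5] at h4
    · refine le_antisymm ?_ dist_nonneg
      simpa using h2 p ⟨hp, hpj⟩
  choose E hElev hEc hEb using hE
  set A : Set (ℝ × ℝ) := sqBoundary ∪ {p ∈ unitSq | ∃ j : ℤ, Φ p / σ = j} with hA
  have hAQ : A ⊆ unitSq := Set.union_subset sqBoundary_subset fun p hp => hp.1
  have hAc : IsClosed A := by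
    refine isClosed_sqBoundary.union (isClosed_unitSq.inter ?_)
    have h1 : IsClosed (Set.range ((↑) : ℤ → ℝ)) := Int.isClosedEmbedding_coe_real.isClosed_range
    have h2 : {p : ℝ × ℝ | ∃ j : ℤ, Φ p / σ = j} =
        (fun p => Φ p / σ) ⁻¹' Set.range ((↑) : ℤ → ℝ) := by
      ext p; simp [eq_comm]
    change IsClosed {p : ℝ × ℝ | ∃ j : ℤ, Φ p / σ = j}
    rw [h2]
    exact h1.preimage hΨ
  set g' : ℝ × ℝ → X := fun p => if p ∈ sqBoundary then b p else E (round (Φ p / σ)) p with hg'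
  have hg'lev : ∀ p ∈ A, lev (g' p) = Φ p := by
    rintro p hp
    simp only [hg']
    split_ifs with hpb
    · exact (hΦ p hpb).symm
    · obtain ⟨-, j, hj⟩ := hp.resolve_left hpb
      rw [hElev, hj, round_intCast, ← hj, div_mul_cancel₀ _ hσ.ne']
  have hg'c : ∀ η > 0, EpsContOn η g' A := by
    intro η hη p hp
    set j := round (Φ p / σ) with hj
    have hbj : EpsContOn η b sqBoundary := hb.epsContOn hη
    -- near `p`, the set consists of the boundary and of one level set
    have hnear : ∀ᶠ q in 𝓝[A] p, q ∈ sqBoundary ∨ q ∈ unitSq ∧ Φ q / σ = j := by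
      have h1 : ∀ᶠ q in 𝓝 p, |Φ q / σ - Φ p / σ| < 1 / 2 := by
        have := Metric.tendsto_nhds.1 (hΨ.tendsto p) (1 / 2) (by norm_num)
        simpa [Real.dist_eq] using this
      filter_upwards [self_mem_nhdsWithin, mem_nhdsWithin_of_mem_nhds h1] with q hq hqp
      rcases hq with hq | ⟨hq, k, hk⟩
      · exact Or.inl hq
      · refine Or.inr ⟨hq, ?_⟩
        rw [hk] at hqp ⊢
        have h2 := abs_sub_round (Φ p / σ)
        have h3 : |((k - j : ℤ) : ℝ)| < 1 := by
          push_cast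
          calc |(k : ℝ) - j| ≤ |k - Φ p / σ| + |Φ p / σ - j| := abs_sub_le _ _ _
            _ < 1 := by linarith
        have h4 : |k - j| < 1 := by exact_mod_cast h3
        have h5 : k = j := by have := Int.abs_lt_one_iff.1 h4; omega
        rw [h5]
    set B : Set (ℝ × ℝ) := {q ∈ unitSq | Φ q / σ = j} with hB
    have hBc : IsClosed B := isClosed_unitSq.inter (isClosed_eq hΨ continuous_const)
    have hcont : ∀ q ∈ sqBoundary ∪ B, ∀ᶠ r in 𝓝[sqBoundary ∪ B] q, dist (g' r) (g' q) ≤ η := by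
      have hval : ∀ q ∈ B, dist (g' q) (E j q) = 0 := by
        intro q hq
        simp only [hg']
        split_ifs with hqb
        · refine hEb j q hqb ?_
          rw [← hq.2, div_mul_cancel₀ _ hσ.ne']
        · rw [hq.2, round_intCast, dist_self]
      have h1 : EpsContOn η g' sqBoundary := by
        intro q hq
        filter_upwards [hbj q hq, self_mem_nhdsWithin] with r hr hrb
        simpa only [hg', if_pos hq, if_pos hrb] using hr
      have h2 : EpsContOn η g' B := by
        intro q hq
        filter_upwards [((hEc j).mono fun r (hr : r ∈ B) => hr.1).epsContOn hη q hq,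
          self_mem_nhdsWithin] with r hr hrB
        have h3 := dist_triangle4 (g' r) (E j r) (E j q) (g' q)
        rw [hval r hrB, dist_comm (E j q), hval q hq] at h3
        linarith
      intro q hq
      rw [nhdsWithin_union, eventually_sup]
      constructor
      · by_cases hqb : q ∈ sqBoundary
        · exact h1 q hqb
        · have : 𝓝[sqBoundary] q = ⊥ := by
            rw [← notMem_closure_iff_nhdsWithin_eq_bot, isClosed_sqBoundary.closure_eq]
            exact hqb
          rw [this]; exact eventually_bot
      · by_cases hqB : q ∈ B
        · exact h2 q hqB
        · have : 𝓝[B] q = ⊥ := by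
            rw [← notMem_closure_iff_nhdsWithin_eq_bot, hBc.closure_eq]
            exact hqB
          rw [this]; exact eventually_bot
    have hpB : p ∈ sqBoundary ∪ B := by
      rcases hp with hp | ⟨hp, k, hk⟩
      · exact Or.inl hp
      · refine Or.inr ⟨hp, ?_⟩
        rw [hj, hk, round_intCast]
    have h6 := eventually_nhdsWithin_iff.1 (hcont p hpB)
    filter_upwards [mem_nhdsWithin_of_mem_nhds h6, hnear] with q hq hqn using hq hqn
  -- the maps on the slabs
  have hD : ∀ k : ℤ, ∃ D : ℝ × ℝ → X, EpsContOn (L * (C * (L * (2 * (K * σ) + σ)))) D unitSq ∧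
      ∀ p ∈ A, Φ p / σ ∈ Set.Icc (k : ℝ) (k + 1) → dist (g' p) (D p) ≤ K * σ := by
    intro k
    have hsub : A ∩ {p | Φ p / σ ∈ Set.Icc (k : ℝ) (k + 1)} ⊆ A := Set.inter_subset_left
    obtain ⟨D, -, h2, h3⟩ := h.exists_extension hY
      (A := A ∩ {p | Φ p / σ ∈ Set.Icc (k : ℝ) (k + 1)})
      (hsub.trans hAQ) (hAc.inter (isClosed_Icc.preimage hΨ)) g' (c := k * σ) hσ.le fun p hp => by
        have h4 : (k : ℝ) ≤ Φ p / σ := hp.2.1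
        have h5 : Φ p / σ ≤ k + 1 := hp.2.2
        rw [le_div_iff₀ hσ] at h4
        rw [div_le_iff₀ hσ] at h5
        rw [hg'lev p hp.1, abs_le]
        constructor <;> linarith
    exact ⟨D, h3 σ hσ ((hg'c σ hσ).mono hsub), fun p hp hpk => h2 p ⟨hp, hpk⟩⟩
  choose D hDc hDg using hD
  refine ⟨fun p => if p ∈ A then g' p else D ⌊Φ p / σ⌋ p, ?_, fun p hp => ?_⟩
  · intro p hp
    set x := Φ p / σ with hx
    have hfloor : ∀ᶠ q in 𝓝[unitSq] p, ⌊Φ q / σ⌋ ∈ Set.Icc (⌈x⌉ - 1) ⌊x⌋ :=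
      mem_nhdsWithin_of_mem_nhds (hΨ.tendsto p (eventually_floor_mem x))
    have hDall : ∀ᶠ q in 𝓝[unitSq] p, ∀ k ∈ Set.Icc (⌈x⌉ - 1) ⌊x⌋,
        dist (D k q) (D k p) ≤ L * (C * (L * (2 * (K * σ) + σ))) := by
      rw [Filter.eventually_all_finite (Set.finite_Icc _ _)]
      exact fun k _ => hDc k p hp
    have hMσ : L * (C * (L * (2 * (K * σ) + σ))) + K * σ + σ = ε := by rw [← hσM, hM]; ring
    have hKσ : 0 ≤ K * σ := by positivity
    by_cases hpA : p ∈ A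
    · have hA' : ∀ᶠ q in 𝓝[unitSq] p, q ∈ A → dist (g' q) (g' p) ≤ σ :=
        mem_nhdsWithin_of_mem_nhds (eventually_nhdsWithin_iff.1 (hg'c σ hσ p hpA))
      filter_upwards [hfloor, hDall, hA'] with q h1 h2 h3
      simp only [if_pos hpA]
      split_ifs with hqA
      · have h4 : 0 ≤ L * (C * (L * (2 * (K * σ) + σ))) := by positivity
        linarith [h3 hqA]
      · have h4 := h2 _ h1
        have h5 := hDg ⌊Φ q / σ⌋ p hpA ⟨?_, ?_⟩
        · rw [dist_comm] at h5
          linarith [dist_triangle (D ⌊Φ q / σ⌋ q) (D ⌊Φ q / σ⌋ p) (g' p)]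
        · exact Int.le_floor.1 h1.2
        · have h6 : ⌈x⌉ ≤ ⌊Φ q / σ⌋ + 1 := by have := h1.1; omega
          have h7 := Int.ceil_le.1 h6
          push_cast at h7
          exact h7
    · filter_upwards [hfloor, hDall, mem_nhdsWithin_of_mem_nhds (hAc.isOpen_compl.mem_nhds hpA)]
        with q h1 h2 h3
      simp only [if_neg hpA]
      rw [if_neg h3]
      -- `Φ p / σ` is not an integer, so that nearby points are in the same slab
      have h4 : ⌈x⌉ - 1 = ⌊x⌋ := by
        have h5 : (⌊x⌋ : ℝ) < x := lt_of_le_of_ne (Int.floor_le x) fun h =>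
          hpA (Or.inr ⟨hp, ⌊x⌋, h.symm⟩)
        have h6 : ⌊x⌋ < ⌈x⌉ := Int.lt_ceil.2 h5
        have h7 := Int.ceil_le_floor_add_one x
        omega
      rw [h4, Set.Icc_self, Set.mem_singleton_iff] at h1
      have h5 := h2 ⌊x⌋ (by rw [h4]; simp)
      rw [h1]
      linarith
  · simp only [hg', if_pos hp, if_pos (show p ∈ A from Or.inl hp)]

/-! ### Groups with a level function -/

section ConeLevel

variable {X : Type*} [PseudoMetricSpace X] {ω : Ultrafilter ℕ} {e : ℕ → X} {d : ℕ → ℝ}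
  {hd : Tendsto d ω atTop} {F : X → ℤ} {Λ : ℝ}

/-- The rescaled limit of a coarsely Lipschitz function, normalized to vanish on the observation
sequence. -/
noncomputable def coneLevel (F : X → ℤ) (p : AsymptoticCone X ω e d hd) : ℝ :=
  limUnder (ω : Filter ℕ) fun n => ((F ((AsymptoticCone.rep p).1 n) : ℝ) - F (e n)) / d n

theorem tendsto_coneLevel_rep (hF : ∀ a b, |(F a : ℝ) - F b| ≤ Λ * dist a b)
    (p : AsymptoticCone X ω e d hd) :
    Tendsto (fun n => ((F ((AsymptoticCone.rep p).1 n) : ℝ) - F (e n)) / d n) ω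
      (𝓝 (coneLevel F p)) := by
  set w := AsymptoticCone.rep p with hw
  obtain ⟨M, hM⟩ := w.2
  have hmem : ∀ᶠ n in (ω : Filter ℕ),
      ((F (w.1 n) : ℝ) - F (e n)) / d n ∈ Set.Icc (-(|Λ| * M)) (|Λ| * M) := by
    filter_upwards [hM, hd.eventually_gt_atTop 0] with n h1 h2
    rw [Set.mem_Icc, ← abs_le, abs_div, abs_of_pos h2]
    calc |(F (w.1 n) : ℝ) - F (e n)| / d n ≤ |Λ| * dist (w.1 n) (e n) / d n := by
          gcongr
          exact (hF _ _).trans (mul_le_mul_of_nonneg_right (le_abs_self _) dist_nonneg)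
      _ ≤ |Λ| * M := by
          rw [mul_div_assoc]
          gcongr
  obtain ⟨a, -, ha⟩ := (isCompact_Icc (a := -(|Λ| * M)) (b := |Λ| * M)).ultrafilter_le_nhds
    (ω.map fun n => ((F (w.1 n) : ℝ) - F (e n)) / d n) (le_principal_iff.mpr hmem)
  have ha' : Tendsto (fun n => ((F (w.1 n) : ℝ) - F (e n)) / d n) ω (𝓝 a) := ha
  exact tendsto_nhds_limUnder ⟨a, ha'⟩

theorem tendsto_coneLevel_mk (hF : ∀ a b, |(F a : ℝ) - F b| ≤ Λ * dist a b)
    (w : ConeSequence X ω e d hd) :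
    Tendsto (fun n => ((F (w.1 n) : ℝ) - F (e n)) / d n) ω
      (𝓝 (coneLevel F (SeparationQuotient.mk w : AsymptoticCone X ω e d hd))) := by
  set v := AsymptoticCone.rep (SeparationQuotient.mk w : AsymptoticCone X ω e d hd) with hv
  have h0 : dist w v = 0 := ConeSequence.mk_eq_mk.1 (AsymptoticCone.mk_rep _).symm
  have h1 : Tendsto (fun n => ((F (w.1 n) : ℝ) - F (v.1 n)) / d n) ω (𝓝 0) := by
    have h2 : Tendsto (fun n => Λ * (dist (w.1 n) (v.1 n) / d n)) ω (𝓝 0) := by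
      have := (ConeSequence.tendsto_dist w v).const_mul Λ
      rwa [h0, mul_zero] at this
    refine squeeze_zero_norm' ?_ h2
    filter_upwards [hd.eventually_gt_atTop 0] with n hn
    rw [Real.norm_eq_abs, abs_div, abs_of_pos hn, ← mul_div_assoc]
    gcongr
    exact hF _ _
  have h3 := h1.add (tendsto_coneLevel_rep hF (SeparationQuotient.mk w))
  rw [zero_add] at h3
  refine h3.congr fun n => ?_
  rw [← add_div, sub_add_sub_cancel]

theorem continuous_coneLevel (hΛ : 0 ≤ Λ) (hF : ∀ a b, |(F a : ℝ) - F b| ≤ Λ * dist a b) :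
    Continuous (coneLevel F : AsymptoticCone X ω e d hd → ℝ) := by
  refine (LipschitzWith.of_dist_le_mul (K := ⟨Λ, hΛ⟩) fun p q => ?_).continuous
  have h1 := ((tendsto_coneLevel_rep hF p).sub (tendsto_coneLevel_rep hF q)).abs
  have h2 := (ConeSequence.tendsto_dist (AsymptoticCone.rep p) (AsymptoticCone.rep q)).const_mul Λ
  rw [AsymptoticCone.dist_rep] at h2
  refine le_of_tendsto_of_tendsto h1 h2 ?_
  filter_upwards [hd.eventually_gt_atTop 0] with n hn
  rw [← sub_div, sub_sub_sub_cancel_right, abs_div, abs_of_pos hn, ← mul_div_assoc]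
  gcongr
  exact hF _ _

end ConeLevel

/-- An integer valued function on the metric group `X` whose level sets are the left cosets of
the image of `f`, and such that every level is at controlled distance. -/
structure IsLevelFunction {X Y : Type*} [Group X] [PseudoMetricSpace X] [Group Y] (f : Y →* X)
    (F : X → ℤ) (Λ K : ℝ) : Prop where
  isometry : ∀ g a b : X, dist (g * a) (g * b) = dist a b
  nonneg : 0 ≤ Λ
  nonneg' : 0 ≤ K
  lipschitz : ∀ a b, |(F a : ℝ) - F b| ≤ Λ * dist a b
  exists_eq : ∀ g k, ∃ g', F g' = k ∧ dist g g' ≤ K * |(F g : ℝ) - k|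
  exists_mul_map : ∀ g g', F g = F g' → ∃ h, g' = g * f h
  mul_map : ∀ g h, F (g * f h) = F g

/-- The asymptotic cones of a group with a level function are foliated by asymptotic cones of
the subgroup. -/
theorem IsLevelFunction.exists_isFoliated {X Y : Type*} [Group X] [PseudoMetricSpace X] [Group Y]
    [PseudoMetricSpace Y] {f : Y →* X} {F : X → ℤ} {Λ K L C : ℝ} (h : IsLevelFunction f F Λ K)
    (hL : 0 < L) (hf : ∀ a b, dist (f a) (f b) ≤ L * dist a b + C)
    (hf' : ∀ a b, dist a b ≤ L * dist (f a) (f b) + C) (ω : Ultrafilter ℕ) (e : ℕ → X) (d : ℕ → ℝ)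
    (hd : Tendsto d ω atTop) :
    ∃ ι : ℝ → AsymptoticCone Y ω (fun _ => (1 : Y)) d hd → AsymptoticCone X ω e d hd,
      IsFoliated (coneLevel F) ι L K := by
  have hK := h.nonneg'
  -- a point of the level `c`, for every `c`
  choose t ht htd using fun (c : ℝ) n => h.exists_eq (e n) (F (e n) + ⌊c * d n⌋)
  have hfl : ∀ x : ℝ, |(⌊x⌋ : ℝ) - x| ≤ 1 := fun x => by
    rw [abs_le]
    constructor <;> linarith [Int.floor_le x, Int.lt_floor_add_one x]
  have hte : ∀ c, ∀ᶠ n in (ω : Filter ℕ), dist (t c n) (e n) ≤ K * (|c| + 1) * d n := by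
    intro c
    filter_upwards [hd.eventually_ge_atTop 1] with n hn
    rw [dist_comm, mul_assoc]
    refine (htd c n).trans (mul_le_mul_of_nonneg_left ?_ hK)
    push_cast
    rw [sub_add_cancel_left, abs_neg]
    have h1 := hfl (c * d n)
    have h2 := abs_sub_abs_le_abs_sub (⌊c * d n⌋ : ℝ) (c * d n)
    rw [abs_mul, abs_of_nonneg (by linarith : 0 ≤ d n)] at h2
    linarith
  have hι : ∀ c, IsConeMap ω (fun _ => (1 : Y)) e d (fun n y => t c n * f y) L C
      (K * (|c| + 1)) := fun c =>
    { nonneg := hL.le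
      dist_le := fun n a b => by rw [h.isometry]; exact hf a b
      base := by simpa using hte c }
  have hclim : ∀ c : ℝ, Tendsto (fun n => (⌊c * d n⌋ : ℝ) / d n) ω (𝓝 c) := by
    intro c
    have h1 : Tendsto (fun n => ((⌊c * d n⌋ : ℝ) - c * d n) / d n) ω (𝓝 0) := by
      refine squeeze_zero_norm' (a := fun n => 1 / d n) ?_ (tendsto_const_nhds.div_atTop hd)
      filter_upwards [hd.eventually_gt_atTop 0] with n hn
      rw [Real.norm_eq_abs, abs_div, abs_of_pos hn]
      gcongr
      exact hfl _
    have h2 := h1.add_const c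
    rw [zero_add] at h2
    refine h2.congr' ?_
    filter_upwards [hd.eventually_gt_atTop 0] with n hn
    field_simp
    ring
  refine ⟨fun c => coneMap (hι c), hL, hK, continuous_coneLevel h.nonneg h.lipschitz,
    fun c y z => dist_coneMap_le (hι c) y z,
    fun c y z => le_dist_coneMap (hι c) (C' := C)
      (fun n a b => by rw [h.isometry]; exact hf' a b) y z,
    fun c y => ?_, fun x c => ?_⟩
  · refine tendsto_nhds_unique (tendsto_coneLevel_mk h.lipschitz _) ((hclim c).congr fun n => ?_)
    change _ = ((F (t c n * f ((AsymptoticCone.rep y).1 n)) : ℝ) - F (e n)) / d n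
    rw [h.mul_map, ht]
    push_cast
    rw [add_sub_cancel_left]
  · set w := AsymptoticCone.rep x with hw
    choose g hg hgd using fun n => h.exists_eq (w.1 n) (F (t c n))
    choose k hk using fun n => h.exists_mul_map (t c n) (g n) (hg n).symm
    have hlim : Tendsto (fun n => K * |((F (w.1 n) : ℝ) - F (e n)) / d n - ⌊c * d n⌋ / d n|) ω
        (𝓝 (K * |coneLevel F x - c|)) :=
      ((tendsto_coneLevel_rep h.lipschitz x).sub (hclim c)).abs.const_mul K
    have hdist : ∀ᶠ n in (ω : Filter ℕ), dist (w.1 n) (t c n * f (k n)) / d n ≤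
        K * |((F (w.1 n) : ℝ) - F (e n)) / d n - ⌊c * d n⌋ / d n| := by
      filter_upwards [hd.eventually_gt_atTop 0] with n hn
      rw [← hk, ← sub_div, abs_div, abs_of_pos hn, ← mul_div_assoc]
      gcongr
      refine (hgd n).trans_eq ?_
      rw [ht]
      push_cast
      rw [sub_sub]
    obtain ⟨M, hM⟩ := w.2
    have hbound : ∀ᶠ n in (ω : Filter ℕ), dist (k n) 1 ≤
        (L * (K * |coneLevel F x - c| + 1 + M + K * (|c| + 1)) + 1) * d n := by
      filter_upwards [hdist, hlim.eventually (gt_mem_nhds (lt_add_one _)), hM, hte c,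
        hd.eventually_gt_atTop 0, hd.eventually_ge_atTop C] with n h1 h2 h3 h4 h5 h6
      have h7 := hf' (k n) 1
      rw [← h.isometry (t c n), map_one, mul_one] at h7
      have h8 := h1.trans h2.le
      rw [div_le_iff₀ h5] at h8 h3
      have h9 := dist_triangle4 (t c n * f (k n)) (w.1 n) (e n) (t c n)
      rw [dist_comm (t c n * f (k n)) (w.1 n), dist_comm (e n)] at h9
      have h10 : dist (t c n * f (k n)) (t c n) ≤
          (K * |coneLevel F x - c| + 1 + M + K * (|c| + 1)) * d n := by linarith
      have h11 := mul_le_mul_of_nonneg_left h10 hL.le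
      linarith
    set q : ConeSequence Y ω (fun _ => (1 : Y)) d hd := ConeSequence.base.ofDistLE k hbound
    refine ⟨SeparationQuotient.mk q, ?_⟩
    rw [coneMap_mk, ← AsymptoticCone.mk_rep x, SeparationQuotient.dist_mk, AsymptoticCone.mk_rep]
    exact le_of_tendsto_of_tendsto (ConeSequence.tendsto_dist _ _) hlim hdist

/-- A group with a level function whose level sets are the cosets of a quasi-isometrically
embedded prairie group has simply connected asymptotic cones. -/
theorem satisfiesConeDichotomy_of_levels {G Y : Type*} [Group G] [Group Y] (f : Y →* G)
    (hY : IsPrairieGroup Y) (hf : IsQuasiIsometricallyEmbedded f) (F : G → ℤ)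
    (hF : ∀ s, ∃ c : ℕ, ∀ g, |F (g * s) - F g| ≤ c)
    (hstep : ∃ N : Set G, N.Finite ∧ ∀ g, (∃ s ∈ N, F (g * s) = F g + 1) ∧
      ∃ s ∈ N, F (g * s) = F g - 1)
    (hfib : ∀ g g', F g = F g' → ∃ h, g' = g * f h) (hfib' : ∀ g h, F (g * f h) = F g) :
    SatisfiesConeDichotomy G := by
  intro S hSf hS ω e d hd
  left
  obtain ⟨T, hT, hTf⟩ := Group.fg_iff.1 hY.1
  obtain ⟨L, C, hL, hC, hLC⟩ := hf.2.2 T hTf hT S hSf hS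
  have hL0 : 0 < L := by linarith
  -- the level function is Lipschitz
  choose c hc using hF
  have hlet : {s : G | s ∈ S ∨ s⁻¹ ∈ S}.Finite := hSf.union (hSf.preimage inv_injective.injOn)
  obtain ⟨Λ, hΛ⟩ := (hlet.image c).bddAbove
  have hΛ' : ∀ s, (s ∈ S ∨ s⁻¹ ∈ S) → c s ≤ Λ := fun s hs => hΛ ⟨s, hs, rfl⟩
  have hword : ∀ (l : List G), (∀ x ∈ l, x ∈ S ∨ x⁻¹ ∈ S) → ∀ g,
      |F g - F (g * l.prod)| ≤ Λ * l.length := by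
    intro l
    induction l with
    | nil => intro _ g; simp
    | cons a l ih =>
      intro hl g
      have h1 := ih (fun x hx => hl x (by simp [hx])) (g * a)
      have h2 := hc a g
      have h3 : (c a : ℤ) ≤ Λ := by exact_mod_cast hΛ' a (hl a (by simp))
      rw [List.prod_cons, ← mul_assoc, List.length_cons]
      push_cast
      rw [abs_sub_comm] at h2
      have h4 := abs_sub_le (F g) (F (g * a)) (F (g * a * l.prod))
      linarith
  have hlip : ∀ a b : G, |(F a : ℝ) - F b| ≤ Λ * dist (α := WordMetric S hS) a b := by
    intro a b
    have h1 := hword (WordMetric.geodesic hS a b) (WordMetric.mem_geodesic a b) a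
    rw [WordMetric.mul_prod_geodesic] at h1
    have h2 := WordMetric.length_geodesic (hS := hS) a b
    refine le_of_le_of_eq ?_ (congrArg (fun t : ℝ => (Λ : ℝ) * t) h2)
    exact_mod_cast h1
  -- neighbouring levels are at bounded distance
  obtain ⟨N, hNf, hN⟩ := hstep
  obtain ⟨K, hK⟩ := (hNf.image fun s => dist (α := WordMetric S hS) 1 s).bddAbove
  have hK' : ∀ s ∈ N, dist (α := WordMetric S hS) 1 s ≤ K := fun s hs => hK ⟨s, hs, rfl⟩
  have hNdist : ∀ g : G, ∀ s ∈ N, dist (α := WordMetric S hS) g (g * s : G) ≤ K := by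
    intro g s hs
    have h1 := WordMetric.dist_mul_left (hS := hS) g 1 s
    rw [mul_one] at h1
    exact h1.trans_le (hK' s hs)
  have hK0 : 0 ≤ K := by
    obtain ⟨s, hs, -⟩ := (hN 1).1
    exact dist_nonneg.trans (hK' s hs)
  have hex : ∀ (m : ℕ) (g : G) (k : ℤ), (F g - k).natAbs = m →
      ∃ g', F g' = k ∧ dist (α := WordMetric S hS) g g' ≤ K * m := by
    intro m
    induction m with
    | zero =>
      intro g k hk
      exact ⟨g, by omega, (dist_self (α := WordMetric S hS) g).le.trans (by simp)⟩
    | succ m ih =>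
      intro g k hk
      obtain ⟨s, hs, hgs⟩ : ∃ s ∈ N, (F (g * s) - k).natAbs = m := by
        rcases le_total k (F g) with h1 | h1
        · obtain ⟨s, hs, h2⟩ := (hN g).2
          exact ⟨s, hs, by omega⟩
        · obtain ⟨s, hs, h2⟩ := (hN g).1
          exact ⟨s, hs, by omega⟩
      obtain ⟨g', hg', hd'⟩ := ih _ _ hgs
      refine ⟨g', hg', ?_⟩
      have h1 := hNdist g s hs
      have h2 := dist_triangle (α := WordMetric S hS) g (g * s : G) g'
      push_cast
      linarith
  let f' : WordMetric T hT →* WordMetric S hS := f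
  have hlev : IsLevelFunction (X := WordMetric S hS) f' F Λ K :=
    { isometry := WordMetric.dist_mul_left
      nonneg := Nat.cast_nonneg _
      nonneg' := hK0
      lipschitz := hlip
      exists_eq := fun g k => by
        obtain ⟨g', h1, h2⟩ := hex _ g k rfl
        refine ⟨g', h1, h2.trans_eq ?_⟩
        rw [Nat.cast_natAbs]
        push_cast
        rfl
      exists_mul_map := hfib
      mul_map := hfib' }
  have hcomb := WordMetric.isCombing_comb (S := S) (hS := hS)
  obtain ⟨n, hn, R, -, hdiv⟩ := exists_loopDivision (X := WordMetric S hS) hcomb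
    (fun ω e d hd => by
      obtain ⟨ι, hι⟩ := hlev.exists_isFoliated (L := L) (C := L * C) hL0
        (fun a b => (hLC a b).2.trans (by
          have : C ≤ L * C := le_mul_of_one_le_left hC hL
          linarith))
        (fun a b => by
          have h1 := (hLC a b).1
          rw [sub_le_iff_le_add, div_le_iff₀ hL0] at h1
          refine h1.trans_eq ?_
          change _ = L * dist (α := WordMetric S hS) (f a) (f b) + L * C
          ring) ω e d hd
      obtain ⟨C₀, hC₀⟩ := hY.exists_uniformExtension hTf hT (ω := ω) (e := fun _ => 1) (hd := hd)
      exact hι.almostFillable hC₀) 4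
  obtain ⟨C₁, hC₁⟩ := hdiv.exists_uniformExtension (ω := ω) (e := e) (d := d) (hd := hd) hn hcomb
  have := pathConnectedSpace_cone (ω := ω) (e := e) (d := d) (hd := hd) hcomb
  exact hC₁.simplyConnectedSpace

/-! ### Amalgamated products over subgroups of index two -/

namespace Monoid.PushoutI

open NormalWord

section IndexTwo

variable {A : Bool → Type*} [∀ i, Group (A i)] {H : Type*} [Group H] {φ : ∀ i, H →* A i}

/-- The action on the integers of a group with a subgroup of index two: the elements outside of the
subgroup act by the reflection `n ↦ c - n`. -/
noncomputable def reflectionHom {B : Type*} [Group B] (U : Subgroup B)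
    (hU : ∀ a b, a ∉ U → b ∉ U → a⁻¹ * b ∈ U) (c : ℤ) : B →* Equiv.Perm ℤ := by
  classical
  exact
  { toFun := fun a => if a ∈ U then 1 else Equiv.subLeft c
    map_one' := if_pos U.one_mem
    map_mul' := fun a b => by
      by_cases ha : a ∈ U
      · simp [ha, Subgroup.mul_mem_cancel_left]
      · by_cases hb : b ∈ U
        · simp [ha, hb, Subgroup.mul_mem_cancel_right]
        · have h := hU a⁻¹ b (by rwa [inv_mem_iff]) hb
          rw [inv_inv] at h
          rw [if_pos h, if_neg ha, if_neg hb]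
          ext n
          simp }

theorem reflectionHom_apply_of_mem {B : Type*} [Group B] {U : Subgroup B}
    (hU : ∀ a b, a ∉ U → b ∉ U → a⁻¹ * b ∈ U) (c : ℤ) {a : B} (ha : a ∈ U) :
    reflectionHom U hU c a = 1 := if_pos ha

theorem reflectionHom_apply_of_notMem {B : Type*} [Group B] {U : Subgroup B}
    (hU : ∀ a b, a ∉ U → b ∉ U → a⁻¹ * b ∈ U) (c : ℤ) {a : B} (ha : a ∉ U) (n : ℤ) :
    reflectionHom U hU c a n = c - n := by
  have h : reflectionHom U hU c a = Equiv.subLeft c := if_neg ha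
  rw [h]
  rfl

/-- The action of the amalgamated product on the integers: the two factors act through
reflections with different centres. -/
noncomputable def lineHom (hidx : ∀ i, ∀ a b, a ∉ (φ i).range → b ∉ (φ i).range →
    a⁻¹ * b ∈ (φ i).range) : PushoutI φ →* Equiv.Perm ℤ :=
  lift (fun i => reflectionHom (φ i).range (hidx i) (bif i then -1 else 1)) 1 fun i => by
    ext1 h
    exact reflectionHom_apply_of_mem (hidx i) _ ⟨h, rfl⟩

variable {hidx : ∀ i, ∀ a b, a ∉ (φ i).range → b ∉ (φ i).range → a⁻¹ * b ∈ (φ i).range}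

theorem lineHom_of {i : Bool} {a : A i} (ha : a ∉ (φ i).range) (n : ℤ) :
    lineHom hidx (of i a) n = (bif i then -1 else 1) - n := by
  rw [lineHom, lift_of, reflectionHom_apply_of_notMem _ _ ha]

theorem lineHom_base (h : H) (n : ℤ) : lineHom hidx (base φ h) n = n := by
  rw [lineHom, lift_base]
  rfl

theorem natAbs_lineHom_sub (g : PushoutI φ) (m n : ℤ) :
    (lineHom hidx g m - lineHom hidx g n).natAbs = (m - n).natAbs := by
  induction g using induction_on generalizing m n with
  | of i a =>
    by_cases ha : a ∈ (φ i).range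
    · obtain ⟨h, rfl⟩ := ha
      rw [of_apply_eq_base, lineHom_base, lineHom_base]
    · rw [lineHom_of ha, lineHom_of ha]
      omega
  | base h => rw [lineHom_base, lineHom_base]
  | mul x y hx hy => rw [map_mul, Equiv.Perm.mul_apply, Equiv.Perm.mul_apply, hx, hy]

/-- The stabilizer of `0` is the base group: an element whose normal form begins with a letter of
one of the factors moves `0` to one of the two sides. -/
theorem exists_base_of_lineHom_zero (hφ : ∀ i, Function.Injective (φ i)) {g : PushoutI φ}
    (hg : lineHom hidx g 0 = 0) : ∃ h, g = base φ h := by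
  classical
  obtain ⟨d⟩ := transversal_nonempty φ hφ
  have key : (∃ h, g = base φ h ∧ lineHom hidx g 0 = 0) ∨
      (g ∈ leading d false ∧ 1 ≤ lineHom hidx g 0) ∨
      (g ∈ leading d true ∧ lineHom hidx g 0 ≤ -1) := by
    clear hg
    induction g using reduced_induction (d := d) with
    | base h => exact Or.inl ⟨h, rfl, lineHom_base h 0⟩
    | cons i a g ha hgi ih =>
      right
      have h1 := of_mul_mem_leading ha hgi
      rw [map_mul, Equiv.Perm.mul_apply, lineHom_of ha]
      rcases i with _ | _
      · refine Or.inl ⟨h1, ?_⟩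
        rcases ih with ⟨h, -, h2⟩ | ⟨h2, -⟩ | ⟨-, h2⟩
        · rw [h2]; simp
        · exact absurd h2 hgi
        · rw [cond_false]; omega
      · refine Or.inr ⟨h1, ?_⟩
        rcases ih with ⟨h, -, h2⟩ | ⟨-, h2⟩ | ⟨h2, -⟩
        · rw [h2]; simp
        · rw [cond_true]; omega
        · exact absurd h2 hgi
  rcases key with ⟨h, h1, -⟩ | ⟨-, h1⟩ | ⟨-, h1⟩
  · exact ⟨h, h1⟩
  · omega
  · omega

/-- If the edge group has index two in both factors, the orbit map `g ↦ g • 0` of the action on the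
integers is a level function. -/
theorem satisfiesConeDichotomy_of_index_two (hφ : ∀ i, Function.Injective (φ i))
    (hφt : ∀ i, (φ i).range ≠ ⊤) (hH : IsPrairieGroup H)
    (hq : IsQuasiIsometricallyEmbedded (base φ))
    (hidx : ∀ i, ∀ a b, a ∉ (φ i).range → b ∉ (φ i).range → a⁻¹ * b ∈ (φ i).range) :
    SatisfiesConeDichotomy (PushoutI φ) := by
  have hex : ∀ i, ∃ a, a ∉ (φ i).range := by
    intro i
    by_contra! h
    exact hφt i ((Subgroup.eq_top_iff' _).2 h)
  choose b hb using hex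
  have hmul : ∀ g s : PushoutI φ, lineHom hidx (g * s) 0 = lineHom hidx g (lineHom hidx s 0) :=
    fun g s => by rw [map_mul, Equiv.Perm.mul_apply]
  refine satisfiesConeDichotomy_of_levels (base φ) hH hq (fun g => lineHom hidx g 0)
    (fun s => ⟨(lineHom hidx s 0).natAbs, fun g => ?_⟩)
    ⟨{of false (b false), of true (b true)}, Set.toFinite _, fun g => ?_⟩
    (fun g g' hgg => ?_) fun g h => ?_
  · have h1 := natAbs_lineHom_sub (hidx := hidx) g (lineHom hidx s 0) 0
    simp only [hmul]
    rw [Int.abs_eq_natAbs, h1, sub_zero]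
  · simp only [hmul, Set.mem_insert_iff, Set.mem_singleton_iff, exists_eq_or_imp,
      exists_eq_left, lineHom_of (hb _), cond_true, cond_false, sub_zero]
    have h1 := natAbs_lineHom_sub (hidx := hidx) g 1 0
    have h2 := natAbs_lineHom_sub (hidx := hidx) g (-1) 0
    have h3 := natAbs_lineHom_sub (hidx := hidx) g 1 (-1)
    omega
  · obtain ⟨h, hh⟩ := exists_base_of_lineHom_zero (hidx := hidx) hφ (g := g⁻¹ * g') (by
      rw [hmul, ← hgg, ← hmul, inv_mul_cancel, map_one, Equiv.Perm.one_apply])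
    exact ⟨h, by rw [← hh, mul_inv_cancel_left]⟩
  · simp only [hmul, lineHom_base]

end IndexTwo

/-- The dichotomy for the asymptotic cones of an amalgamated product. -/
theorem satisfiesConeDichotomy {A : Bool → Type*} [∀ i, Group (A i)] {H : Type*} [Group H]
    {φ : ∀ i, H →* A i} (hφ : ∀ i, Function.Injective (φ i)) (hφt : ∀ i, (φ i).range ≠ ⊤)
    (hH : IsPrairieGroup H) (hq : IsQuasiIsometricallyEmbedded (base φ)) :
    SatisfiesConeDichotomy (PushoutI φ) := by
  classical
  by_cases hidx : ∀ i, ∀ a b, a ∉ (φ i).range → b ∉ (φ i).range → a⁻¹ * b ∈ (φ i).range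
  · exact satisfiesConeDichotomy_of_index_two hφ hφt hH hq hidx
  · push Not at hidx
    obtain ⟨i, a', a, ha', ha, haa⟩ := hidx
    obtain ⟨b, hb⟩ : ∃ b, b ∉ (φ (!i)).range := by
      by_contra! h
      exact hφt _ ((Subgroup.eq_top_iff' _).2 h)
    exact satisfiesConeDichotomy_of_index hφ hH hq (by simp) ha ha' haa hb

end Monoid.PushoutI

/-- The first part is about the HNN extension of `A` with associated subgroups `H` and `K` and
`t h t⁻¹ = φ h` for `h ∈ H`; the second part is about the amalgamated product of the two groups
`A false` and `A true` along the images in them of `H`. -/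
theorem mainTheorem2 :
    (∀ (A : Type u) [Group A] (H K : Subgroup A) (φ : H ≃* K),
      H ≠ ⊤ → K ≠ ⊤ →
      IsPrairieGroup H → IsPrairieGroup K →
      IsQuasiIsometricallyEmbedded
        ((HNNExtension.of : A →* HNNExtension A H K φ).comp H.subtype) →
      IsQuasiIsometricallyEmbedded
        ((HNNExtension.of : A →* HNNExtension A H K φ).comp K.subtype) →
      SatisfiesConeDichotomy (HNNExtension A H K φ)) ∧
    (∀ (A : Bool → Type v) [∀ i, Group (A i)] (H : Type w) [Group H] (ι : ∀ i, H →* A i),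
      (∀ i, Function.Injective (ι i)) →
      (∀ i, (ι i).range ≠ ⊤) →
      IsPrairieGroup H →
      IsQuasiIsometricallyEmbedded (Monoid.PushoutI.base ι) →
      SatisfiesConeDichotomy (Monoid.PushoutI ι)) := by
  refine ⟨fun A _ H K φ _ hK _ hKp _ hKq => HNNExtension.satisfiesConeDichotomy hK hKp hKq,
    fun A _ H _ ι hι hιt hH hq => Monoid.PushoutI.satisfiesConeDichotomy hι hιt hH hq⟩
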